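/- Let $m\ge 1$, $n\ge 0$, and let $\pi\colon E\to M$ be a smooth surjective submersion between smooth (Hausdorff) manifolds with $\dim M=m$ and $\dim E=m+n$. For a surjective submersion $q\colon P\to M$ let $\Lambda^k_rP$ be the bundle of $k$-forms on $P$ that vanish whenever $r$ of their arguments are $q$-vertical, with its tautological form $\Theta$ ($\Theta(\omega)$ is the pullback of $\omega$ under the derivative of the projection $\Lambda^k_rP\to P$) and its canonical $(k+1)$-form $-d\Theta$. Put $\mathcal M\pi=\Lambda^m_2E$ and $\mathcal M^\circ\pi=\Lambda^m_2E/\Lambda^m_1E$, with projections $\nu\colon\mathcal M\pi\to E$, $\nu^\circ\colon\mathcal M^\circ\pi\to E$ and $\mu\colon\mathcal M\pi\to\mathcal M^\circ\pi$, and let $\Omega$ be the canonical $(m+1)$-form on $\mathcal M\pi$. Let $h$ be a Hamiltonian section, i.e. a smooth section of $\mu$, and let $\mathcal H(\omega)=\omega-h(\mu(\omega))\in\Lambda^m_1E$ be its Hamiltonian density, regarded via $\nu^*$ as an $m$-form on $\mathcal M\pi$. For $z\in J^1(\pi\circ\nu)$ over $\omega\in\mathcal M\pi$, i.e. a linear right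 inverse $z\colon T_{\pi(\nu(\omega))}M\to T_\omega\mathcal M\pi$ of $T_\omega(\pi\circ\nu)$, put $\mathbf h_z=z\circ T_\omega(\pi\circ\nu)$ and $$\flat_\Omega(z)=i_{\mathbf h_z}\Omega(\omega)-(m-1)\Omega(\omega)\in\Lambda^{m+1}_2\mathcal M\pi,\qquad (i_{\mathbf h_z}\Omega)(X_1,\dots,X_{m+1})=\sum_i\Omega(X_1,\dots,\mathbf h_z X_i,\dots,X_{m+1}),$$ where $\Lambda^{m+1}_2\mathcal M\pi$ refers to the submersion $\pi\circ\nu\colon\mathcal M\pi\to M$. Let $\widetilde\Omega$ be the $(m+2)$-form on $J^1(\pi\circ\nu)$ obtained by pulling back the canonical form of $\Lambda^{m+1}_2\mathcal M\pi$ by $\flat_\Omega$, and let $S_{\mathcal H}=\flat_\Omega^{-1}(-d\mathcal H(\mathcal M\pi))$. A submanifold $S$ is $l$-Lagrangian for a $(k+1)$-form $\widetilde\Omega$ if at each of its points the image $W$ of the tangent space of $S$ in the quotient by $\{v: i_v\widetilde\Omega=0\}$ satisfies $W=\{v:\ i_{v\wedge w_1\wedge\dots\wedge w_l}\widetilde\Omega'=0\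 \ \forall w_1,\dots,w_l\in W\}$, where $\widetilde\Omega'$ is the form induced by $\widetilde\Omega$ on the quotient. Fibred coordinates $(x^i,u^\alpha)$ on $E$ induce coordinates $(x^i,u^\alpha,p,p^i_\alpha)$ on $\mathcal M\pi$ by $\omega=p\,d^mx+p^i_\alpha\,du^\alpha\wedge d^{m-1}x_i$ with $d^mx=dx^1\wedge\dots\wedge dx^m$ and $d^{m-1}x_i=i_{\partial/\partial x^i}d^mx$, coordinates $(x^i,u^\alpha,p^i_\alpha)$ on $\mathcal M^\circ\pi$, and jet coordinates $(x^i,u^\alpha,p,p^i_\alpha,u^\alpha_j,p_j,p^i_{\alpha j})$ on $J^1(\pi\circ\nu)$; the local Hamiltonian function $H$ is defined by $h(x,u,p^i_\alpha)=(x,u,p=-H(x,u,p^i_\alpha),p^i_\alpha)$. Then: 1. A smooth section $\tau$ of $\pi\circ\nu^\circ\colon\mathcal M^\circ\pi\to M$ over an open subset of $M$ solves the Hamilton-De Donder-Weyl equation, i.e. $(h\circ\tau)^*i_X(\Omega+d\mathcal H)=0$ for every smooth vector field $X$ on $\mathcal M\pi$, if and only if $\flat_\Omega\circ j^1(h\circ\tau)=-d\mathcal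 H\circ(h\circ\tau)$. 2. $S_{\mathcal H}$ is an $(m+1)$-Lagrangian submanifold of $(J^1(\pi\circ\nu),\widetilde\Omega)$. In the domain of each induced chart it is the submanifold cut out by the independent equations $$u^\alpha_j=\frac{\partial H}{\partial p^j_\alpha},\qquad \sum_j p^j_{\alpha j}=-\frac{\partial H}{\partial u^\alpha},$$ and these are Hamilton's equations: for every local section $\sigma$ of $\pi\circ\nu$ and every $x$ in its domain with $\nu(\sigma(x))$ in the coordinate domain, $j^1\sigma(x)$ satisfies them if and only if $\tau=\mu\circ\sigma$ satisfies at $x$ $$\frac{\partial(u^\alpha\circ\tau)}{\partial x^i}=\frac{\partial H}{\partial p^i_\alpha}\circ\tau,\qquad \sum_i\frac{\partial(p^i_\alpha\circ\tau)}{\partial x^i}=-\frac{\partial H}{\partial u^\alpha}\circ\tau .$$ -/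

import Mathlib

open Set Filter Manifold
open scoped Topology ContDiff

noncomputable section

abbrev Base (m : ℕ) := EuclideanSpace ℝ (Fin m)

/-- The alternating `k`-forms `α` on `V` that are `r`-horizontal with respect to `L : V → W`:
`α` vanishes as soon as `r` of its arguments are vertical, i.e. lie in `ker L`. -/
def horizontalForms {V W : Type*} [AddCommGroup V] [Module ℝ V] [TopologicalSpace V]
    [AddCommGroup W] [Module ℝ W] [TopologicalSpace W] (L : V →L[ℝ] W) (r k : ℕ) :
    Submodule ℝ (V [⋀^Fin k]→L[ℝ] ℝ) where
  carrier := {α | ∀ v : Fin k → V,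
    (∃ s : Finset (Fin k), s.card = r ∧ ∀ i ∈ s, L (v i) = 0) → α v = 0}
  add_mem' := by
    intro a b ha hb v hv
    simp [ha v hv, hb v hv]
  zero_mem' := by
    intro v _
    rfl
  smul_mem' := by
    intro c a ha v hv
    simp [ha v hv]

theorem horizontalForms.comp_mem {V W V' W' : Type*} [AddCommGroup V] [Module ℝ V]
    [TopologicalSpace V] [AddCommGroup W] [Module ℝ W] [TopologicalSpace W]
    [AddCommGroup V'] [Module ℝ V'] [TopologicalSpace V']
    [AddCommGroup W'] [Module ℝ W'] [TopologicalSpace W']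
    {L : V →L[ℝ] W} {L' : V' →L[ℝ] W'} {r k : ℕ} {α : V [⋀^Fin k]→L[ℝ] ℝ}
    (hα : α ∈ horizontalForms L r k) (N : V' →L[ℝ] V) (hN : ∀ v, L' v = 0 → L (N v) = 0) :
    α.compContinuousLinearMap N ∈ horizontalForms L' r k := by
  rintro v ⟨s, hs, hv⟩
  exact hα _ ⟨s, hs, fun i hi => hN _ (hv i hi)⟩

instance finiteDimensional_continuousMultilinear {V : Type*} [NormedAddCommGroup V]
    [NormedSpace ℝ V] [FiniteDimensional ℝ V] (k : ℕ) :
    FiniteDimensional ℝ (ContinuousMultilinearMap ℝ (fun _ : Fin k => V) ℝ) :=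
  Module.Finite.of_injective
    (ContinuousMultilinearMap.toMultilinearMapLinear :
      ContinuousMultilinearMap ℝ (fun _ : Fin k => V) ℝ →ₗ[ℝ] _)
    ContinuousMultilinearMap.toMultilinearMap_injective

instance finiteDimensional_forms {V : Type*} [NormedAddCommGroup V]
    [NormedSpace ℝ V] [FiniteDimensional ℝ V] (k : ℕ) :
    FiniteDimensional ℝ (V [⋀^Fin k]→L[ℝ] ℝ) :=
  Module.Finite.of_injective
    (ContinuousAlternatingMap.toContinuousMultilinearMapCLM ℝ :
      (V [⋀^Fin k]→L[ℝ] ℝ) →L[ℝ] _).toLinearMap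
    ContinuousAlternatingMap.toContinuousMultilinearMap_injective

theorem contDiffOn_of_injective_comp {X Y Z : Type*} [NormedAddCommGroup X] [NormedSpace ℝ X]
    [NormedAddCommGroup Y] [NormedSpace ℝ Y] [NormedAddCommGroup Z] [NormedSpace ℝ Z]
    [FiniteDimensional ℝ Z] (ι : Y →ₗ[ℝ] Z) (hι : Function.Injective ι) {s : Set X} {f : X → Y}
    (hf : ContDiffOn ℝ ∞ (fun x => ι (f x)) s) : ContDiffOn ℝ ∞ f s := by
  obtain ⟨g, hg⟩ := LinearMap.exists_leftInverse_of_injective ι (LinearMap.ker_eq_bot.2 hι)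
  have : f = fun x => g.toContinuousLinearMap (ι (f x)) := by
    funext x
    exact (LinearMap.congr_fun hg (f x)).symm
  rw [this]
  exact g.toContinuousLinearMap.contDiff.comp_contDiffOn hf

/-- A map into a space of horizontal forms is smooth if it is smooth as a map into the space of
all multilinear forms. -/
theorem horizontalForms.contDiffOn {V W X : Type*} [NormedAddCommGroup V] [NormedSpace ℝ V]
    [FiniteDimensional ℝ V] [NormedAddCommGroup W] [NormedSpace ℝ W]
    [NormedAddCommGroup X] [NormedSpace ℝ X] {L : V →L[ℝ] W} {r k : ℕ} {s : Set X}
    {f : X → horizontalForms L r k}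
    (hf : ContDiffOn ℝ ∞ (fun x => (f x).1.toContinuousMultilinearMap) s) :
    ContDiffOn ℝ ∞ f s := by
  let ι : horizontalForms L r k →ₗ[ℝ] ContinuousMultilinearMap ℝ (fun _ : Fin k => V) ℝ :=
    (ContinuousAlternatingMap.toContinuousMultilinearMapCLM ℝ :
      (V [⋀^Fin k]→L[ℝ] ℝ) →L[ℝ] _).toLinearMap ∘ₗ (horizontalForms L r k).subtype
  have hι : Function.Injective ι :=
    ContinuousAlternatingMap.toContinuousMultilinearMap_injective.comp Subtype.val_injective
  exact contDiffOn_of_injective_comp (Y := horizontalForms L r k)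
    (Z := ContinuousMultilinearMap ℝ (fun _ : Fin k => V) ℝ) ι hι hf

theorem contDiffOn_form_comp {V X : Type*} [NormedAddCommGroup V] [NormedSpace ℝ V]
    [NormedAddCommGroup X] [NormedSpace ℝ X] {k : ℕ} {s : Set X}
    {a : X → V [⋀^Fin k]→L[ℝ] ℝ} {N : X → V →L[ℝ] V}
    (ha : ContDiffOn ℝ ∞ a s) (hN : ContDiffOn ℝ ∞ N s) :
    ContDiffOn ℝ ∞
      (fun x => ((a x).compContinuousLinearMap (N x)).toContinuousMultilinearMap) s := by
  have h1 : ContDiffOn ℝ ∞ (fun x =>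
      ContinuousMultilinearMap.compContinuousLinearMapContinuousMultilinear ℝ
        (fun _ : Fin k => V) (fun _ : Fin k => V) ℝ (fun _ => N x)) s :=
    (ContinuousMultilinearMap.contDiff _).comp_contDiffOn (contDiffOn_pi.2 fun _ => hN)
  have h2 : ContDiffOn ℝ ∞ (fun x => (a x).toContinuousMultilinearMap) s :=
    (ContinuousAlternatingMap.toContinuousMultilinearMapCLM ℝ :
      (V [⋀^Fin k]→L[ℝ] ℝ) →L[ℝ] _).contDiff.comp_contDiffOn ha
  exact h1.clm_apply h2


/-- `p : P → M` is a smooth surjective submersion onto the `m`-dimensional manifold `M`, with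
fibres modelled on `F`. -/
class IsFibration (m : ℕ) (F : Type*) [NormedAddCommGroup F] [NormedSpace ℝ F] {P M : Type*}
    [TopologicalSpace M] [ChartedSpace (Base m) M]
    [TopologicalSpace P] [ChartedSpace (Base m × F) P] (p : P → M) : Prop where
  surjective : Function.Surjective p
  submersion : IsSubmersion 𝓘(ℝ, Base m × F) 𝓘(ℝ, Base m) ∞ p

/-- Fibred coordinates `(x, u)` on `P` over coordinates `x` on `M`. -/
structure AdaptedChart (m : ℕ) (F : Type*) [NormedAddCommGroup F] [NormedSpace ℝ F] {P M : Type*}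
    [TopologicalSpace M] [ChartedSpace (Base m) M]
    [TopologicalSpace P] [ChartedSpace (Base m × F) P] (p : P → M) where
  total : OpenPartialHomeomorph P (Base m × F)
  base : OpenPartialHomeomorph M (Base m)
  total_mem : total ∈ IsManifold.maximalAtlas 𝓘(ℝ, Base m × F) ∞ P
  base_mem : base ∈ IsManifold.maximalAtlas 𝓘(ℝ, Base m) ∞ M
  map_source : ∀ e ∈ total.source, p e ∈ base.source
  fst_total : ∀ e ∈ total.source, (total e).1 = base (p e)

section Adapted

variable {m : ℕ} {F : Type*} [NormedAddCommGroup F] [NormedSpace ℝ F] {P M : Type*}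
  [TopologicalSpace M] [ChartedSpace (Base m) M]
  [TopologicalSpace P] [ChartedSpace (Base m × F) P] [IsManifold 𝓘(ℝ, Base m × F) ∞ P]
  {p : P → M}

theorem AdaptedChart.exists_mem_source [FiniteDimensional ℝ F] [hp : IsFibration m F p] (e : P) :
    ∃ c : AdaptedChart m F p, e ∈ c.total.source := by
  have h : IsSubmersionAt 𝓘(ℝ, Base m × F) 𝓘(ℝ, Base m) ∞ p e :=
    hp.submersion.isSubmersionAt e
  let L := h.equiv
  have : FiniteDimensional ℝ (Base m × h.complement) :=
    Module.Finite.equiv L.toLinearEquiv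
  have : FiniteDimensional ℝ h.complement :=
    Module.Finite.of_surjective (LinearMap.snd ℝ (Base m) h.complement)
      LinearMap.snd_surjective
  have hr : Module.finrank ℝ h.complement = Module.finrank ℝ F := by
    have := L.toLinearEquiv.finrank_eq
    rw [Module.finrank_prod, Module.finrank_prod] at this
    omega
  let j : h.complement ≃L[ℝ] F := ContinuousLinearEquiv.ofFinrankEq hr
  let Φ : (Base m × F) ≃L[ℝ] (Base m × F) :=
    L.trans ((ContinuousLinearEquiv.refl ℝ (Base m)).prodCongr j)
  have hφ := h.domChart_mem_maximalAtlas
  refine ⟨⟨h.domChart.trans Φ.toHomeomorph.toOpenPartialHomeomorph, h.codChart, ?_,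
    h.codChart_mem_maximalAtlas, ?_, ?_⟩, by simpa using h.mem_domChart_source⟩
  · rw [IsManifold.mem_maximalAtlas_iff_contMDiffOn] at hφ ⊢
    refine ⟨?_, ?_⟩
    · have := Φ.contDiff.contMDiff (n := ∞).comp_contMDiffOn hφ.1
      simpa using this
    · have := hφ.2.comp (Φ.symm.contDiff.contMDiff (n := ∞).contMDiffOn
        (s := (h.domChart.trans Φ.toHomeomorph.toOpenPartialHomeomorph).target))
        (by intro x hx; simpa using hx)
      exact this
  · intro e' he'
    exact h.source_subset_preimage_source (by simpa using he')
  · intro e' he'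
    have he'' : e' ∈ h.domChart.source := by simpa using he'
    have ht : h.domChart e' ∈ (h.domChart.extend 𝓘(ℝ, Base m × F)).target := by
      simpa using h.domChart.map_source he''
    have := h.writtenInCharts ht
    simp [h.domChart.left_inv he''] at this
    simpa [Φ] using this.symm

end Adapted

/-- Fibre coordinates with values in `G` on `q : T → P` attached to every fibred chart
`c = (x, u)` of `p : P → M`, with smooth coordinate changes.  Together with `(x, u)` they form the
charts `(x, (u, g))` of a manifold structure on `T`. -/
structure FibreCoordinates (m : ℕ) (F : Type*) [NormedAddCommGroup F] [NormedSpace ℝ F]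
    (G : Type*) [NormedAddCommGroup G] [NormedSpace ℝ G] {P M T : Type*}
    [TopologicalSpace M] [ChartedSpace (Base m) M]
    [TopologicalSpace P] [ChartedSpace (Base m × F) P] (p : P → M) (q : T → P) where
  coord : AdaptedChart m F p → T → G
  point : AdaptedChart m F p → Base m × F → G → T
  proj_point : ∀ c y g, y ∈ c.total.target → q (point c y g) = c.total.symm y
  coord_point : ∀ c y g, y ∈ c.total.target → coord c (point c y g) = g
  point_coord : ∀ c t, q t ∈ c.total.source → point c (c.total (q t)) (coord c t) = t
  smooth : ∀ c c' : AdaptedChart m F p,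
    ContDiffOn ℝ ∞ (fun w : (Base m × F) × G => coord c' (point c w.1 w.2))
      (Prod.fst ⁻¹' (c.total.symm.trans c'.total).source)

namespace AdaptedChart

variable {m : ℕ} {F : Type*} [NormedAddCommGroup F] [NormedSpace ℝ F] {P M : Type*}
  [TopologicalSpace M] [ChartedSpace (Base m) M]
  [TopologicalSpace P] [ChartedSpace (Base m × F) P] {p : P → M}

theorem contDiffOn_transition (c c' : AdaptedChart m F p) :
    ContDiffOn ℝ ∞ (c'.total ∘ c.total.symm) (c.total.symm.trans c'.total).source := by
  have h1 := contMDiffOn_of_mem_maximalAtlas c'.total_mem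
  have h2 := contMDiffOn_symm_of_mem_maximalAtlas c.total_mem
  have := h1.comp' h2
  rw [contMDiffOn_iff_contDiffOn] at this
  exact this

end AdaptedChart

namespace FibreCoordinates

variable {m : ℕ} {F G : Type*} [NormedAddCommGroup F] [NormedSpace ℝ F]
  [NormedAddCommGroup G] [NormedSpace ℝ G] {P M T : Type*}
  [TopologicalSpace M] [ChartedSpace (Base m) M]
  [TopologicalSpace P] [ChartedSpace (Base m × F) P] {p : P → M} {q : T → P}
  (fam : FibreCoordinates m F G p q)

/-- The chart `t ↦ (x, (u, g))` of `T`. -/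
def chart (c : AdaptedChart m F p) : PartialEquiv T (Base m × (F × G)) where
  toFun t := ((c.total (q t)).1, ((c.total (q t)).2, fam.coord c t))
  invFun w := fam.point c (w.1, w.2.1) w.2.2
  source := q ⁻¹' c.total.source
  target := {w | (w.1, w.2.1) ∈ c.total.target}
  map_source' t ht := c.total.map_source ht
  map_target' w hw := by
    have hw' : (w.1, w.2.1) ∈ c.total.target := hw
    simpa [fam.proj_point c _ _ hw'] using c.total.map_target hw'
  left_inv' t ht := fam.point_coord c t ht
  right_inv' w hw := by
    have hw' : (w.1, w.2.1) ∈ c.total.target := hw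
    simp [fam.proj_point c _ _ hw', fam.coord_point c _ _ hw', c.total.right_inv hw']

theorem chart_trans_source (c c' : AdaptedChart m F p) :
    ((fam.chart c).symm.trans (fam.chart c')).source =
      (fun w : Base m × (F × G) => (w.1, w.2.1)) ⁻¹' (c.total.symm.trans c'.total).source := by
  ext w
  simp only [PartialEquiv.trans_source, PartialEquiv.symm_source, mem_inter_iff, mem_preimage,
    OpenPartialHomeomorph.trans_source, OpenPartialHomeomorph.symm_source]
  refine and_congr_right fun hw => ?_
  have hw' : (w.1, w.2.1) ∈ c.total.target := hw
  change q (fam.point c (w.1, w.2.1) w.2.2) ∈ c'.total.source ↔ _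
  rw [fam.proj_point c _ _ hw']

theorem contDiffOn_chart_trans (c c' : AdaptedChart m F p) :
    ContDiffOn ℝ ∞ ((fam.chart c).symm.trans (fam.chart c'))
      ((fam.chart c).symm.trans (fam.chart c')).source := by
  rw [chart_trans_source]
  have h0 : ContDiff ℝ ∞ (fun w : Base m × (F × G) => (w.1, w.2.1)) := by fun_prop
  have h0' : ContDiff ℝ ∞ (fun w : Base m × (F × G) => ((w.1, w.2.1), w.2.2)) := by fun_prop
  have h1 : ContDiffOn ℝ ∞ (fun w : Base m × (F × G) => c'.total (c.total.symm (w.1, w.2.1)))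
      ((fun w : Base m × (F × G) => (w.1, w.2.1)) ⁻¹' (c.total.symm.trans c'.total).source) :=
    (c.contDiffOn_transition c').comp h0.contDiffOn fun _ h => h
  have h2 : ContDiffOn ℝ ∞ (fun w : Base m × (F × G) =>
        fam.coord c' (fam.point c (w.1, w.2.1) w.2.2))
      ((fun w : Base m × (F × G) => (w.1, w.2.1)) ⁻¹' (c.total.symm.trans c'.total).source) :=
    (fam.smooth c c').comp h0'.contDiffOn fun _ h => h
  refine (h1.fst.prodMk (h1.snd.prodMk h2)).congr fun w hw => ?_
  have hw' : (w.1, w.2.1) ∈ c.total.target := hw.1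
  change ((c'.total (q (fam.point c (w.1, w.2.1) w.2.2))).1,
    ((c'.total (q (fam.point c (w.1, w.2.1) w.2.2))).2, _)) = _
  rw [fam.proj_point c _ _ hw']
  rfl

variable [FiniteDimensional ℝ F] [IsManifold 𝓘(ℝ, Base m × F) ∞ P] [IsFibration m F p]

/-- The atlas of all charts `fam.chart c`. -/
def core : ChartedSpaceCore (Base m × (F × G)) T where
  atlas := range fam.chart
  chartAt t := fam.chart (AdaptedChart.exists_mem_source (p := p) (q t)).choose
  mem_chart_source t := (AdaptedChart.exists_mem_source (p := p) (q t)).choose_spec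
  chart_mem_atlas t := mem_range_self _
  open_source := by
    rintro _ _ ⟨c, rfl⟩ ⟨c', rfl⟩
    rw [chart_trans_source]
    exact (c.total.symm.trans c'.total).open_source.preimage (by fun_prop)
  continuousOn_toFun := by
    rintro _ _ ⟨c, rfl⟩ ⟨c', rfl⟩
    exact (fam.contDiffOn_chart_trans c c').continuousOn

/-- The topology on `T` defined by the charts. -/
@[reducible] def topology : TopologicalSpace T := fam.core.toTopologicalSpace

/-- The manifold structure on `T` defined by the charts. -/
@[reducible] def chartedSpace : @ChartedSpace (Base m × (F × G)) _ T fam.topology :=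
  fam.core.toChartedSpace

/-- The chart `fam.chart c` as an open partial homeomorphism. -/
def openChart (c : AdaptedChart m F p) :
    @OpenPartialHomeomorph T (Base m × (F × G)) fam.topology _ :=
  fam.core.openPartialHomeomorph (fam.chart c) (mem_range_self c)

theorem mem_atlas {e : @OpenPartialHomeomorph T (Base m × (F × G)) fam.topology _}
    (he : e ∈ fam.chartedSpace.atlas) : ∃ c, e = fam.openChart c := by
  change e ∈ ⋃ (f : PartialEquiv T (Base m × (F × G))) (hf : f ∈ fam.core.atlas),
    ({fam.core.openPartialHomeomorph f hf} : Set _) at he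
  simp only [mem_iUnion, mem_singleton_iff] at he
  obtain ⟨_, ⟨c, rfl⟩, rfl⟩ := he
  exact ⟨c, rfl⟩

theorem openChart_mem_atlas (c : AdaptedChart m F p) :
    fam.openChart c ∈ fam.chartedSpace.atlas := by
  change fam.openChart c ∈ ⋃ (f : PartialEquiv T (Base m × (F × G))) (hf : f ∈ fam.core.atlas),
    ({fam.core.openPartialHomeomorph f hf} : Set _)
  simp only [mem_iUnion, mem_singleton_iff]
  exact ⟨_, mem_range_self c, rfl⟩

theorem isManifold :
    @IsManifold ℝ _ (Base m × (F × G)) _ _ (Base m × (F × G)) _ 𝓘(ℝ, Base m × (F × G)) ∞ T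
      fam.topology fam.chartedSpace := by
  let _ := fam.topology
  let _ := fam.chartedSpace
  refine isManifold_of_contDiffOn _ _ _ fun e e' he he' => ?_
  obtain ⟨c, rfl⟩ := fam.mem_atlas he
  obtain ⟨c', rfl⟩ := fam.mem_atlas he'
  have := fam.contDiffOn_chart_trans c c'
  simp only [modelWithCornersSelf_coe, modelWithCornersSelf_coe_symm, Function.comp_id,
    Function.id_comp, preimage_id, range_id, inter_univ]
  exact this

theorem openChart_mem_maximalAtlas (c : AdaptedChart m F p) :
    fam.openChart c ∈ @IsManifold.maximalAtlas ℝ _ (Base m × (F × G)) _ _ (Base m × (F × G)) _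
      𝓘(ℝ, Base m × (F × G)) ∞ T fam.topology fam.chartedSpace := by
  let _ := fam.topology
  let _ := fam.chartedSpace
  have := fam.isManifold
  exact IsManifold.subset_maximalAtlas (fam.openChart_mem_atlas c)

/-- The fibred chart `(x, (u, g))` of `p ∘ q`. -/
def lift (c : AdaptedChart m F p) :
    @AdaptedChart m (F × G) _ _ T M _ _ fam.topology fam.chartedSpace (p ∘ q) :=
  letI := fam.topology
  letI := fam.chartedSpace
  { total := fam.openChart c
    base := c.base
    total_mem := fam.openChart_mem_maximalAtlas c
    base_mem := c.base_mem
    map_source := fun t ht => c.map_source (q t) ht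
    fst_total := fun t ht => c.fst_total (q t) ht }

theorem isFibration :
    @IsFibration m (F × G) _ _ T M _ _ fam.topology fam.chartedSpace (p ∘ q) := by
  let _ := fam.topology
  let _ := fam.chartedSpace
  refine ⟨?_, F × G, inferInstance, inferInstance, fun t => ?_⟩
  · refine (IsFibration.surjective (m := m) (F := F) (p := p)).comp fun e => ?_
    obtain ⟨c, hc⟩ := AdaptedChart.exists_mem_source (m := m) (F := F) (p := p) e
    exact ⟨fam.point c (c.total e) 0, by
      rw [fam.proj_point c _ _ (c.total.map_source hc), c.total.left_inv hc]⟩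
  · obtain ⟨c, hc⟩ := AdaptedChart.exists_mem_source (m := m) (F := F) (p := p) (q t)
    refine IsSubmersionAtOfComplement.mk_of_charts (ContinuousLinearEquiv.refl ℝ _)
      (fam.lift c).total (fam.lift c).base hc ((fam.lift c).map_source t hc)
      (fam.lift c).total_mem (fam.lift c).base_mem (fam.lift c).map_source ?_
    intro w hw
    have hw' : w ∈ (fam.lift c).total.target := by simpa using hw
    have h1 := (fam.lift c).fst_total _ ((fam.lift c).total.map_target hw')
    rw [(fam.lift c).total.right_inv hw'] at h1
    simpa using h1.symm

end FibreCoordinates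

namespace AdaptedChart

variable {m : ℕ} {F : Type*} [NormedAddCommGroup F] [NormedSpace ℝ F] {P M : Type*}
  [TopologicalSpace M] [ChartedSpace (Base m) M]
  [TopologicalSpace P] [ChartedSpace (Base m × F) P] {p : P → M}

/-- The isomorphism `T_e P → ℝ^m × F` given by the chart (for `e` in its domain). -/
def tangentCoord (c : AdaptedChart m F p) (e : P) :
    TangentSpace 𝓘(ℝ, Base m × F) e →L[ℝ] Base m × F :=
  mfderiv 𝓘(ℝ, Base m × F) 𝓘(ℝ, Base m × F) c.total e

/-- The inverse of `c.tangentCoord e` (for `e` in the domain of the chart). -/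
def tangentPoint (c : AdaptedChart m F p) (e : P) :
    Base m × F →L[ℝ] TangentSpace 𝓘(ℝ, Base m × F) e :=
  mfderiv 𝓘(ℝ, Base m × F) 𝓘(ℝ, Base m × F) c.total.symm (c.total e)

/-- The isomorphism `T_x M → ℝ^m` given by the base chart (for `x` in its domain). -/
def baseCoord (c : AdaptedChart m F p) (x : M) : TangentSpace 𝓘(ℝ, Base m) x →L[ℝ] Base m :=
  mfderiv 𝓘(ℝ, Base m) 𝓘(ℝ, Base m) c.base x

/-- The inverse of `c.baseCoord x` (for `x` in the domain of the base chart). -/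
def basePoint (c : AdaptedChart m F p) (x : M) : Base m →L[ℝ] TangentSpace 𝓘(ℝ, Base m) x :=
  mfderiv 𝓘(ℝ, Base m) 𝓘(ℝ, Base m) c.base.symm (c.base x)

theorem mdifferentiable_total (c : AdaptedChart m F p) :
    c.total.MDifferentiable 𝓘(ℝ, Base m × F) 𝓘(ℝ, Base m × F) :=
  ⟨(contMDiffOn_of_mem_maximalAtlas c.total_mem).mdifferentiableOn (by simp),
    (contMDiffOn_symm_of_mem_maximalAtlas c.total_mem).mdifferentiableOn (by simp)⟩

theorem mdifferentiable_base (c : AdaptedChart m F p) :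
    c.base.MDifferentiable 𝓘(ℝ, Base m) 𝓘(ℝ, Base m) :=
  ⟨(contMDiffOn_of_mem_maximalAtlas c.base_mem).mdifferentiableOn (by simp),
    (contMDiffOn_symm_of_mem_maximalAtlas c.base_mem).mdifferentiableOn (by simp)⟩

theorem tangentCoord_point (c : AdaptedChart m F p) {e : P} (he : e ∈ c.total.source)
    (w : Base m × F) : c.tangentCoord e (c.tangentPoint e w) = w := by
  have := c.mdifferentiable_total.comp_symm_deriv (c.total.map_source he)
  rw [c.total.left_inv he] at this
  exact congrArg (fun L => L w) this

theorem tangentPoint_coord (c : AdaptedChart m F p) {e : P} (he : e ∈ c.total.source)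
    (v : TangentSpace 𝓘(ℝ, Base m × F) e) : c.tangentPoint e (c.tangentCoord e v) = v :=
  congrArg (fun L => L v) (c.mdifferentiable_total.symm_comp_deriv he)

theorem baseCoord_point (c : AdaptedChart m F p) {x : M} (hx : x ∈ c.base.source)
    (w : Base m) : c.baseCoord x (c.basePoint x w) = w := by
  have := c.mdifferentiable_base.comp_symm_deriv (c.base.map_source hx)
  rw [c.base.left_inv hx] at this
  exact congrArg (fun L => L w) this

theorem basePoint_coord (c : AdaptedChart m F p) {x : M} (hx : x ∈ c.base.source)
    (v : TangentSpace 𝓘(ℝ, Base m) x) : c.basePoint x (c.baseCoord x v) = v :=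
  congrArg (fun L => L v) (c.mdifferentiable_base.symm_comp_deriv hx)

theorem tangentCoord_fst [hp : IsFibration m F p] (c : AdaptedChart m F p) {e : P}
    (he : e ∈ c.total.source) (v : TangentSpace 𝓘(ℝ, Base m × F) e) :
    (c.tangentCoord e v).1 =
      c.baseCoord (p e) (mfderiv 𝓘(ℝ, Base m × F) 𝓘(ℝ, Base m) p e v) := by
  have hpd : MDifferentiableAt 𝓘(ℝ, Base m × F) 𝓘(ℝ, Base m) p e :=
    (hp.submersion.isSubmersionAt e).contMDiffAt.mdifferentiableAt (by simp)
  have h1 := HasMFDerivAt.comp e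
    (c.mdifferentiable_base.mdifferentiableAt (c.map_source e he)).hasMFDerivAt hpd.hasMFDerivAt
  have h2 := HasMFDerivAt.comp e
    ((ContinuousLinearMap.fst ℝ (Base m) F).hasMFDerivAt (x := c.total e))
    (c.mdifferentiable_total.mdifferentiableAt he).hasMFDerivAt
  have h3 : (c.base ∘ p) =ᶠ[𝓝 e] (ContinuousLinearMap.fst ℝ (Base m) F ∘ c.total) :=
    Filter.eventually_of_mem (c.total.open_source.mem_nhds he) fun e' he' =>
      (c.fst_total e' he').symm
  have := hasMFDerivAt_unique (h2.congr_of_eventuallyEq h3) h1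
  exact congrArg (fun L => L v) this

theorem baseCoord_injective (c : AdaptedChart m F p) {x : M} (hx : x ∈ c.base.source)
    {v : TangentSpace 𝓘(ℝ, Base m) x} (hv : c.baseCoord x v = 0) : v = 0 := by
  rw [← c.basePoint_coord hx v, hv, map_zero]

/-- Vertical vectors in coordinates. -/
theorem vertical_iff [IsFibration m F p] (c : AdaptedChart m F p) {e : P}
    (he : e ∈ c.total.source) (v : TangentSpace 𝓘(ℝ, Base m × F) e) :
    mfderiv 𝓘(ℝ, Base m × F) 𝓘(ℝ, Base m) p e v = 0 ↔ (c.tangentCoord e v).1 = 0 := by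
  rw [c.tangentCoord_fst he]
  exact ⟨fun h => by rw [h, map_zero], fun h => c.baseCoord_injective (c.map_source e he) h⟩

/-- The derivative of a change of charts. -/
theorem tangentCoord_comp_tangentPoint (c c' : AdaptedChart m F p) {e : P}
    (he : e ∈ c.total.source) (he' : e ∈ c'.total.source) :
    (c.tangentCoord e).comp (c'.tangentPoint e) =
      fderiv ℝ (c.total ∘ c'.total.symm) (c'.total e) := by
  have h1 := (c'.mdifferentiable_total.mdifferentiableAt_symm
    (c'.total.map_source he')).hasMFDerivAt
  have h2 : HasMFDerivAt 𝓘(ℝ, Base m × F) 𝓘(ℝ, Base m × F) c.total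
      (c'.total.symm (c'.total e)) (c.tangentCoord e) := by
    rw [c'.total.left_inv he']
    exact (c.mdifferentiable_total.mdifferentiableAt he).hasMFDerivAt
  have h3 := HasMFDerivAt.comp (c'.total e) h2 h1
  have h4 : HasFDerivAt (c.total ∘ c'.total.symm) ((c.tangentCoord e).comp (c'.tangentPoint e))
      (c'.total e) := HasMFDerivAt.hasFDerivAt h3
  exact h4.fderiv.symm

theorem contDiffOn_tangentCoord_comp (c c' : AdaptedChart m F p) :
    ContDiffOn ℝ ∞ (fun y => (c.tangentCoord (c.total.symm y)).comp
      (c'.tangentPoint (c.total.symm y))) (c.total.symm.trans c'.total).source := by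
  have h1 : ContDiffOn ℝ ∞ (fderiv ℝ (c.total ∘ c'.total.symm))
      (c'.total.symm.trans c.total).source :=
    (c'.contDiffOn_transition c).fderiv_of_isOpen
      (c'.total.symm.trans c.total).open_source (by simp)
  have hmaps : MapsTo (c'.total ∘ c.total.symm) (c.total.symm.trans c'.total).source
      (c'.total.symm.trans c.total).source := by
    intro y hy
    have := (c.total.symm.trans c'.total).map_source hy
    simpa using this
  refine (h1.comp (c.contDiffOn_transition c') hmaps).congr fun y hy => ?_
  have hy' : y ∈ c.total.target ∧ c.total.symm y ∈ c'.total.source := by simpa using hy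
  exact tangentCoord_comp_tangentPoint c c' (c.total.map_target hy'.1) hy'.2

theorem contDiffOn_tangentPoint_comp (c c' : AdaptedChart m F p) :
    ContDiffOn ℝ ∞ (fun y => (c'.tangentCoord (c.total.symm y)).comp
      (c.tangentPoint (c.total.symm y))) (c.total.symm.trans c'.total).source := by
  refine ((c.contDiffOn_transition c').fderiv_of_isOpen (m := ∞)
    (c.total.symm.trans c'.total).open_source (by simp)).congr fun y hy => ?_
  have hy' : y ∈ c.total.target ∧ c.total.symm y ∈ c'.total.source := by simpa using hy
  rw [tangentCoord_comp_tangentPoint c' c hy'.2 (c.total.map_target hy'.1),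
    c.total.right_inv hy'.1]

end AdaptedChart

section FormBundles

variable (m : ℕ) (F : Type*) [NormedAddCommGroup F] [NormedSpace ℝ F] {P M : Type*}
  [TopologicalSpace M] [ChartedSpace (Base m) M]
  [TopologicalSpace P] [ChartedSpace (Base m × F) P] (p : P → M)

/-- The `k`-forms on `T_e P` that are `r`-horizontal with respect to `p`. -/
def HForms (r k : ℕ) (e : P) : Type _ :=
  horizontalForms (mfderiv 𝓘(ℝ, Base m × F) 𝓘(ℝ, Base m) p e) r k

instance (r k : ℕ) (e : P) : AddCommGroup (HForms m F p r k e) :=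
  inferInstanceAs (AddCommGroup
    (horizontalForms (mfderiv 𝓘(ℝ, Base m × F) 𝓘(ℝ, Base m) p e) r k))

instance (r k : ℕ) (e : P) : Module ℝ (HForms m F p r k e) :=
  inferInstanceAs (Module ℝ
    (horizontalForms (mfderiv 𝓘(ℝ, Base m × F) 𝓘(ℝ, Base m) p e) r k))

/-- The `r`-horizontal `k`-forms on `ℝ^m × F`. -/
def ModelForms (r k : ℕ) : Type _ :=
  horizontalForms (ContinuousLinearMap.fst ℝ (Base m) F) r k

instance (r k : ℕ) : NormedAddCommGroup (ModelForms m F r k) :=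
  inferInstanceAs (NormedAddCommGroup
    (horizontalForms (ContinuousLinearMap.fst ℝ (Base m) F) r k))

instance (r k : ℕ) : NormedSpace ℝ (ModelForms m F r k) :=
  inferInstanceAs (NormedSpace ℝ
    (horizontalForms (ContinuousLinearMap.fst ℝ (Base m) F) r k))

instance [FiniteDimensional ℝ F] (r k : ℕ) : FiniteDimensional ℝ (ModelForms m F r k) :=
  inferInstanceAs (FiniteDimensional ℝ
    (horizontalForms (ContinuousLinearMap.fst ℝ (Base m) F) r k))

variable {m F} in
/-- The underlying form of an element of `ModelForms`. -/
def ModelForms.val {r k : ℕ} : ModelForms m F r k →ₗ[ℝ] (Base m × F) [⋀^Fin k]→L[ℝ] ℝ :=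
  (horizontalForms (ContinuousLinearMap.fst ℝ (Base m) F) r k).subtype

variable {m F p} in
/-- The underlying form of an element of `HForms`. -/
def HForms.val {r k : ℕ} {e : P} :
    HForms m F p r k e →ₗ[ℝ] TangentSpace 𝓘(ℝ, Base m × F) e [⋀^Fin k]→L[ℝ] ℝ :=
  (horizontalForms (mfderiv 𝓘(ℝ, Base m × F) 𝓘(ℝ, Base m) p e) r k).subtype

variable {m F} in
/-- A horizontal form on `ℝ^m × F` as an element of `ModelForms`. -/
def ModelForms.mk {r k : ℕ} (a : (Base m × F) [⋀^Fin k]→L[ℝ] ℝ)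
    (ha : a ∈ horizontalForms (ContinuousLinearMap.fst ℝ (Base m) F) r k) :
    ModelForms m F r k :=
  Subtype.mk a ha

variable {m F p} in
/-- A horizontal form at `e` as an element of `HForms`. -/
def HForms.mk {r k : ℕ} {e : P} (a : TangentSpace 𝓘(ℝ, Base m × F) e [⋀^Fin k]→L[ℝ] ℝ)
    (ha : a ∈ horizontalForms (mfderiv 𝓘(ℝ, Base m × F) 𝓘(ℝ, Base m) p e) r k) :
    HForms m F p r k e :=
  Subtype.mk a ha

variable {m F} in
/-- A linear map with values in `ModelForms`. -/
def ModelForms.lift {r k : ℕ} {A : Type*} [AddCommGroup A] [Module ℝ A]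
    (f : A →ₗ[ℝ] (Base m × F) [⋀^Fin k]→L[ℝ] ℝ)
    (hf : ∀ a, f a ∈ horizontalForms (ContinuousLinearMap.fst ℝ (Base m) F) r k) :
    A →ₗ[ℝ] ModelForms m F r k :=
  f.codRestrict _ hf

variable {m F p} in
/-- A linear map with values in `HForms`. -/
def HForms.lift {r k : ℕ} {e : P} {A : Type*} [AddCommGroup A] [Module ℝ A]
    (f : A →ₗ[ℝ] TangentSpace 𝓘(ℝ, Base m × F) e [⋀^Fin k]→L[ℝ] ℝ)
    (hf : ∀ a, f a ∈ horizontalForms (mfderiv 𝓘(ℝ, Base m × F) 𝓘(ℝ, Base m) p e) r k) :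
    A →ₗ[ℝ] HForms m F p r k e :=
  f.codRestrict _ hf

/-- The bundle `Λ^k_r P` of `r`-horizontal `k`-forms on `P` (all `k`-forms when `k < r`). -/
structure FormBundle (r k : ℕ) where
  pt : P
  form : HForms m F p r k pt

/-- The subspace `Λ^k_1` of `Λ^k_2` at a point of `P`. -/
def SemibasicForms (k : ℕ) (e : P) : Submodule ℝ (HForms m F p 2 k e) :=
  (horizontalForms (mfderiv 𝓘(ℝ, Base m × F) 𝓘(ℝ, Base m) p e) 1 k).comap HForms.val

/-- The subspace `Λ^k_1` of `Λ^k_2` on `ℝ^m × F`. -/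
def ModelSemibasic (k : ℕ) : Submodule ℝ (ModelForms m F 2 k) :=
  (horizontalForms (ContinuousLinearMap.fst ℝ (Base m) F) 1 k).comap ModelForms.val

/-- The quotient bundle `Λ^k_2 P / Λ^k_1 P`. -/
structure ReducedFormBundle (k : ℕ) where
  pt : P
  cls : HForms m F p 2 k pt ⧸ SemibasicForms m F p k pt

variable {m F p}

/-- The projection `Λ^k_2 P → Λ^k_2 P / Λ^k_1 P`. -/
def FormBundle.reduce {k : ℕ} (t : FormBundle m F p 2 k) : ReducedFormBundle m F p k :=
  ⟨t.pt, Submodule.Quotient.mk t.form⟩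

namespace AdaptedChart

variable [IsFibration m F p] (c : AdaptedChart m F p)

open Classical in
/-- Forms at `e` written in the chart. -/
def pushForm (r k : ℕ) (e : P) : HForms m F p r k e →ₗ[ℝ] ModelForms m F r k :=
  if he : e ∈ c.total.source then
    ModelForms.lift
      (ContinuousAlternatingMap.compContinuousLinearMapₗ (c.tangentPoint e) ∘ₗ HForms.val)
      fun a => horizontalForms.comp_mem a.2 (c.tangentPoint e) fun w hw => by
        rw [c.vertical_iff he, c.tangentCoord_point he]
        exact hw
  else 0

open Classical in
/-- The form at `e` with a given expression in the chart. -/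
def pullForm (r k : ℕ) (e : P) : ModelForms m F r k →ₗ[ℝ] HForms m F p r k e :=
  if he : e ∈ c.total.source then
    HForms.lift
      (ContinuousAlternatingMap.compContinuousLinearMapₗ (c.tangentCoord e) ∘ₗ ModelForms.val)
      fun a => horizontalForms.comp_mem a.2 (c.tangentCoord e)
        fun w hw => (c.vertical_iff he w).1 hw
  else 0

variable {c}

theorem coe_pushForm {r k : ℕ} {e : P} (he : e ∈ c.total.source) (a : HForms m F p r k e) :
    (c.pushForm r k e a).val = a.val.compContinuousLinearMap (c.tangentPoint e) := by
  rw [pushForm, dif_pos he]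
  rfl

theorem coe_pullForm {r k : ℕ} {e : P} (he : e ∈ c.total.source) (a : ModelForms m F r k) :
    (c.pullForm r k e a).val = a.val.compContinuousLinearMap (c.tangentCoord e) := by
  rw [pullForm, dif_pos he]
  rfl

theorem push_pull {r k : ℕ} {e : P} (he : e ∈ c.total.source) (a : ModelForms m F r k) :
    c.pushForm r k e (c.pullForm r k e a) = a := by
  apply Subtype.ext
  change (c.pushForm r k e (c.pullForm r k e a)).val = a.val
  rw [coe_pushForm he, coe_pullForm he]
  ext v
  simp [c.tangentCoord_point he, Function.comp_def]

theorem pull_push {r k : ℕ} {e : P} (he : e ∈ c.total.source) (a : HForms m F p r k e) :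
    c.pullForm r k e (c.pushForm r k e a) = a := by
  apply Subtype.ext
  change (c.pullForm r k e (c.pushForm r k e a)).val = a.val
  rw [coe_pullForm he, coe_pushForm he]
  ext v
  simp [c.tangentPoint_coord he, Function.comp_def]

theorem contDiffOn_push_pull [FiniteDimensional ℝ F] (c c' : AdaptedChart m F p) (r k : ℕ) :
    ContDiffOn ℝ ∞ (fun w : (Base m × F) × ModelForms m F r k =>
        c'.pushForm r k (c.total.symm w.1) (c.pullForm r k (c.total.symm w.1) w.2))
      (Prod.fst ⁻¹' (c.total.symm.trans c'.total).source) := by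
  apply horizontalForms.contDiffOn
  have h0 : ContDiff ℝ ∞ (ModelForms.val : ModelForms m F r k → _) :=
    (ModelForms.val (m := m) (F := F) (r := r) (k := k)).toContinuousLinearMap.contDiff
  have h1 : ContDiffOn ℝ ∞
      (fun w : (Base m × F) × ModelForms m F r k => ModelForms.val w.2)
      (Prod.fst ⁻¹' (c.total.symm.trans c'.total).source) :=
    (h0.comp contDiff_snd).contDiffOn
  have h2 := (c.contDiffOn_tangentCoord_comp c').comp
    (contDiff_fst (𝕜 := ℝ) (n := ∞) (E := Base m × F) (F := ModelForms m F r k)).contDiffOn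
    (s := Prod.fst ⁻¹' (c.total.symm.trans c'.total).source) fun _ h => h
  refine (contDiffOn_form_comp h1 h2).congr fun w hw => ?_
  have hw' : w.1 ∈ c.total.target ∧ c.total.symm w.1 ∈ c'.total.source := by simpa using hw
  change (c'.pushForm r k (c.total.symm w.1)
    (c.pullForm r k (c.total.symm w.1) w.2)).val.toContinuousMultilinearMap = _
  rw [coe_pushForm hw'.2, coe_pullForm (c.total.map_target hw'.1)]
  rfl

theorem semibasic_le_push (k : ℕ) (e : P) :
    SemibasicForms m F p k e ≤ (ModelSemibasic m F k).comap (c.pushForm 2 k e) := by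
  intro a ha
  by_cases he : e ∈ c.total.source
  · change (c.pushForm 2 k e a).val ∈ horizontalForms _ 1 k
    rw [coe_pushForm he]
    exact horizontalForms.comp_mem ha (c.tangentPoint e) fun w hw => by
      rw [c.vertical_iff he, c.tangentCoord_point he]
      exact hw
  · rw [pushForm, dif_neg he]
    simp

theorem semibasic_le_pull (k : ℕ) (e : P) :
    ModelSemibasic m F k ≤ (SemibasicForms m F p k e).comap (c.pullForm 2 k e) := by
  intro a ha
  by_cases he : e ∈ c.total.source
  · change (c.pullForm 2 k e a).val ∈ horizontalForms _ 1 k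
    rw [coe_pullForm he]
    exact horizontalForms.comp_mem ha (c.tangentCoord e) fun w hw => (c.vertical_iff he w).1 hw
  · rw [pullForm, dif_neg he]
    simp

end AdaptedChart

variable [FiniteDimensional ℝ F]

variable (m F) in
instance isClosed_modelSemibasic (k : ℕ) :
    IsClosed (ModelSemibasic m F k : Set (ModelForms m F 2 k)) :=
  Submodule.closed_of_finiteDimensional _

variable [IsManifold 𝓘(ℝ, Base m × F) ∞ P] [IsFibration m F p]

variable (m F p) in
/-- A form is determined by its base point and its expression in a chart. -/
def formCoordinates (r k : ℕ) :
    FibreCoordinates m F (ModelForms m F r k) p (FormBundle.pt : FormBundle m F p r k → P) where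
  coord c t := c.pushForm r k t.pt t.form
  point c y a := ⟨c.total.symm y, c.pullForm r k _ a⟩
  proj_point _ _ _ _ := rfl
  coord_point c y a hy := AdaptedChart.push_pull (c.total.map_target hy) a
  point_coord c t ht := by
    obtain ⟨e, a⟩ := t
    have ht' : e ∈ c.total.source := ht
    change FormBundle.mk (c.total.symm (c.total e))
      (c.pullForm r k (c.total.symm (c.total e)) (c.pushForm r k e a)) = _
    rw [c.total.left_inv ht', AdaptedChart.pull_push ht']
  smooth c c' := AdaptedChart.contDiffOn_push_pull c c' r k

variable (m F p) in
/-- A class of forms is determined by its base point and its expression in a chart. -/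
def reducedCoordinates (k : ℕ) :
    FibreCoordinates m F (ModelForms m F 2 k ⧸ ModelSemibasic m F k) p
      (ReducedFormBundle.pt : ReducedFormBundle m F p k → P) where
  coord c t := Submodule.mapQ _ _ (c.pushForm 2 k t.pt) (c.semibasic_le_push k t.pt) t.cls
  point c y a := ⟨c.total.symm y,
    Submodule.mapQ _ _ (c.pullForm 2 k _) (c.semibasic_le_pull k _) a⟩
  proj_point _ _ _ _ := rfl
  coord_point c y a hy := by
    induction a using Submodule.Quotient.induction_on with
    | _ a => simp [AdaptedChart.push_pull (c.total.map_target hy) a]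
  point_coord c t ht := by
    obtain ⟨e, a⟩ := t
    have ht' : e ∈ c.total.source := ht
    induction a using Submodule.Quotient.induction_on with
    | _ a =>
      simp only [Submodule.mapQ_apply]
      rw [c.total.left_inv ht', AdaptedChart.pull_push ht']
  smooth c c' := by
    obtain ⟨s, hs⟩ := (ModelSemibasic m F k).mkQ.exists_rightInverse_of_surjective
      (ModelSemibasic m F k).range_mkQ
    have h1 : ContDiff ℝ ∞ s.toContinuousLinearMap := s.toContinuousLinearMap.contDiff
    have h2 : ContDiff ℝ ∞ (ModelSemibasic m F k).mkQ.toContinuousLinearMap :=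
      (ModelSemibasic m F k).mkQ.toContinuousLinearMap.contDiff
    refine (h2.comp_contDiffOn ((AdaptedChart.contDiffOn_push_pull c c' 2 k).comp
      (contDiff_fst.prodMk (h1.comp contDiff_snd)).contDiffOn fun _ h => h)).congr fun w hw => ?_
    have : w.2 = (ModelSemibasic m F k).mkQ (s w.2) := (LinearMap.congr_fun hs w.2).symm
    simp only [Function.comp_apply]
    conv_lhs => rw [this]
    rfl

section

variable (r k : ℕ)

instance : TopologicalSpace (FormBundle m F p r k) := (formCoordinates m F p r k).topology

instance : ChartedSpace (Base m × (F × ModelForms m F r k)) (FormBundle m F p r k) :=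
  (formCoordinates m F p r k).chartedSpace

instance : IsManifold 𝓘(ℝ, Base m × (F × ModelForms m F r k)) ∞ (FormBundle m F p r k) :=
  (formCoordinates m F p r k).isManifold

instance : IsFibration m (F × ModelForms m F r k)
    (p ∘ (FormBundle.pt : FormBundle m F p r k → P)) :=
  (formCoordinates m F p r k).isFibration

instance : TopologicalSpace (ReducedFormBundle m F p k) := (reducedCoordinates m F p k).topology

instance : ChartedSpace (Base m × (F × (ModelForms m F 2 k ⧸ ModelSemibasic m F k)))
    (ReducedFormBundle m F p k) :=
  (reducedCoordinates m F p k).chartedSpace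

instance : IsManifold 𝓘(ℝ, Base m × (F × (ModelForms m F 2 k ⧸ ModelSemibasic m F k))) ∞
    (ReducedFormBundle m F p k) :=
  (reducedCoordinates m F p k).isManifold

end

end FormBundles

section Jets

variable (m : ℕ) (F : Type*) [NormedAddCommGroup F] [NormedSpace ℝ F] {P M : Type*}
  [TopologicalSpace M] [ChartedSpace (Base m) M]
  [TopologicalSpace P] [ChartedSpace (Base m × F) P] (p : P → M)

/-- The first jet bundle `J¹p`: a jet at `e ∈ P` is a linear right inverse `T_{p e} M → T_e P` of
the derivative of `p` at `e`. -/
structure JetBundle where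
  pt : P
  jet : TangentSpace 𝓘(ℝ, Base m) (p pt) →L[ℝ] TangentSpace 𝓘(ℝ, Base m × F) pt
  isSection : ∀ v, mfderiv 𝓘(ℝ, Base m × F) 𝓘(ℝ, Base m) p pt (jet v) = v

variable {m F p}

namespace AdaptedChart

variable [IsFibration m F p]

theorem mfderiv_tangentPoint (c : AdaptedChart m F p) {e : P} (he : e ∈ c.total.source)
    (w : Base m × F) :
    mfderiv 𝓘(ℝ, Base m × F) 𝓘(ℝ, Base m) p e (c.tangentPoint e w) = c.basePoint (p e) w.1 := by
  have h := c.tangentCoord_fst he (c.tangentPoint e w)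
  rw [c.tangentCoord_point he] at h
  rw [h, c.basePoint_coord (c.map_source e he)]

/-- The expression `u^a_i` of a jet in a chart. -/
def jetCoord (c : AdaptedChart m F p) (z : JetBundle m F p) : Base m →L[ℝ] F :=
  (ContinuousLinearMap.snd ℝ (Base m) F).comp
    ((c.tangentCoord z.pt).comp (z.jet.comp (c.basePoint (p z.pt))))

/-- The jet at `e` with a given expression in a chart. -/
def jetOfCoord (c : AdaptedChart m F p) (e : P) (he : e ∈ c.total.source) (g : Base m →L[ℝ] F) :
    JetBundle m F p where
  pt := e
  jet := (c.tangentPoint e).comp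
    (((ContinuousLinearMap.id ℝ (Base m)).prod g).comp (c.baseCoord (p e)))
  isSection v := by
    change mfderiv 𝓘(ℝ, Base m × F) 𝓘(ℝ, Base m) p e
      (c.tangentPoint e (c.baseCoord (p e) v, g (c.baseCoord (p e) v))) = v
    rw [c.mfderiv_tangentPoint he]
    exact c.basePoint_coord (c.map_source e he) v

theorem jetCoord_jetOfCoord (c : AdaptedChart m F p) {e : P} (he : e ∈ c.total.source)
    (g : Base m →L[ℝ] F) : c.jetCoord (c.jetOfCoord e he g) = g := by
  ext w
  change (c.tangentCoord e (c.tangentPoint e (c.baseCoord (p e) (c.basePoint (p e) w),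
    g (c.baseCoord (p e) (c.basePoint (p e) w))))).2 = g w
  rw [c.tangentCoord_point he, c.baseCoord_point (c.map_source e he)]

theorem jetOfCoord_jetCoord (c : AdaptedChart m F p) (z : JetBundle m F p)
    (hz : z.pt ∈ c.total.source) : c.jetOfCoord z.pt hz (c.jetCoord z) = z := by
  obtain ⟨e, j, hj⟩ := z
  have he : e ∈ c.total.source := hz
  have key : (c.jetOfCoord e he (c.jetCoord ⟨e, j, hj⟩)).jet = j := by
    refine ContinuousLinearMap.ext fun (v : TangentSpace 𝓘(ℝ, Base m) (p e)) => ?_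
    change c.tangentPoint e (c.baseCoord (p e) v,
      (c.tangentCoord e (j (c.basePoint (p e) (c.baseCoord (p e) v)))).2) = j v
    rw [c.basePoint_coord (c.map_source e he)]
    have : (c.baseCoord (p e) v, (c.tangentCoord e (j v)).2) = c.tangentCoord e (j v) :=
      Prod.ext (by rw [c.tangentCoord_fst he, hj]) rfl
    rw [this, c.tangentPoint_coord he]
  change JetBundle.mk e _ _ = _
  congr

open Classical in
/-- The jet over `c.total.symm y` with a given expression in a chart. -/
def jetPoint [FiniteDimensional ℝ F] [IsManifold 𝓘(ℝ, Base m × F) ∞ P]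
    (c : AdaptedChart m F p) (y : Base m × F) (g : Base m →L[ℝ] F) : JetBundle m F p :=
  if hy : y ∈ c.total.target then c.jetOfCoord (c.total.symm y) (c.total.map_target hy) g
  else (exists_mem_source (p := p) (c.total.symm y)).choose.jetOfCoord (c.total.symm y)
    (exists_mem_source (p := p) (c.total.symm y)).choose_spec g

theorem jetOfCoord_congr (c : AdaptedChart m F p) {e e' : P} (he : e ∈ c.total.source)
    (he' : e' ∈ c.total.source) (h : e = e') (g : Base m →L[ℝ] F) :
    c.jetOfCoord e he g = c.jetOfCoord e' he' g := by
  subst h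
  rfl

theorem jetCoord_change (c c' : AdaptedChart m F p) {e : P} (he : e ∈ c.total.source)
    (he' : e ∈ c'.total.source) (g : Base m →L[ℝ] F) :
    c'.jetCoord (c.jetOfCoord e he g) =
      (ContinuousLinearMap.snd ℝ (Base m) F).comp
        (((c'.tangentCoord e).comp (c.tangentPoint e)).comp
          (((ContinuousLinearMap.id ℝ (Base m)).prod g).comp
            ((ContinuousLinearMap.fst ℝ (Base m) F).comp
              (((c.tangentCoord e).comp (c'.tangentPoint e)).comp
                (ContinuousLinearMap.inl ℝ (Base m) F))))) := by
  have key : ∀ w, c.baseCoord (p e) (c'.basePoint (p e) w) =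
      (c.tangentCoord e (c'.tangentPoint e (w, 0))).1 := fun w => by
    rw [c.tangentCoord_fst he, c'.mfderiv_tangentPoint he']
  ext w
  change (c'.tangentCoord e (c.tangentPoint e
    (c.baseCoord (p e) (c'.basePoint (p e) w), g (c.baseCoord (p e) (c'.basePoint (p e) w))))).2 =
    (c'.tangentCoord e (c.tangentPoint e ((c.tangentCoord e (c'.tangentPoint e (w, 0))).1,
      g ((c.tangentCoord e (c'.tangentPoint e (w, 0))).1)))).2
  rw [key]

end AdaptedChart

variable [FiniteDimensional ℝ F] [IsManifold 𝓘(ℝ, Base m × F) ∞ P] [IsFibration m F p]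

variable (m F p) in
/-- A jet is determined by its base point and its expression in a chart. -/
def jetCoordinates :
    FibreCoordinates m F (Base m →L[ℝ] F) p (JetBundle.pt : JetBundle m F p → P) where
  coord c z := c.jetCoord z
  point c y g := c.jetPoint y g
  proj_point c y g hy := by
    rw [AdaptedChart.jetPoint, dif_pos hy]
    rfl
  coord_point c y g hy := by
    rw [AdaptedChart.jetPoint, dif_pos hy]
    exact c.jetCoord_jetOfCoord _ g
  point_coord c z hz := by
    rw [AdaptedChart.jetPoint, dif_pos (c.total.map_source hz),
      c.jetOfCoord_congr _ hz (c.total.left_inv hz), c.jetOfCoord_jetCoord]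
  smooth c c' := by
    have hf : ContDiff ℝ ∞ (fun w : (Base m × F) × (Base m →L[ℝ] F) => w.1) := contDiff_fst
    have h1 := (c.contDiffOn_tangentPoint_comp c').comp hf.contDiffOn
      (s := Prod.fst ⁻¹' (c.total.symm.trans c'.total).source) fun _ h => h
    have h2 := (c.contDiffOn_tangentCoord_comp c').comp hf.contDiffOn
      (s := Prod.fst ⁻¹' (c.total.symm.trans c'.total).source) fun _ h => h
    have h3 : ContDiff ℝ ∞ (fun w : (Base m × F) × (Base m →L[ℝ] F) =>
        (ContinuousLinearMap.id ℝ (Base m)).prod w.2) :=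
      ((ContinuousLinearMap.prodL (E := Base m) (F := Base m) (G := F) (𝕜 := ℝ) ℝ).contDiff.comp
        (contDiff_const.prodMk contDiff_snd))
    refine ((contDiffOn_const (c := ContinuousLinearMap.snd ℝ (Base m) F)).clm_comp
      (h1.clm_comp (h3.contDiffOn.clm_comp
        ((contDiffOn_const (c := ContinuousLinearMap.fst ℝ (Base m) F)).clm_comp
          (h2.clm_comp (contDiffOn_const (c := ContinuousLinearMap.inl ℝ (Base m) F))))))).congr fun w hw => ?_
    have hw' : w.1 ∈ c.total.target ∧ c.total.symm w.1 ∈ c'.total.source := by simpa using hw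
    change c'.jetCoord (c.jetPoint w.1 w.2) = _
    rw [AdaptedChart.jetPoint, dif_pos hw'.1, c.jetCoord_change c' _ hw'.2]
    rfl


instance : TopologicalSpace (JetBundle m F p) := (jetCoordinates m F p).topology

instance : ChartedSpace (Base m × (F × (Base m →L[ℝ] F))) (JetBundle m F p) :=
  (jetCoordinates m F p).chartedSpace

instance : IsManifold 𝓘(ℝ, Base m × (F × (Base m →L[ℝ] F))) ∞ (JetBundle m F p) :=
  (jetCoordinates m F p).isManifold

end Jets

section LinearForms

variable {V : Type*} [NormedAddCommGroup V] [NormedSpace ℝ V] {W : Type*} [NormedAddCommGroup W]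
  [NormedSpace ℝ W]

theorem extDeriv_mem_horizontalForms (L : V →L[ℝ] W) (r k : ℕ) (α : V → V [⋀^Fin k]→L[ℝ] ℝ)
    (x : V) (h : ∀ᶠ y in 𝓝 x, α y ∈ horizontalForms L r k) :
    extDeriv α x ∈ horizontalForms L (r + 1) (k + 1) := by
  rintro v ⟨s, hs, hv⟩
  have key : ∀ (w : V) (u : Fin k → V),
      (∃ t : Finset (Fin k), t.card = r ∧ ∀ i ∈ t, L (u i) = 0) → fderiv ℝ α x w u = 0 := by
    intro w u hu
    by_cases hd : DifferentiableAt ℝ α x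
    · have h1 : HasFDerivAt (fun y => α y u) _ x :=
        (ContinuousAlternatingMap.apply ℝ V ℝ u).hasFDerivAt.comp x hd.hasFDerivAt
      have h2 : HasFDerivAt (fun y => α y u) (0 : V →L[ℝ] ℝ) x :=
        (hasFDerivAt_const (0 : ℝ) x).congr_of_eventuallyEq (h.mono fun y hy => hy u hu)
      exact congrArg (fun A : V →L[ℝ] ℝ => A w) (h1.unique h2)
    · rw [fderiv_zero_of_not_differentiableAt hd]
      rfl
  rw [extDeriv, ContinuousAlternatingMap.alternatizeUncurryFin_apply]
  refine Finset.sum_eq_zero fun i _ => ?_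
  rw [key, smul_zero]
  have hcard : r ≤ (Finset.univ.filter fun j => i.succAbove j ∈ s).card := by
    have hsub : s ⊆ insert i
        ((Finset.univ.filter fun j => i.succAbove j ∈ s).image i.succAbove) := by
      intro a ha
      rcases Fin.eq_self_or_eq_succAbove i a with rfl | ⟨j, rfl⟩
      · simp
      · simp [ha]
    have h1 := (Finset.card_le_card hsub).trans (Finset.card_insert_le _ _)
    have h2 := Finset.card_image_le (s := Finset.univ.filter fun j => i.succAbove j ∈ s)
      (f := i.succAbove)
    omega
  obtain ⟨t, ht, htr⟩ := Finset.exists_subset_card_eq hcard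
  exact ⟨t, htr, fun j hj => hv _ (Finset.mem_filter.1 (ht hj)).2⟩

/-- The insertion `(v₁, …, v_k) ↦ ∑ᵢ α(v₁, …, A vᵢ, …, v_k)` of an endomorphism `A` in a form
`α`. -/
def insertion {V : Type*} [AddCommGroup V] [Module ℝ V] [TopologicalSpace V] {k : ℕ}
    (A : V →L[ℝ] V) (α : V [⋀^Fin k]→L[ℝ] ℝ) : V [⋀^Fin k]→L[ℝ] ℝ where
  toFun v := ∑ i, α (Function.update v i (A (v i)))
  map_update_add' := by
    intro inst v j x y
    obtain rfl : inst = instDecidableEqFin k := Subsingleton.elim _ _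
    rw [← Finset.sum_add_distrib]
    refine Finset.sum_congr rfl fun i _ => ?_
    by_cases h : i = j
    · subst h
      simp
    · simp only [Function.update_of_ne h, Function.update_comm (Ne.symm h)]
      exact α.map_update_add _ _ _ _
  map_update_smul' := by
    intro inst v j c x
    obtain rfl : inst = instDecidableEqFin k := Subsingleton.elim _ _
    rw [Finset.smul_sum]
    refine Finset.sum_congr rfl fun i _ => ?_
    by_cases h : i = j
    · subst h
      simp
    · simp only [Function.update_of_ne h, Function.update_comm (Ne.symm h)]
      exact α.map_update_smul _ _ _ _
  map_eq_zero_of_eq' := by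
    intro v a b hab hne
    have h0 : ∀ i, i ≠ a ∧ i ≠ b → α (Function.update v i (A (v i))) = 0 := fun i hi =>
      α.map_eq_zero_of_eq _
        (by rw [Function.update_of_ne hi.1.symm, Function.update_of_ne hi.2.symm, hab]) hne
    rw [Finset.sum_eq_add a b hne (fun i _ hi => h0 i hi) (by simp) (by simp)]
    have h1 : Function.update v b (A (v b)) =
        Function.update v a (A (v a)) ∘ Equiv.swap a b := by
      funext i
      by_cases hia : i = a
      · subst hia
        simp [Function.update_of_ne hne, Function.update_of_ne (Ne.symm hne), hab]
      · by_cases hib : i = b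
        · subst hib
          simp [hab]
        · simp [Equiv.swap_apply_of_ne_of_ne hia hib, hia, hib]
    rw [h1]
    have h2 := α.toAlternatingMap.map_swap (Function.update v a (A (v a))) hne
    have h3 : α (Function.update v a (A (v a)) ∘ Equiv.swap a b) =
      -α (Function.update v a (A (v a))) := h2
    rw [h3, add_neg_cancel]
  cont := by
    refine continuous_finsetSum _ fun i _ => α.cont.comp ?_
    exact continuous_id.update i (A.continuous.comp (continuous_apply i))

end LinearForms

section DifferentialForms

/-- Differential `k`-forms on a manifold `X` modelled on `V`. -/
abbrev DifferentialForm (V : Type*) [NormedAddCommGroup V] [NormedSpace ℝ V] (X : Type*)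
    [TopologicalSpace X] [ChartedSpace V X] (k : ℕ) : Type _ :=
  ∀ z : X, TangentSpace 𝓘(ℝ, V) z [⋀^Fin k]→L[ℝ] ℝ

variable {V : Type*} [NormedAddCommGroup V] [NormedSpace ℝ V] {X : Type*}
  [TopologicalSpace X] [ChartedSpace V X] {V' : Type*} [NormedAddCommGroup V'] [NormedSpace ℝ V']
  {X' : Type*} [TopologicalSpace X'] [ChartedSpace V' X'] {k : ℕ}

namespace DifferentialForm

/-- The expression of a differential form in the chart at `z`. -/
def inChart (α : DifferentialForm V X k) (z : X) (y : V) : V [⋀^Fin k]→L[ℝ] ℝ :=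
  (α ((chartAt V z).symm y)).compContinuousLinearMap
    (mfderiv 𝓘(ℝ, V) 𝓘(ℝ, V) (chartAt V z).symm y)

/-- The exterior derivative. -/
def d (α : DifferentialForm V X k) : DifferentialForm V X (k + 1) := fun z =>
  (extDeriv (α.inChart z) (chartAt V z z)).compContinuousLinearMap
    (mfderiv 𝓘(ℝ, V) 𝓘(ℝ, V) (chartAt V z) z)

/-- The pullback of a differential form. -/
def pullback (α : DifferentialForm V X k) (f : X' → X) : DifferentialForm V' X' k := fun z =>
  (α (f z)).compContinuousLinearMap (mfderiv 𝓘(ℝ, V') 𝓘(ℝ, V) f z)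

/-- The interior product with a vector field. -/
def interior (α : DifferentialForm V X (k + 1)) (Y : ∀ z : X, TangentSpace 𝓘(ℝ, V) z) :
    DifferentialForm V X k := fun z =>
  (show V [⋀^Fin (k + 1)]→L[ℝ] ℝ from α z).curryLeft (Y z)

end DifferentialForm

end DifferentialForms

/-- The derivative of an `r`-horizontal form is `(r + 1)`-horizontal. -/
theorem DifferentialForm.d_mem_horizontalForms {m : ℕ} {F : Type*} [NormedAddCommGroup F]
    [NormedSpace ℝ F] {P M : Type*} [TopologicalSpace M] [ChartedSpace (Base m) M]
    [TopologicalSpace P] [ChartedSpace (Base m × F) P] {p : P → M} [IsFibration m F p]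
    {r k : ℕ} {α : DifferentialForm (Base m × F) P k}
    (hα : ∀ z, α z ∈ horizontalForms (mfderiv 𝓘(ℝ, Base m × F) 𝓘(ℝ, Base m) p z) r k) {z : P}
    (hc : ∃ c : AdaptedChart m F p, c.total = chartAt (Base m × F) z) :
    α.d z ∈ horizontalForms (mfderiv 𝓘(ℝ, Base m × F) 𝓘(ℝ, Base m) p z) (r + 1) (k + 1) := by
  obtain ⟨c, hc⟩ := hc
  have hz : z ∈ c.total.source := by
    rw [hc]
    exact mem_chart_source _ z
  have h1 : ∀ᶠ y in 𝓝 (c.total z),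
      α.inChart z y ∈ horizontalForms (ContinuousLinearMap.fst ℝ (Base m) F) r k := by
    filter_upwards [c.total.open_target.mem_nhds (c.total.map_source hz)] with y hy
    have hy' := c.total.map_target hy
    have h2 := horizontalForms.comp_mem (hα (c.total.symm y)) (c.tangentPoint (c.total.symm y))
      (L' := ContinuousLinearMap.fst ℝ (Base m) F) fun w hw => by
        rw [c.vertical_iff hy', c.tangentCoord_point hy']
        exact hw
    rw [AdaptedChart.tangentPoint, c.total.right_inv hy] at h2
    rw [DifferentialForm.inChart, ← hc]
    exact h2
  have h3 := extDeriv_mem_horizontalForms _ r k _ _ h1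
  have h4 := horizontalForms.comp_mem h3 (c.tangentCoord z)
    (L' := mfderiv 𝓘(ℝ, Base m × F) 𝓘(ℝ, Base m) p z) fun w hw => (c.vertical_iff hz w).1 hw
  rw [DifferentialForm.d, ← hc]
  exact h4

theorem FibreCoordinates.exists_total_eq_chartAt {m : ℕ} {F G : Type*} [NormedAddCommGroup F]
    [NormedSpace ℝ F] [NormedAddCommGroup G] [NormedSpace ℝ G] {P M T : Type*}
    [TopologicalSpace M] [ChartedSpace (Base m) M]
    [TopologicalSpace P] [ChartedSpace (Base m × F) P] {p : P → M} {q : T → P}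
    (fam : FibreCoordinates m F G p q)
    [FiniteDimensional ℝ F] [IsManifold 𝓘(ℝ, Base m × F) ∞ P] [IsFibration m F p] (t : T) :
    letI := fam.topology
    letI := fam.chartedSpace
    ∃ c : AdaptedChart m (F × G) (p ∘ q), c.total = chartAt (Base m × (F × G)) t := by
  let _ := fam.topology
  let _ := fam.chartedSpace
  obtain ⟨c, hc⟩ := fam.mem_atlas (chart_mem_atlas (Base m × (F × G)) t)
  exact ⟨fam.lift c, hc.symm⟩

section LocalSections

/-- A smooth section of `p : P → M` over an open subset of `M`. -/
structure LocalSection (m : ℕ) (F : Type*) [NormedAddCommGroup F] [NormedSpace ℝ F] {P M : Type*}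
    [TopologicalSpace M] [ChartedSpace (Base m) M]
    [TopologicalSpace P] [ChartedSpace (Base m × F) P] (p : P → M) where
  dom : Set M
  isOpen_dom : IsOpen dom
  toFun : M → P
  smooth : ContMDiffOn 𝓘(ℝ, Base m) 𝓘(ℝ, Base m × F) ∞ toFun dom
  proj : ∀ x ∈ dom, p (toFun x) = x

variable {m : ℕ} {F : Type*} [NormedAddCommGroup F] [NormedSpace ℝ F] {P M : Type*}
  [TopologicalSpace M] [ChartedSpace (Base m) M]
  [TopologicalSpace P] [ChartedSpace (Base m × F) P] {p : P → M} [hp : IsFibration m F p]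

theorem LocalSection.mfderiv_proj (σ : LocalSection m F p) {x : M} (hx : x ∈ σ.dom)
    (v : TangentSpace 𝓘(ℝ, Base m) x) :
    mfderiv 𝓘(ℝ, Base m × F) 𝓘(ℝ, Base m) p (σ.toFun x)
      (mfderiv 𝓘(ℝ, Base m) 𝓘(ℝ, Base m × F) σ.toFun x v) = v := by
  have hpd : MDifferentiableAt 𝓘(ℝ, Base m × F) 𝓘(ℝ, Base m) p (σ.toFun x) :=
    (hp.submersion.isSubmersionAt _).contMDiffAt.mdifferentiableAt (by simp)
  have hσ : MDifferentiableAt 𝓘(ℝ, Base m) 𝓘(ℝ, Base m × F) σ.toFun x :=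
    (σ.smooth.contMDiffAt (σ.isOpen_dom.mem_nhds hx)).mdifferentiableAt (by simp)
  have h1 := HasMFDerivAt.comp x hpd.hasMFDerivAt hσ.hasMFDerivAt
  have h2 : p ∘ σ.toFun =ᶠ[𝓝 x] id :=
    Filter.eventually_of_mem (σ.isOpen_dom.mem_nhds hx) fun y hy => σ.proj y hy
  have h3 := hasMFDerivAt_unique h1 ((hasMFDerivAt_id x).congr_of_eventuallyEq h2)
  exact congrArg (fun L => L v) h3

/-- The first jet `j¹σ(x)`, given by the derivative `T_x M → T_{σ(x)} P` of `σ`; here `T_x M` is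
`T_{p(σ(x))} M` because `p (σ x) = x`. -/
def LocalSection.jet (σ : LocalSection m F p) (x : M) (hx : x ∈ σ.dom) : JetBundle m F p where
  pt := σ.toFun x
  jet := show TangentSpace 𝓘(ℝ, Base m) x →L[ℝ] TangentSpace 𝓘(ℝ, Base m × F) (σ.toFun x) from
    mfderiv 𝓘(ℝ, Base m) 𝓘(ℝ, Base m × F) σ.toFun x
  isSection v := σ.mfderiv_proj hx v

end LocalSections

section Hamiltonian

variable (m : ℕ) (F : Type*) [NormedAddCommGroup F] [NormedSpace ℝ F] [FiniteDimensional ℝ F]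
  {P M : Type*} [TopologicalSpace M] [ChartedSpace (Base m) M]
  [TopologicalSpace P] [ChartedSpace (Base m × F) P] [IsManifold 𝓘(ℝ, Base m × F) ∞ P]

section

variable (p : P → M) [IsFibration m F p] (r k : ℕ)

/-- The tautological form `Θ(ω) = ν^* ω` on the bundle `ν : Λ^k_r P → P`. -/
def tautologicalForm :
    DifferentialForm (Base m × (F × ModelForms m F r k)) (FormBundle m F p r k) k := fun t =>
  t.form.val.compContinuousLinearMap
    (mfderiv 𝓘(ℝ, Base m × (F × ModelForms m F r k)) 𝓘(ℝ, Base m × F)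
      (FormBundle.pt : FormBundle m F p r k → P) t)

/-- The canonical multisymplectic form `Ω = - dΘ` on `Λ^k_r P`. -/
def canonicalForm :
    DifferentialForm (Base m × (F × ModelForms m F r k)) (FormBundle m F p r k) (k + 1) :=
  -(tautologicalForm m F p r k).d

end

variable (p : P → M) [IsFibration m F p]

/-- The extended multimomentum bundle `𝓜p = Λ^m_2 P`. -/
abbrev Multimomenta : Type _ := FormBundle m F p 2 m

/-- The model space of the fibres of `𝓜p → M`. -/
abbrev MultimomentaFibre : Type _ := F × ModelForms m F 2 m

variable {m F p} in
/-- The projection `p ∘ ν : 𝓜p → M`. -/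
abbrev Multimomenta.proj : Multimomenta m F p → M := p ∘ FormBundle.pt

/-- The reduced multimomentum bundle `𝓜°p = Λ^m_2 P / Λ^m_1 P`. -/
abbrev ReducedMultimomenta : Type _ := ReducedFormBundle m F p m

/-- The model space of the fibres of `𝓜°p → M`. -/
abbrev ReducedMultimomentaFibre : Type _ := F × (ModelForms m F 2 m ⧸ ModelSemibasic m F m)

variable {m F p} in
/-- The projection `p ∘ ν° : 𝓜°p → M`. -/
abbrev ReducedMultimomenta.proj : ReducedMultimomenta m F p → M := p ∘ ReducedFormBundle.pt

/-- A Hamiltonian section: a smooth section `h` of `μ : 𝓜p → 𝓜°p`, where `h(t)` is the form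
`form t` at the base point of `t`. -/
structure HamiltonianSection where
  form : ∀ t : ReducedMultimomenta m F p, HForms m F p 2 m t.pt
  mk_form : ∀ t, Submodule.Quotient.mk (form t) = t.cls
  smooth : ContMDiff 𝓘(ℝ, Base m × ReducedMultimomentaFibre m F)
    𝓘(ℝ, Base m × MultimomentaFibre m F) ∞
    (fun t => (⟨t.pt, form t⟩ : Multimomenta m F p))

variable {m F p}

namespace HamiltonianSection

variable (h : HamiltonianSection m F p)

/-- The map `h : 𝓜°p → 𝓜p`. -/
def toFun (t : ReducedMultimomenta m F p) : Multimomenta m F p := ⟨t.pt, h.form t⟩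

/-- The local section `h ∘ τ` of `𝓜p → M`. -/
def comp (τ : LocalSection m (ReducedMultimomentaFibre m F)
      (ReducedMultimomenta.proj : ReducedMultimomenta m F p → M)) :
    LocalSection m (MultimomentaFibre m F) (Multimomenta.proj : Multimomenta m F p → M) where
  dom := τ.dom
  isOpen_dom := τ.isOpen_dom
  toFun x := h.toFun (τ.toFun x)
  smooth := h.smooth.comp_contMDiffOn τ.smooth
  proj x hx := τ.proj x hx

/-- The Hamiltonian density `𝓗(ω) = ω - h(μ(ω))`, a form at the base point of `ω`. -/
def density (z : Multimomenta m F p) : HForms m F p 2 m z.pt :=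
  z.form - (show HForms m F p 2 m z.pt from h.form z.reduce)

theorem density_mem (z : Multimomenta m F p) : h.density z ∈ SemibasicForms m F p m z.pt := by
  rw [density, ← Submodule.Quotient.eq]
  exact (h.mk_form z.reduce).symm

/-- The Hamiltonian density as a differential `m`-form on `𝓜p`. -/
def densityForm : DifferentialForm (Base m × MultimomentaFibre m F) (Multimomenta m F p) m :=
  fun z => (h.density z).val.compContinuousLinearMap
    (mfderiv 𝓘(ℝ, Base m × MultimomentaFibre m F) 𝓘(ℝ, Base m × F)
      (FormBundle.pt : Multimomenta m F p → P) z)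

/-- A local section `τ` of `𝓜°p → M` is a critical point of `h` if it solves the
Hamilton-De Donder-Weyl equation `(h ∘ τ)^* i_X(Ω + d𝓗) = 0` for all vector fields `X` on
`𝓜p`. -/
def IsCriticalPoint (τ : LocalSection m (ReducedMultimomentaFibre m F)
    (ReducedMultimomenta.proj : ReducedMultimomenta m F p → M)) : Prop :=
  ∀ Y : ∀ z : Multimomenta m F p, TangentSpace 𝓘(ℝ, Base m × MultimomentaFibre m F) z,
    ContMDiff 𝓘(ℝ, Base m × MultimomentaFibre m F)
      𝓘(ℝ, Base m × MultimomentaFibre m F).tangent ∞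
      (fun z => (⟨z, Y z⟩ : TangentBundle 𝓘(ℝ, Base m × MultimomentaFibre m F)
        (Multimomenta m F p))) →
    ∀ x ∈ τ.dom,
      DifferentialForm.pullback (V' := Base m)
        ((canonicalForm m F p 2 m + h.densityForm.d).interior Y) (h.comp τ).toFun x = 0

end HamiltonianSection

end Hamiltonian

theorem insertion_sub_mem_horizontalForms {V W : Type*} [AddCommGroup V] [Module ℝ V]
    [TopologicalSpace V] [IsTopologicalAddGroup V] [ContinuousConstSMul ℝ V]
    [AddCommGroup W] [Module ℝ W] [TopologicalSpace W] {L : V →L[ℝ] W}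
    {m : ℕ} {α : V [⋀^Fin (m + 1)]→L[ℝ] ℝ} (hα : α ∈ horizontalForms L 3 (m + 1))
    {A : V →L[ℝ] V} (hA : ∀ v, L (A v) = L v) (hA0 : ∀ v, L v = 0 → A v = 0) :
    insertion A α - ((m : ℝ) - 1) • α ∈ horizontalForms L 2 (m + 1) := by
  rintro v ⟨s, hs, hv⟩
  have h1 : ∀ i ∈ s, α (Function.update v i (A (v i))) = 0 := fun i hi => by
    rw [hA0 _ (hv i hi)]
    exact α.map_coord_zero i (by simp)
  have h2 : ∀ i ∉ s, α (Function.update v i (A (v i))) = α v := fun i hi => by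
    have h3 : α (Function.update v i (v i - A (v i))) = 0 := by
      refine hα _ ⟨insert i s, by rw [Finset.card_insert_of_notMem hi, hs], fun j hj => ?_⟩
      by_cases hji : j = i
      · subst hji
        simp [hA]
      · rw [Function.update_of_ne hji]
        exact hv j ((Finset.mem_insert.1 hj).resolve_left hji)
    rw [α.map_update_sub, Function.update_eq_self, sub_eq_zero] at h3
    exact h3.symm
  have h4 : insertion A α v = ∑ i, α (Function.update v i (A (v i))) := rfl
  have h5 : (∑ i, α (Function.update v i (A (v i)))) = ∑ i ∈ sᶜ, α v := by
    rw [← Finset.sum_add_sum_compl s, Finset.sum_eq_zero h1, zero_add]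
    exact Finset.sum_congr rfl fun i hi => h2 i (Finset.mem_compl.1 hi)
  have h6 : (((sᶜ).card : ℕ) : ℝ) = (m : ℝ) - 1 := by
    rw [Finset.card_compl, hs, Fintype.card_fin]
    have h7 : 2 ≤ m + 1 := by
      have := s.card_le_univ
      rw [hs, Fintype.card_fin] at this
      exact this
    rw [Nat.cast_sub h7]
    push_cast
    ring
  rw [ContinuousAlternatingMap.sub_apply, ContinuousAlternatingMap.smul_apply, h4, h5,
    Finset.sum_const, ← Nat.cast_smul_eq_nsmul ℝ, h6, sub_self]

theorem FibreCoordinates.mdifferentiable_proj {m : ℕ} {F G : Type*} [NormedAddCommGroup F]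
    [NormedSpace ℝ F] [NormedAddCommGroup G] [NormedSpace ℝ G] {P M T : Type*}
    [TopologicalSpace M] [ChartedSpace (Base m) M]
    [TopologicalSpace P] [ChartedSpace (Base m × F) P] {p : P → M} {q : T → P}
    (fam : FibreCoordinates m F G p q)
    [FiniteDimensional ℝ F] [IsManifold 𝓘(ℝ, Base m × F) ∞ P] [IsFibration m F p] (t : T) :
    letI := fam.topology
    letI := fam.chartedSpace
    MDifferentiableAt 𝓘(ℝ, Base m × (F × G)) 𝓘(ℝ, Base m × F) q t := by
  let _ := fam.topology
  let _ := fam.chartedSpace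
  obtain ⟨c, hc⟩ := AdaptedChart.exists_mem_source (m := m) (F := F) (p := p) (q t)
  have ht : t ∈ (fam.lift c).total.source := hc
  have h1 := (fam.lift c).mdifferentiable_total.mdifferentiableAt ht
  have h2 : MDifferentiableAt 𝓘(ℝ, Base m × (F × G)) 𝓘(ℝ, Base m × F)
      (fun w : Base m × (F × G) => (w.1, w.2.1)) ((fam.lift c).total t) :=
    (show DifferentiableAt ℝ (fun w : Base m × (F × G) => (w.1, w.2.1)) _ by
      fun_prop).mdifferentiableAt
  have h3 : MDifferentiableAt 𝓘(ℝ, Base m × F) 𝓘(ℝ, Base m × F) c.total.symm (c.total (q t)) :=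
    c.mdifferentiable_total.mdifferentiableAt_symm (c.total.map_source hc)
  have h4 : q =ᶠ[𝓝 t] fun t => c.total.symm (((fam.lift c).total t).1,
      ((fam.lift c).total t).2.1) := by
    filter_upwards [(fam.lift c).total.open_source.mem_nhds ht] with t' ht'
    exact (c.total.left_inv ht').symm
  exact (MDifferentiableAt.comp t h3 (MDifferentiableAt.comp t h2 h1)).congr_of_eventuallyEq h4

section Flat

variable {m : ℕ} {F : Type*} [NormedAddCommGroup F] [NormedSpace ℝ F] [FiniteDimensional ℝ F]
  {P M : Type*} [TopologicalSpace M] [ChartedSpace (Base m) M]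
  [TopologicalSpace P] [ChartedSpace (Base m × F) P] [IsManifold 𝓘(ℝ, Base m × F) ∞ P]
  {p : P → M} [hp : IsFibration m F p]

/-- Semibasic forms stay semibasic when pulled back to `Λ^k_r P`. -/
theorem FormBundle.comp_mem {r k r' k' : ℕ} (t : FormBundle m F p r k)
    {α : TangentSpace 𝓘(ℝ, Base m × F) t.pt [⋀^Fin k']→L[ℝ] ℝ}
    (hα : α ∈ horizontalForms (mfderiv 𝓘(ℝ, Base m × F) 𝓘(ℝ, Base m) p t.pt) r' k') :
    α.compContinuousLinearMap
      (mfderiv 𝓘(ℝ, Base m × (F × ModelForms m F r k)) 𝓘(ℝ, Base m × F)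
        (FormBundle.pt : FormBundle m F p r k → P) t) ∈
      horizontalForms (mfderiv 𝓘(ℝ, Base m × (F × ModelForms m F r k)) 𝓘(ℝ, Base m)
        (p ∘ (FormBundle.pt : FormBundle m F p r k → P)) t) r' k' := by
  refine horizontalForms.comp_mem hα _ fun v hv => ?_
  have hpd : MDifferentiableAt 𝓘(ℝ, Base m × F) 𝓘(ℝ, Base m) p t.pt :=
    (hp.submersion.isSubmersionAt _).contMDiffAt.mdifferentiableAt (by simp)
  have h1 := (formCoordinates m F p r k).mdifferentiable_proj t
  rw [mfderiv_comp t hpd h1] at hv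
  exact hv

theorem canonicalForm_mem (r k : ℕ) (t : FormBundle m F p r k) :
    canonicalForm m F p r k t ∈
      horizontalForms (mfderiv 𝓘(ℝ, Base m × (F × ModelForms m F r k)) 𝓘(ℝ, Base m)
        (p ∘ (FormBundle.pt : FormBundle m F p r k → P)) t) (r + 1) (k + 1) :=
  Submodule.neg_mem _ (DifferentialForm.d_mem_horizontalForms
    (fun t => t.comp_mem t.form.2) ((formCoordinates m F p r k).exists_total_eq_chartAt t))

/-- The horizontal projector `T_{pt} P → T_{pt} P` of a jet. -/
def JetBundle.projector (z : JetBundle m F p) :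
    TangentSpace 𝓘(ℝ, Base m × F) z.pt →L[ℝ] TangentSpace 𝓘(ℝ, Base m × F) z.pt :=
  z.jet.comp (mfderiv 𝓘(ℝ, Base m × F) 𝓘(ℝ, Base m) p z.pt)

variable (m F p) in
/-- The jet bundle `J¹(p ∘ ν)` of `p ∘ ν : 𝓜p → M`. -/
abbrev MultimomentaJet : Type _ :=
  JetBundle m (MultimomentaFibre m F) (Multimomenta.proj : Multimomenta m F p → M)

variable (m F p) in
/-- The bundle `Λ^{m+1}_2 𝓜p`. -/
abbrev MultimomentaForms : Type _ :=
  FormBundle m (MultimomentaFibre m F) (Multimomenta.proj : Multimomenta m F p → M) 2 (m + 1)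

/-- The morphism `♭_Ω : J¹(p ∘ ν) → Λ^{m+1}_2 𝓜p`, `♭_Ω(z) = i_{h_z} Ω - (m - 1) Ω`. -/
def flat (z : MultimomentaJet m F p) : MultimomentaForms m F p where
  pt := z.pt
  form := HForms.mk
    (insertion z.projector (canonicalForm m F p 2 m z.pt) -
      ((m : ℝ) - 1) • canonicalForm m F p 2 m z.pt)
    (insertion_sub_mem_horizontalForms (canonicalForm_mem 2 m z.pt)
      (fun v => z.isSection _)
      (fun v hv => by
        change z.jet (mfderiv _ _ _ _ v) = 0
        rw [hv, map_zero]))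

namespace HamiltonianSection

variable (h : HamiltonianSection m F p)

/-- The map `-d𝓗 : 𝓜p → Λ^{m+1}_2 𝓜p`. -/
def negD (z : Multimomenta m F p) : MultimomentaForms m F p where
  pt := z
  form := HForms.mk (-h.densityForm.d z)
    (Submodule.neg_mem _ (DifferentialForm.d_mem_horizontalForms
      (fun z => z.comp_mem (h.density_mem z))
      ((formCoordinates m F p 2 m).exists_total_eq_chartAt z)))

/-- The set `S_𝓗 = ♭_Ω⁻¹(-d𝓗(𝓜p))`. -/
def equationSet : Set (MultimomentaJet m F p) := flat ⁻¹' range h.negD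

end HamiltonianSection

variable (m F p) in
/-- The premultisymplectic `(m + 2)`-form on `J¹(p ∘ ν)`, the pullback under `♭_Ω` of the
canonical form of `Λ^{m+1}_2 𝓜p`. -/
def jetForm : DifferentialForm
    (Base m × (MultimomentaFibre m F × (Base m →L[ℝ] MultimomentaFibre m F)))
    (MultimomentaJet m F p) (m + 2) :=
  DifferentialForm.pullback (V' := Base m × (MultimomentaFibre m F ×
      (Base m →L[ℝ] MultimomentaFibre m F)))
    (canonicalForm m (MultimomentaFibre m F)
      (Multimomenta.proj : Multimomenta m F p → M) 2 (m + 1)) flat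

end Flat

section Lagrangian

section Algebra

variable {V : Type*} [AddCommGroup V] [Module ℝ V] {k : ℕ}

/-- The kernel `{v | i_v Ω = 0}` of a form. -/
def formKernel (Ω : V [⋀^Fin (k + 1)]→ₗ[ℝ] ℝ) : Submodule ℝ V := LinearMap.ker Ω.curryLeft

/-- The `l`-orthogonal `{v | i_{v ∧ w₁ ∧ … ∧ w_l} Ω = 0 for all w₁, …, w_l ∈ W}`, for `l ≤ k`. -/
def orthogonal (Ω : V [⋀^Fin (k + 1)]→ₗ[ℝ] ℝ) (l : ℕ) (W : Submodule ℝ V) : Set V :=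
  {v | ∀ w : Fin k → V, (∀ i : Fin k, (i : ℕ) < l → w i ∈ W) → Ω.curryLeft v w = 0}

/-- `W` is `l`-Lagrangian for the form `Ω`: the image of `W` in the quotient of `V` by the kernel
of `Ω` is its own `l`-orthogonal for the form induced by `Ω`. -/
def IsLagrangianSubspace (Ω : V [⋀^Fin (k + 1)]→ₗ[ℝ] ℝ) (l : ℕ) (W : Submodule ℝ V) : Prop :=
  ∃ Ω' : (V ⧸ formKernel Ω) [⋀^Fin (k + 1)]→ₗ[ℝ] ℝ,
    Ω'.compLinearMap (formKernel Ω).mkQ = Ω ∧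
      orthogonal Ω' l (W.map (formKernel Ω).mkQ) = W.map (formKernel Ω).mkQ

end Algebra

variable {V : Type*} [NormedAddCommGroup V] [NormedSpace ℝ V] {X : Type*}
  [TopologicalSpace X] [ChartedSpace V X]

/-- On the open set `U`, `S` is the submanifold cut out by the independent equations `f = 0`. -/
structure IsLocalDefiningMap (S U : Set X) {Y : Type*} [NormedAddCommGroup Y] [NormedSpace ℝ Y]
    (f : X → Y) : Prop where
  isOpen : IsOpen U
  smooth : ContMDiffOn 𝓘(ℝ, V) 𝓘(ℝ, Y) ∞ f U
  inter_eq : S ∩ U = {z ∈ U | f z = 0}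
  surjective : ∀ z ∈ S ∩ U, Function.Surjective (mfderiv 𝓘(ℝ, V) 𝓘(ℝ, Y) f z)

/-- `S` is an `l`-Lagrangian submanifold for the form `Ω`: near each of its points `S` is cut out
by independent equations `f = 0`, and its tangent space `ker d_z f` is `l`-Lagrangian. -/
def IsLagrangianSubmanifold {k : ℕ} (S : Set X) (Ω : DifferentialForm V X (k + 1)) (l : ℕ) :
    Prop :=
  ∀ z ∈ S, ∃ (U : Set X) (j : ℕ) (f : X → Fin j → ℝ), z ∈ U ∧ IsLocalDefiningMap (V := V) S U f ∧
    IsLagrangianSubspace (Ω z).toAlternatingMap l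
      (LinearMap.ker (mfderiv 𝓘(ℝ, V) 𝓘(ℝ, Fin j → ℝ) f z).toLinearMap)

end Lagrangian

section Coordinates

variable {m n : ℕ}

/-- The fibre coordinates `u = (u^1, …, u^n)`. -/
abbrev Fibre (n : ℕ) := EuclideanSpace ℝ (Fin n)

/-- The coordinate vector `∂/∂x^i` of `ℝ^m × ℝ^n`. -/
def baseVector (i : Fin m) : Base m × Fibre n := (EuclideanSpace.single i 1, 0)

/-- The coordinate vector `∂/∂u^a` of `ℝ^m × ℝ^n`. -/
def fibreVector (a : Fin n) : Base m × Fibre n := (0, EuclideanSpace.single a 1)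

/-- The coordinate `p` of the form `p d^mx + ∑ p^i_a du^a ∧ d^{m-1}x_i`. -/
def energyCoord (β : ModelForms m (Fibre n) 2 m) : ℝ := β.val baseVector

/-- The coordinates `p^i_a` of the form `p d^mx + ∑ p^i_a du^a ∧ d^{m-1}x_i`. -/
def momentumCoord : ModelForms m (Fibre n) 2 m →ₗ[ℝ] Fin m → Fin n → ℝ where
  toFun β i a := β.val (Function.update baseVector i (fibreVector a))
  map_add' _ _ := rfl
  map_smul' _ _ := rfl

theorem momentumCoord_eq_zero :
    ModelSemibasic m (Fibre n) m ≤ LinearMap.ker (momentumCoord (m := m) (n := n)) := by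
  intro β hβ
  have hβ' : β.val ∈ horizontalForms (ContinuousLinearMap.fst ℝ (Base m) (Fibre n)) 1 m := hβ
  refine LinearMap.mem_ker.2 ?_
  funext i a
  exact hβ' _ ⟨{i}, by simp, by simp [fibreVector]⟩

/-- The coordinates `p^i_a` on the classes of forms modulo `d^mx`. -/
def reducedMomentumCoord :
    (ModelForms m (Fibre n) 2 m ⧸ ModelSemibasic m (Fibre n) m) →ₗ[ℝ] Fin m → Fin n → ℝ :=
  (ModelSemibasic m (Fibre n) m).liftQ momentumCoord momentumCoord_eq_zero

/-- The map `(x, u) ↦ (x^1, …, u^a, …, x^m)` with `u^a` in the place of `x^i`. -/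
def replaceCoord (i : Fin m) (a : Fin n) : Base m × Fibre n →L[ℝ] Fin m → ℝ :=
  ContinuousLinearMap.pi fun j =>
    if j = i then (EuclideanSpace.proj a).comp (ContinuousLinearMap.snd ℝ (Base m) (Fibre n))
    else (EuclideanSpace.proj j).comp (ContinuousLinearMap.fst ℝ (Base m) (Fibre n))

/-- The determinant as an alternating form on `ℝ^m`. -/
def detForm (m : ℕ) : (Fin m → ℝ) [⋀^Fin m]→L[ℝ] ℝ where
  toAlternatingMap := Matrix.detRowAlternating
  cont := Continuous.matrix_det (A := fun v : Fin m → Fin m → ℝ => Matrix.of v) continuous_id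

/-- The form `du^a ∧ d^{m-1}x_i` on `ℝ^m × ℝ^n`, i.e. `d^mx` with `dx^i` replaced by `du^a`. -/
def momentumForm (i : Fin m) (a : Fin n) : ModelForms m (Fibre n) 2 m :=
  ModelForms.mk ((detForm m).compContinuousLinearMap (replaceCoord i a)) <| by
    rintro v ⟨s, hs, hv⟩
    obtain ⟨j, k, hjk, rfl⟩ := Finset.card_eq_two.1 hs
    have h1 : ∀ w : Base m × Fibre n, w.1 = 0 →
        replaceCoord i a w = (w.2 a) • (Pi.single i 1 : Fin m → ℝ) := fun w hw => by
      funext l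
      by_cases hl : l = i
      · subst hl
        simp [replaceCoord]
      · simp [replaceCoord, hl, hw]
    have hj := h1 _ (hv j (by simp))
    have hk := h1 _ (hv k (by simp))
    set w : Fin m → Fin m → ℝ := fun l => replaceCoord i a (v l) with hw
    change detForm m w = 0
    have h2 : w = Function.update (Function.update w j (w j)) k (w k) := by simp
    rw [h2]
    change detForm m (Function.update (Function.update w j (replaceCoord i a (v j))) k
      (replaceCoord i a (v k))) = 0
    rw [hj, hk, (detForm m).map_update_smul, Function.update_comm hjk,
      (detForm m).map_update_smul]
    rw [(detForm m).map_eq_zero_of_eq _ (i := j) (j := k) _ hjk]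
    · simp
    · simp [Function.update_of_ne hjk.symm]

variable {E M : Type*} [TopologicalSpace M] [ChartedSpace (Base m) M]
  [TopologicalSpace E] [ChartedSpace (Base m × Fibre n) E]
  [IsManifold 𝓘(ℝ, Base m × Fibre n) ∞ E]
  {π : E → M} [IsFibration m (Fibre n) π]

namespace HamiltonianSection

variable (h : HamiltonianSection m (Fibre n) π) (c : AdaptedChart m (Fibre n) π)

/-- The Hamiltonian function `H(x, u, p^i_a)` in the fibred chart `c`: the section `h` is
`(x, u, p^i_a) ↦ (x, u, p = -H(x, u, p^i_a), p^i_a)`. -/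
def hamiltonian (y : (Base m × Fibre n) × (Fin m → Fin n → ℝ)) : ℝ :=
  -energyCoord (c.pushForm 2 m _ (h.form ((reducedCoordinates m (Fibre n) π m).point c y.1
    (Submodule.Quotient.mk (∑ i, ∑ a, y.2 i a • momentumForm i a)))))

/-- `∂H/∂u^a`. -/
def fibrePartial (a : Fin n) (y : (Base m × Fibre n) × (Fin m → Fin n → ℝ)) : ℝ :=
  fderiv ℝ (h.hamiltonian c) y (fibreVector a, 0)

/-- `∂H/∂p^i_a`. -/
def momentumPartial (i : Fin m) (a : Fin n) (y : (Base m × Fibre n) × (Fin m → Fin n → ℝ)) : ℝ :=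
  fderiv ℝ (h.hamiltonian c) y (0, Pi.single i (Pi.single a 1))

end HamiltonianSection

/-- The coordinates `((x, u), p^i_a)` of `t ∈ 𝓜°π`. -/
def reducedPosition (c : AdaptedChart m (Fibre n) π) (t : ReducedMultimomenta m (Fibre n) π) :
    (Base m × Fibre n) × (Fin m → Fin n → ℝ) :=
  (c.total t.pt, reducedMomentumCoord ((reducedCoordinates m (Fibre n) π m).coord c t))

/-- The coordinates of a jet `z ∈ J¹(π ∘ ν)` in the chart induced by `c`: the base point has
coordinates `((x, u), p^i_a)`. -/
def jetPosition (c : AdaptedChart m (Fibre n) π) (z : MultimomentaJet m (Fibre n) π) :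
    (Base m × Fibre n) × (Fin m → Fin n → ℝ) :=
  reducedPosition c z.pt.reduce

/-- The jet coordinates `(u^a_j, p_j, p^i_{aj})` in the chart of `𝓜π` induced by `c`, as a linear
map sending `∂/∂x^j` to the `j`-th partial derivatives. -/
def jetDerivative (c : AdaptedChart m (Fibre n) π) (z : MultimomentaJet m (Fibre n) π) :
    Base m →L[ℝ] MultimomentaFibre m (Fibre n) :=
  ((formCoordinates m (Fibre n) π 2 m).lift c).jetCoord z

/-- The jet coordinate `u^a_j`. -/
def jetFibre (c : AdaptedChart m (Fibre n) π) (j : Fin m) (a : Fin n)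
    (z : MultimomentaJet m (Fibre n) π) : ℝ :=
  (jetDerivative c z (EuclideanSpace.single j 1)).1 a

/-- The jet coordinate `p^i_{aj}`. -/
def jetMomentum (c : AdaptedChart m (Fibre n) π) (i j : Fin m) (a : Fin n)
    (z : MultimomentaJet m (Fibre n) π) : ℝ :=
  momentumCoord (jetDerivative c z (EuclideanSpace.single j 1)).2 i a

/-- The left-hand sides minus the right-hand sides of the equations
`u^a_j = ∂H/∂p^j_a` and `∑ j, p^j_{aj} = -∂H/∂u^a` for jets. -/
def hamiltonMap (h : HamiltonianSection m (Fibre n) π) (c : AdaptedChart m (Fibre n) π)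
    (z : MultimomentaJet m (Fibre n) π) : (Fin m → Fin n → ℝ) × (Fin n → ℝ) :=
  (fun j a => jetFibre c j a z - h.momentumPartial c j a (jetPosition c z),
    fun a => (∑ j, jetMomentum c j j a z) - (-h.fibrePartial c a (jetPosition c z)))

/-- Hamilton's equations for `τ` at the point `x` in the coordinates given by `c`:
`∂(u^a ∘ τ)/∂x^i = ∂H/∂p^i_a ∘ τ` and `∑ i, ∂(p^i_a ∘ τ)/∂x^i = -∂H/∂u^a ∘ τ`. -/
def HamiltonEquationsAt (h : HamiltonianSection m (Fibre n) π) (c : AdaptedChart m (Fibre n) π)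
    (τ : M → ReducedMultimomenta m (Fibre n) π) (x : M) : Prop :=
  (∀ (i : Fin m) (a : Fin n),
    fderiv ℝ (fun s : Base m => (reducedPosition c (τ (c.base.symm s))).1.2 a) (c.base x)
      (EuclideanSpace.single i 1) = h.momentumPartial c i a (reducedPosition c (τ x))) ∧
  ∀ a : Fin n,
    ∑ i : Fin m, fderiv ℝ (fun s : Base m => (reducedPosition c (τ (c.base.symm s))).2 i a)
      (c.base x) (EuclideanSpace.single i 1) = -h.fibrePartial c a (reducedPosition c (τ x))

end Coordinates

end

noncomputable section

section LagrangianAlgebra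

variable {V : Type*} [AddCommGroup V] [Module ℝ V] {k : ℕ}

theorem AlternatingMap.eq_of_sub_mem_formKernel (Ω : V [⋀^Fin (k + 1)]→ₗ[ℝ] ℝ)
    {v w : Fin (k + 1) → V} (h : ∀ i, v i - w i ∈ formKernel Ω) : Ω v = Ω w := by
  have hker : ∀ (u : Fin (k + 1) → V) (i : Fin (k + 1)), u i ∈ formKernel Ω → Ω u = 0 := by
    intro u i hi
    have h0 : Ω.curryLeft (u i) = 0 := LinearMap.mem_ker.1 hi
    have h1 : Ω (u ∘ Equiv.swap 0 i) = 0 := by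
      have h2 : Matrix.vecCons (u i) (Fin.tail (u ∘ Equiv.swap 0 i)) = u ∘ Equiv.swap 0 i := by
        have := Fin.cons_self_tail (u ∘ Equiv.swap 0 i)
        simpa [Matrix.vecCons] using this
      have h3 := congrArg (fun α => α (Fin.tail (u ∘ Equiv.swap 0 i))) h0
      simp only [AlternatingMap.curryLeft_apply_apply, AlternatingMap.zero_apply] at h3
      rwa [h2] at h3
    rw [AlternatingMap.map_perm] at h1
    rcases eq_or_ne 0 i with rfl | h0i
    · simpa using h1
    · simpa [Equiv.Perm.sign_swap h0i] using h1
  have key : ∀ s : Finset (Fin (k + 1)), Ω (s.piecewise w v) = Ω v := by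
    intro s
    induction s using Finset.induction_on with
    | empty => simp
    | insert i s hi ih =>
      rw [Finset.piecewise_insert, ← ih]
      have h1 := hker (Function.update (s.piecewise w v) i (v i - w i)) i (by simpa using h i)
      rw [Ω.map_update_sub, sub_eq_zero] at h1
      rw [← h1]
      congr 1
      rw [← Finset.piecewise_eq_of_notMem s w v hi, Function.update_eq_self]
  simpa using (key Finset.univ).symm

/-- A subspace `W` on which `Ω` vanishes and which contains, modulo the kernel of `Ω`, every `v`
with `i_v Ω = 0` on `W`, is Lagrangian. -/
theorem IsLagrangianSubspace.of_isotropic (Ω : V [⋀^Fin (k + 1)]→ₗ[ℝ] ℝ) (W : Submodule ℝ V)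
    (h1 : ∀ w : Fin (k + 1) → V, (∀ i, w i ∈ W) → Ω w = 0)
    (h2 : ∀ v, (∀ w : Fin k → V, (∀ i, w i ∈ W) → Ω (Fin.cons v w) = 0) →
      ∃ v' ∈ W, v - v' ∈ formKernel Ω) :
    IsLagrangianSubspace Ω k W := by
  obtain ⟨s, hs⟩ := (formKernel Ω).mkQ.exists_rightInverse_of_surjective
    (formKernel Ω).range_mkQ
  have hs' : ∀ q, (formKernel Ω).mkQ (s q) = q := fun q => LinearMap.congr_fun hs q
  have hpull : ∀ v : Fin (k + 1) → V,
      Ω.compLinearMap s (fun i => (formKernel Ω).mkQ (v i)) = Ω v := by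
    intro v
    refine Ω.eq_of_sub_mem_formKernel fun i => ?_
    rw [← Submodule.Quotient.eq]
    exact hs' _
  refine ⟨Ω.compLinearMap s, AlternatingMap.ext hpull, ?_⟩
  have hcons : ∀ (v : V) (w : Fin k → V),
      (Ω.compLinearMap s).curryLeft ((formKernel Ω).mkQ v) (fun i => (formKernel Ω).mkQ (w i)) =
        Ω (Fin.cons v w) := by
    intro v w
    rw [← hpull, AlternatingMap.curryLeft_apply_apply]
    congr 1
    funext i
    refine Fin.cases rfl (fun i => rfl) i
  ext q
  obtain ⟨v, rfl⟩ := (formKernel Ω).mkQ_surjective q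
  constructor
  · intro hv
    obtain ⟨v', hv', hvv⟩ := h2 v fun w hw => by
      rw [← hcons]
      exact hv _ fun i _ => Submodule.mem_map_of_mem (hw i)
    refine ⟨v', hv', ?_⟩
    exact ((Submodule.Quotient.eq _).2 hvv).symm
  · rintro ⟨v', hv', hvv⟩ w hw
    choose w' hw' hww using fun i => hw i i.2
    obtain rfl : (fun i => (formKernel Ω).mkQ (w' i)) = w := funext hww
    rw [← hvv, hcons]
    refine h1 _ fun i => ?_
    refine Fin.cases hv' (fun i => hw' i) i

variable {Y G T : Type*} [AddCommGroup Y] [Module ℝ Y] [TopologicalSpace Y] [AddCommGroup G]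
  [Module ℝ G] [AddCommGroup T] [Module ℝ T]

/-- Let `Ω` be the alternation of the forms `B g` on `Y`, pulled back to `T ≅ Y × G`, and let
`W` be the subspace `B g = C y`, where the alternation of `C` vanishes. -/
theorem IsLagrangianSubspace.of_graph (a : T →ₗ[ℝ] Y) (b : T →ₗ[ℝ] G)
    (hab : ∀ y g, ∃ t, a t = y ∧ b t = g)
    (B : G →ₗ[ℝ] Y [⋀^Fin k]→L[ℝ] ℝ) (C : Y →ₗ[ℝ] Y [⋀^Fin k]→L[ℝ] ℝ)
    (Ω : T [⋀^Fin (k + 1)]→ₗ[ℝ] ℝ)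
    (hΩ : ∀ v, Ω v = -∑ i : Fin (k + 1),
      (-1 : ℝ) ^ (i : ℕ) * B (b (v i)) (i.removeNth fun j => a (v j)))
    (hC : ∀ y : Fin (k + 1) → Y, ∑ i : Fin (k + 1),
      (-1 : ℝ) ^ (i : ℕ) * C (y i) (i.removeNth y) = 0)
    (hBC : ∀ y, ∃ g, B g = C y) (W : Submodule ℝ T) (hW : ∀ t, t ∈ W ↔ B (b t) = C (a t)) :
    IsLagrangianSubspace Ω k W := by
  have h1 : ∀ w : Fin (k + 1) → T, (∀ i, w i ∈ W) → Ω w = 0 := by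
    intro w hw
    rw [hΩ, neg_eq_zero]
    trans ∑ i : Fin (k + 1), (-1 : ℝ) ^ (i : ℕ) * C (a (w i)) (i.removeNth fun j => a (w j))
    · exact Finset.sum_congr rfl fun i _ => by rw [(hW _).1 (hw i)]
    · exact hC _
  have hlift : ∀ y, ∃ t ∈ W, a t = y := by
    intro y
    obtain ⟨g, hg⟩ := hBC y
    obtain ⟨t, rfl, rfl⟩ := hab y g
    exact ⟨t, (hW t).2 hg, rfl⟩
  have hvert : ∀ (t : T) (w : Fin k → T), a t = 0 →
      Ω (Fin.cons t w) = -B (b t) (fun i => a (w i)) := by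
    intro t w ht
    rw [hΩ, Fin.sum_univ_succ]
    have h0 : ∀ i : Fin k, B (b ((Fin.cons t w : Fin (k + 1) → T) i.succ))
        (i.succ.removeNth fun j => a ((Fin.cons t w : Fin (k + 1) → T) j)) = 0 := by
      intro i
      obtain _ | k := k
      · exact i.elim0
      refine ContinuousAlternatingMap.map_coord_zero _ 0 ?_
      simp [Fin.removeNth, ht]
    simp only [h0, mul_zero, Finset.sum_const_zero, add_zero]
    simp only [Fin.cons_zero, Fin.val_zero, pow_zero, one_mul]
    congr 2
  refine .of_isotropic Ω W h1 fun v hv => ?_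
  obtain ⟨v', hv', hav⟩ := hlift (a v)
  refine ⟨v', hv', ?_⟩
  have ha : a (v - v') = 0 := by rw [map_sub, hav, sub_self]
  have hB : B (b (v - v')) = 0 := by
    ext y
    choose w hw hwy using fun i => hlift (y i)
    have h3 : Ω (Fin.cons (v - v') w) = 0 := by
      have h4 : Ω (Fin.cons v' w) = 0 :=
        h1 _ fun i => Fin.cases hv' (fun i => hw i) i
      have h5 := hv w hw
      have h6 := Ω.toMultilinearMap.cons_add w (v - v') v'
      simp only [AlternatingMap.coe_multilinearMap, sub_add_cancel] at h6
      rw [h5, h4, add_zero] at h6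
      exact h6.symm
    rw [hvert _ _ ha, neg_eq_zero] at h3
    simpa [hwy] using h3
  refine LinearMap.mem_ker.2 (AlternatingMap.ext fun w => ?_)
  have := hvert _ w ha
  rw [hB] at this
  exact this.trans neg_zero

end LagrangianAlgebra

section ExteriorDerivative

variable {V : Type*} [NormedAddCommGroup V] [NormedSpace ℝ V] {X : Type*}
  [TopologicalSpace X] [ChartedSpace V X] {k : ℕ}

/-- The expression of a differential form in the chart `e`. -/
def DifferentialForm.inLocalChart (α : DifferentialForm V X k) (e : OpenPartialHomeomorph X V)
    (y : V) : V [⋀^Fin k]→L[ℝ] ℝ :=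
  (α (e.symm y)).compContinuousLinearMap (mfderiv 𝓘(ℝ, V) 𝓘(ℝ, V) e.symm y)

theorem mdifferentiable_of_mem_maximalAtlas [IsManifold 𝓘(ℝ, V) ∞ X]
    {e : OpenPartialHomeomorph X V} (he : e ∈ IsManifold.maximalAtlas 𝓘(ℝ, V) ∞ X) :
    e.MDifferentiable 𝓘(ℝ, V) 𝓘(ℝ, V) :=
  ⟨(contMDiffOn_of_mem_maximalAtlas he).mdifferentiableOn (by simp),
    (contMDiffOn_symm_of_mem_maximalAtlas he).mdifferentiableOn (by simp)⟩

/-- The exterior derivative may be computed in any chart. -/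
theorem DifferentialForm.d_eq [IsManifold 𝓘(ℝ, V) ∞ X] (α : DifferentialForm V X k)
    {e : OpenPartialHomeomorph X V} (he : e ∈ IsManifold.maximalAtlas 𝓘(ℝ, V) ∞ X) {z : X}
    (hz : z ∈ e.source) (hα : DifferentiableAt ℝ (α.inLocalChart e) (e z)) :
    α.d z = (extDeriv (α.inLocalChart e) (e z)).compContinuousLinearMap
      (mfderiv 𝓘(ℝ, V) 𝓘(ℝ, V) e z) := by
  set e₀ := chartAt V z with he₀
  have hm₀ : e₀ ∈ IsManifold.maximalAtlas 𝓘(ℝ, V) ∞ X := IsManifold.chart_mem_maximalAtlas z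
  have hz₀ : z ∈ e₀.source := mem_chart_source V z
  have hd := mdifferentiable_of_mem_maximalAtlas he
  have hd₀ := mdifferentiable_of_mem_maximalAtlas hm₀
  let f : V → V := e ∘ e₀.symm
  have hf : ContDiffOn ℝ ∞ f (e₀.symm.trans e).source := by
    have := (contMDiffOn_of_mem_maximalAtlas he).comp' (contMDiffOn_symm_of_mem_maximalAtlas hm₀)
    rw [contMDiffOn_iff_contDiffOn] at this
    exact this
  have hmem : e₀ z ∈ (e₀.symm.trans e).source := by
    simp [e₀.map_source hz₀, e₀.left_inv hz₀, hz]
  have hnhds := (e₀.symm.trans e).open_source.mem_nhds hmem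
  have hfz : f (e₀ z) = e z := congrArg e (e₀.left_inv hz₀)
  have hchart : ∀ y ∈ (e₀.symm.trans e).source, HasMFDerivAt 𝓘(ℝ, V) 𝓘(ℝ, V) f y
      (fderiv ℝ f y) := fun y hy =>
    (((hf.contDiffAt ((e₀.symm.trans e).open_source.mem_nhds hy)).differentiableAt
      (by simp)).hasFDerivAt).hasMFDerivAt
  have h1 : α.inChart z =ᶠ[𝓝 (e₀ z)] fun y =>
      (α.inLocalChart e (f y)).compContinuousLinearMap (fderiv ℝ f y) := by
    filter_upwards [hnhds] with y hy
    have hy' : y ∈ e₀.target ∧ e₀.symm y ∈ e.source := by simpa using hy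
    have h2 : e.symm (f y) = e₀.symm y := e.left_inv hy'.2
    have h3 : HasMFDerivAt 𝓘(ℝ, V) 𝓘(ℝ, V) e.symm (f y) _ :=
      (hd.mdifferentiableAt_symm (e.map_source hy'.2)).hasMFDerivAt
    have h4 := h3.comp y (hchart y hy)
    have h5 : e.symm ∘ f =ᶠ[𝓝 y] e₀.symm := by
      filter_upwards [(e₀.symm.trans e).open_source.mem_nhds hy] with y' hy'
      have : y' ∈ e₀.target ∧ e₀.symm y' ∈ e.source := by simpa using hy'
      exact e.left_inv this.2
    have h6 := (h4.congr_of_eventuallyEq h5.symm).mfderiv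
    let α' : X → V [⋀^Fin k]→L[ℝ] ℝ := α
    ext v
    change α' (e₀.symm y) (fun i => (mfderiv 𝓘(ℝ, V) 𝓘(ℝ, V) e₀.symm y : V →L[ℝ] V) (v i)) =
      α' (e.symm (f y)) _
    rw [h2, h6]
    rfl
  have h2 : HasMFDerivAt 𝓘(ℝ, V) 𝓘(ℝ, V) (f ∘ e₀) z _ :=
    (hchart _ hmem).comp z (hd₀.mdifferentiableAt hz₀).hasMFDerivAt
  have h3 : f ∘ e₀ =ᶠ[𝓝 z] e := by
    filter_upwards [e₀.open_source.mem_nhds hz₀] with z' hz'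
    exact congrArg e (e₀.left_inv hz')
  have h4 := (h2.congr_of_eventuallyEq h3.symm).mfderiv
  rw [← hfz] at hα
  have h5 := extDeriv_pullback (r := ∞) hα (hf.contDiffAt hnhds)
    (by rw [minSmoothness_of_isRCLikeNormedField]; exact WithTop.coe_le_coe.2 le_top)
  rw [DifferentialForm.d, h1.extDeriv_eq, h5, hfz, h4]
  rfl

end ExteriorDerivative

section VectorFields

variable {V : Type*} [NormedAddCommGroup V] [NormedSpace ℝ V] [FiniteDimensional ℝ V] {X : Type*}
  [TopologicalSpace X] [T2Space X] [ChartedSpace V X] [IsManifold 𝓘(ℝ, V) ∞ X]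

/-- Every tangent vector of a Hausdorff manifold extends to a smooth vector field. -/
theorem exists_vectorField_eq (x : X) (v : TangentSpace 𝓘(ℝ, V) x) :
    ∃ Y : ∀ z : X, TangentSpace 𝓘(ℝ, V) z,
      ContMDiff 𝓘(ℝ, V) 𝓘(ℝ, V).tangent ∞
        (fun z => (⟨z, Y z⟩ : TangentBundle 𝓘(ℝ, V) X)) ∧ Y x = v := by
  obtain ⟨s, hs, hsm⟩ := FiberBundle.exists_contMDiffOn_extend (k := ∞) 𝓘(ℝ, V) V v
  obtain ⟨f, -, hf⟩ := ((SmoothBumpFunction.nhds_basis_tsupport (I := 𝓘(ℝ, V)) x).mem_iff.1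
    (interior_mem_nhds.2 hs))
  refine ⟨fun z => f z • FiberBundle.extend V v z, ?_, ?_⟩
  · have h := ContMDiffOn.smul_section_of_tsupport (n := ∞) (I := 𝓘(ℝ, V)) (F := V)
      (V := fun z : X => TangentSpace 𝓘(ℝ, V) z) (f.contMDiff.contMDiffOn (s := interior s))
      isOpen_interior hf (hsm.mono interior_subset)
    exact h
  · simp

end VectorFields

section ModelForms

variable (m : ℕ) (F : Type*) [NormedAddCommGroup F] [NormedSpace ℝ F]

/-- The projection `(x, (u, g)) ↦ (x, u)`. -/
def dropFibre (G : Type*) [NormedAddCommGroup G] [NormedSpace ℝ G] :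
    Base m × (F × G) →L[ℝ] Base m × F :=
  (ContinuousLinearMap.fst ℝ (Base m) (F × G)).prod
    ((ContinuousLinearMap.fst ℝ F G).comp (ContinuousLinearMap.snd ℝ (Base m) (F × G)))

variable [FiniteDimensional ℝ F] (r k : ℕ)

/-- The tautological form of `Λ^k_r` in coordinates. -/
def modelTautological : (Base m × (F × ModelForms m F r k)) →L[ℝ]
    (Base m × (F × ModelForms m F r k)) [⋀^Fin k]→L[ℝ] ℝ :=
  LinearMap.toContinuousLinearMap
    (ContinuousAlternatingMap.compContinuousLinearMapₗ (dropFibre m F (ModelForms m F r k)) ∘ₗ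
      ModelForms.val ∘ₗ LinearMap.snd ℝ F (ModelForms m F r k) ∘ₗ
        LinearMap.snd ℝ (Base m) (F × ModelForms m F r k))

/-- The canonical form of `Λ^k_r` in coordinates. -/
def modelCanonical : (Base m × (F × ModelForms m F r k)) [⋀^Fin (k + 1)]→L[ℝ] ℝ :=
  -ContinuousAlternatingMap.alternatizeUncurryFin (modelTautological m F r k)

variable {m F r k}

theorem modelTautological_apply (y : Base m × (F × ModelForms m F r k)) :
    modelTautological m F r k y =
      y.2.2.val.compContinuousLinearMap (dropFibre m F (ModelForms m F r k)) := rfl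

theorem modelCanonical_apply (v : Fin (k + 1) → Base m × (F × ModelForms m F r k)) :
    modelCanonical m F r k v = -∑ i : Fin (k + 1), (-1 : ℝ) ^ (i : ℕ) *
      (v i).2.2.val (i.removeNth fun j => ((v j).1, (v j).2.1)) := by
  change -(ContinuousAlternatingMap.alternatizeUncurryFin (modelTautological m F r k)) v = _
  rw [ContinuousAlternatingMap.alternatizeUncurryFin_apply]
  simp only [zsmul_eq_mul, Int.cast_pow, Int.cast_neg, Int.cast_one]
  rfl

end ModelForms

section FormBundles

variable {m : ℕ} {F : Type*} [NormedAddCommGroup F] [NormedSpace ℝ F] [FiniteDimensional ℝ F]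
  {P M : Type*} [TopologicalSpace M] [ChartedSpace (Base m) M]
  [TopologicalSpace P] [ChartedSpace (Base m × F) P] [IsManifold 𝓘(ℝ, Base m × F) ∞ P]
  {p : P → M} [hp : IsFibration m F p] {r k : ℕ}

variable (r k) in
/-- The chart of `Λ^k_r P` induced by a fibred chart of `P`. -/
abbrev AdaptedChart.formLift (c : AdaptedChart m F p) :
    AdaptedChart m (F × ModelForms m F r k)
      (p ∘ (FormBundle.pt : FormBundle m F p r k → P)) :=
  (formCoordinates m F p r k).lift c

theorem AdaptedChart.tangentCoord_mfderiv_pt (c : AdaptedChart m F p) (t : FormBundle m F p r k)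
    (ht : t.pt ∈ c.total.source)
    (v : TangentSpace 𝓘(ℝ, Base m × (F × ModelForms m F r k)) t) :
    c.tangentCoord t.pt (mfderiv 𝓘(ℝ, Base m × (F × ModelForms m F r k)) 𝓘(ℝ, Base m × F)
        (FormBundle.pt : FormBundle m F p r k → P) t v) =
      dropFibre m F _ ((c.formLift r k).tangentCoord t v) := by
  have h1 := HasMFDerivAt.comp t
    (c.mdifferentiable_total.mdifferentiableAt ht).hasMFDerivAt
    ((formCoordinates m F p r k).mdifferentiable_proj t).hasMFDerivAt
  have h2 := HasMFDerivAt.comp t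
    ((dropFibre m F (ModelForms m F r k)).hasMFDerivAt (x := (c.formLift r k).total t))
    ((c.formLift r k).mdifferentiable_total.mdifferentiableAt (x := t) ht).hasMFDerivAt
  exact congrArg (fun L => L v) (hasMFDerivAt_unique h1 h2)

theorem AdaptedChart.mfderiv_pt_tangentPoint (c : AdaptedChart m F p) (t : FormBundle m F p r k)
    (ht : t.pt ∈ c.total.source) (w : Base m × (F × ModelForms m F r k)) :
    mfderiv 𝓘(ℝ, Base m × (F × ModelForms m F r k)) 𝓘(ℝ, Base m × F)
        (FormBundle.pt : FormBundle m F p r k → P) t ((c.formLift r k).tangentPoint t w) =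
      c.tangentPoint t.pt (dropFibre m F _ w) := by
  have h := c.tangentCoord_mfderiv_pt t ht ((c.formLift r k).tangentPoint t w)
  rw [(c.formLift r k).tangentCoord_point (e := t) ht] at h
  rw [← h, c.tangentPoint_coord ht]

/-- A form `t ↦ ν^* (a t)` on `ν : Λ^k_r P → P` in a chart. -/
theorem AdaptedChart.inLocalChart_pullback {r' k' : ℕ} (c : AdaptedChart m F p)
    (a : ∀ t : FormBundle m F p r k, HForms m F p r' k' t.pt)
    {y : Base m × (F × ModelForms m F r k)} (hy : y ∈ (c.formLift r k).total.target) :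
    DifferentialForm.inLocalChart
        (fun t : FormBundle m F p r k => (a t).val.compContinuousLinearMap
          (mfderiv 𝓘(ℝ, Base m × (F × ModelForms m F r k)) 𝓘(ℝ, Base m × F)
            (FormBundle.pt : FormBundle m F p r k → P) t)) (c.formLift r k).total y =
      (c.pushForm r' k' _ (a ((c.formLift r k).total.symm y))).val.compContinuousLinearMap
        (dropFibre m F _) := by
  obtain ⟨t, ht, rfl⟩ : ∃ t ∈ (c.formLift r k).total.source, (c.formLift r k).total t = y :=
    ⟨_, (c.formLift r k).total.map_target hy, (c.formLift r k).total.right_inv hy⟩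
  rw [(c.formLift r k).total.left_inv ht, AdaptedChart.coe_pushForm (show t.pt ∈ _ from ht)]
  unfold DifferentialForm.inLocalChart
  rw [(c.formLift r k).total.left_inv ht]
  ext v
  change (a t).val _ = (a t).val _
  congr 1
  funext i
  exact c.mfderiv_pt_tangentPoint t ht (v i)

theorem AdaptedChart.inLocalChart_tautologicalForm (c : AdaptedChart m F p)
    {y : Base m × (F × ModelForms m F r k)} (hy : y ∈ (c.formLift r k).total.target) :
    (tautologicalForm m F p r k).inLocalChart (c.formLift r k).total y =
      modelTautological m F r k y := by
  refine (c.inLocalChart_pullback (fun t => t.form) hy).trans ?_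
  rw [modelTautological_apply]
  exact congrArg (fun a : ModelForms m F r k =>
      a.val.compContinuousLinearMap (dropFibre m F (ModelForms m F r k)))
    (congrArg (fun w : Base m × (F × ModelForms m F r k) => w.2.2)
      ((c.formLift r k).total.right_inv hy))

/-- The canonical form of `Λ^k_r P` in a chart. -/
theorem AdaptedChart.canonicalForm_eq (c : AdaptedChart m F p) (t : FormBundle m F p r k)
    (ht : t.pt ∈ c.total.source) :
    canonicalForm m F p r k t =
      (modelCanonical m F r k).compContinuousLinearMap ((c.formLift r k).tangentCoord t) := by
  have ht' : t ∈ (c.formLift r k).total.source := ht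
  have h1 : (tautologicalForm m F p r k).inLocalChart (c.formLift r k).total
      =ᶠ[𝓝 ((c.formLift r k).total t)] modelTautological m F r k := by
    filter_upwards [(c.formLift r k).total.open_target.mem_nhds
      ((c.formLift r k).total.map_source ht')] with y hy
    exact c.inLocalChart_tautologicalForm hy
  have h2 := (tautologicalForm m F p r k).d_eq (c.formLift r k).total_mem ht'
    ((modelTautological m F r k).differentiableAt.congr_of_eventuallyEq h1)
  have h3 : canonicalForm m F p r k t = -(tautologicalForm m F p r k).d t := rfl
  rw [h3, h2, h1.extDeriv_eq, extDeriv, ContinuousLinearMap.fderiv]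
  rfl

theorem modelTautological_mem (y : Base m × (F × ModelForms m F r k)) :
    modelTautological m F r k y ∈
      horizontalForms (ContinuousLinearMap.fst ℝ (Base m) (F × ModelForms m F r k)) r k :=
  horizontalForms.comp_mem y.2.2.2 _ fun _ h => h

theorem modelCanonical_mem :
    modelCanonical m F r k ∈
      horizontalForms (ContinuousLinearMap.fst ℝ (Base m) (F × ModelForms m F r k))
        (r + 1) (k + 1) := by
  have h := extDeriv_mem_horizontalForms
    (ContinuousLinearMap.fst ℝ (Base m) (F × ModelForms m F r k)) r k
    (modelTautological m F r k) 0 (Eventually.of_forall modelTautological_mem)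
  rw [extDeriv, ContinuousLinearMap.fderiv] at h
  exact Submodule.neg_mem _ h

/-- The bundle of forms on a Hausdorff manifold is Hausdorff. -/
instance FormBundle.t2Space [T2Space P] : T2Space (FormBundle m F p r k) := by
  refine ⟨fun t t' h => ?_⟩
  have hcont : Continuous (FormBundle.pt : FormBundle m F p r k → P) :=
    continuous_iff_continuousAt.2 fun t =>
      ((formCoordinates m F p r k).mdifferentiable_proj t).continuousAt
  by_cases hpt : t.pt = t'.pt
  · obtain ⟨c, hc⟩ := AdaptedChart.exists_mem_source (m := m) (F := F) (p := p) t.pt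
    let e := (c.formLift r k).total
    have ht : t ∈ e.source := hc
    have ht' : t' ∈ e.source := by
      change t'.pt ∈ c.total.source
      rwa [← hpt]
    obtain ⟨u, v, hu, hv, htu, htv, huv⟩ := t2_separation (e.injOn.ne ht ht' h)
    refine ⟨e.source ∩ e ⁻¹' u, e.source ∩ e ⁻¹' v, e.isOpen_inter_preimage hu,
      e.isOpen_inter_preimage hv, ⟨ht, htu⟩, ⟨ht', htv⟩, ?_⟩
    exact (huv.preimage e).mono inter_subset_right inter_subset_right
  · obtain ⟨u, v, hu, hv, htu, htv, huv⟩ := t2_separation hpt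
    exact ⟨_, _, hu.preimage hcont, hv.preimage hcont, htu, htv, huv.preimage _⟩

end FormBundles

theorem insertion_apply {V : Type*} [AddCommGroup V] [Module ℝ V] [TopologicalSpace V] {k : ℕ}
    (A : V →L[ℝ] V) (α : V [⋀^Fin k]→L[ℝ] ℝ) (v : Fin k → V) :
    insertion A α v = ∑ i, α (Function.update v i (A (v i))) := rfl

section HorizontalForms

variable {V W : Type*} [AddCommGroup V] [Module ℝ V] [TopologicalSpace V]
    [AddCommGroup W] [Module ℝ W] [TopologicalSpace W] {L : V →L[ℝ] W} {k : ℕ}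

/-- A `2`-horizontal form which vanishes whenever all arguments but the first lie in a horizontal
complement is zero. -/
theorem horizontalForms.eq_zero_of_section {β : V [⋀^Fin (k + 1)]→L[ℝ] ℝ}
    (hβ : β ∈ horizontalForms L 2 (k + 1)) (s : W →L[ℝ] V) (hs : ∀ w, L (s w) = w)
    (h : ∀ (X : V) (w : Fin k → W), β (Fin.cons X fun i => s (w i)) = 0) : β = 0 := by
  ext v
  have hv : v = (fun i => v i - s (L (v i))) + fun i => s (L (v i)) := by
    funext i
    simp
  have hvert : ∀ i, L (v i - s (L (v i))) = 0 := fun i => by rw [map_sub, hs, sub_self]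
  change β.toMultilinearMap v = 0
  rw [hv, MultilinearMap.map_add_univ]
  refine Finset.sum_eq_zero fun S _ => ?_
  change β _ = 0
  rcases lt_or_ge S.card 2 with hS | hS
  · obtain ⟨i₀, hi₀⟩ : ∃ i₀ : Fin (k + 1), ∀ i ∈ S, i = i₀ := by
      rcases S.eq_empty_or_nonempty with rfl | ⟨a, ha⟩
      · exact ⟨0, by simp⟩
      · exact ⟨a, fun i hi => Finset.card_le_one.1 (by omega) i hi a ha⟩
    have hne : ∀ i, i ≠ i₀ → i ∉ S := fun i hi hiS => hi (hi₀ i hiS)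
    set u := S.piecewise (fun i => v i - s (L (v i))) (fun i => s (L (v i))) with hu
    have h1 : u ∘ Equiv.swap 0 i₀ = Fin.cons (u i₀) fun i : Fin k =>
        s (L (v (Equiv.swap 0 i₀ i.succ))) := by
      funext i
      refine Fin.cases ?_ (fun i => ?_) i
      · simp
      · simp only [Function.comp_apply, Fin.cons_succ]
        refine Finset.piecewise_eq_of_notMem _ _ _ (hne _ fun h' => ?_)
        rw [Equiv.swap_apply_eq_iff, Equiv.swap_apply_right] at h'
        exact Fin.succ_ne_zero i h'
    have h2 : β (u ∘ Equiv.swap 0 i₀) = 0 := by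
      rw [h1]
      exact h _ _
    rcases eq_or_ne 0 i₀ with h0 | h0
    · simpa [← h0] using h2
    · have h3 : β (u ∘ Equiv.swap 0 i₀) = -β u := β.toAlternatingMap.map_swap u h0
      rwa [h3, neg_eq_zero] at h2
  · obtain ⟨t, ht, htc⟩ := Finset.exists_subset_card_eq hS
    exact hβ _ ⟨t, htc, fun i hi => by rw [Finset.piecewise_eq_of_mem _ _ _ (ht hi)]; exact hvert i⟩

theorem ContinuousAlternatingMap.apply_eq_zero_of_finrank_lt [Module.Finite ℝ W]
    (β : V [⋀^Fin k]→L[ℝ] ℝ) (s : W →L[ℝ] V) (hk : Module.finrank ℝ W < k) (w : Fin k → W) :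
    β (fun i => s (w i)) = 0 := by
  refine (β.toAlternatingMap.compLinearMap s.toLinearMap).map_linearDependent w fun hli => ?_
  have := hli.fintype_card_le_finrank
  simp at this
  omega

/-- A `2`-horizontal `(k + 1)`-form over a `k`-dimensional space with basis `b` is determined by
its values with a vertical first argument and the basis vectors in the other places. -/
theorem horizontalForms.eq_zero_of_basis {β : V [⋀^Fin (k + 1)]→L[ℝ] ℝ}
    (hβ : β ∈ horizontalForms L 2 (k + 1)) (s : W →L[ℝ] V) (hs : ∀ w, L (s w) = w)
    (b : Module.Basis (Fin k) ℝ W)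
    (h : ∀ X : V, L X = 0 → β (Fin.cons X fun i => s (b i)) = 0) : β = 0 := by
  refine horizontalForms.eq_zero_of_section hβ s hs fun X w => ?_
  have hX : X = (X - s (L X)) + s (L X) := by simp
  have hadd : β (Fin.cons X fun i => s (w i)) = β (Fin.cons (X - s (L X)) fun i => s (w i)) +
      β (Fin.cons (s (L X)) fun i => s (w i)) := by
    conv_lhs => rw [hX]
    exact β.toMultilinearMap.cons_add _ _ _
  have hfin : Module.finrank ℝ W = k := by simp [Module.finrank_eq_card_basis b]
  have := Module.Finite.of_basis b
  have h2 : β (Fin.cons (s (L X)) fun i => s (w i)) = 0 := by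
    have := β.apply_eq_zero_of_finrank_lt s (by omega) (Fin.cons (L X) w)
    rw [← this]
    congr 1
    funext i
    refine Fin.cases rfl (fun i => rfl) i
  rw [hadd, h2, add_zero]
  have h3 : (β.toAlternatingMap.curryLeft (X - s (L X))).compLinearMap s.toLinearMap = 0 := by
    refine Module.Basis.ext_alternating b fun v hv => ?_
    let σ := Equiv.ofBijective v (Finite.injective_iff_bijective.1 hv)
    have h4 := ((β.toAlternatingMap.curryLeft (X - s (L X))).compLinearMap
      s.toLinearMap).map_perm b σ
    have h5 : ((β.toAlternatingMap.curryLeft (X - s (L X))).compLinearMap s.toLinearMap) b = 0 :=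
      h _ (by rw [map_sub, hs, sub_self])
    rw [h5, smul_zero] at h4
    exact h4
  exact congrArg (fun α => α w) h3

/-- On a tuple whose entries but the first are horizontal, `i_h α - (k - 1) α` agrees with `α`. -/
theorem insertion_sub_apply_cons [Module.Finite ℝ W] (hk : Module.finrank ℝ W = k)
    (α : V [⋀^Fin (k + 1)]→L[ℝ] ℝ) (s : W →L[ℝ] V) (hs : ∀ w, L (s w) = w) (X : V)
    (w : Fin k → W) [IsTopologicalAddGroup V] [ContinuousConstSMul ℝ V] :
    (insertion (s.comp L) α - ((k : ℝ) - 1) • α) (Fin.cons X fun i => s (w i)) =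
      α (Fin.cons X fun i => s (w i)) := by
  have h1 : insertion (s.comp L) α (Fin.cons X fun i => s (w i)) =
      k * α (Fin.cons X fun i => s (w i)) := by
    rw [insertion_apply, Fin.sum_univ_succ]
    have h2 : ∀ i : Fin k, α (Function.update (Fin.cons X fun i => s (w i) : Fin (k + 1) → V) i.succ
        ((s.comp L) ((Fin.cons X fun i => s (w i) : Fin (k + 1) → V) i.succ))) =
          α (Fin.cons X fun i => s (w i)) := by
      intro i
      congr 1
      simp only [Fin.cons_succ, ContinuousLinearMap.comp_apply, hs]
      rw [← Fin.cons_update, Function.update_eq_self]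
    simp only [h2]
    rw [Finset.sum_const, Fin.update_cons_zero]
    have h3 := α.apply_eq_zero_of_finrank_lt s (by omega) (Fin.cons (L X) w)
    have h4 : (Fin.cons ((s.comp L) ((Fin.cons X fun i => s (w i) : Fin (k + 1) → V) 0))
        fun i => s (w i) : Fin (k + 1) → V) = fun i => s ((Fin.cons (L X) w : Fin (k + 1) → W) i) := by
      funext i
      refine Fin.cases rfl (fun i => rfl) i
    rw [h4, h3, zero_add]
    simp
  rw [ContinuousAlternatingMap.sub_apply, ContinuousAlternatingMap.smul_apply, h1, smul_eq_mul]
  ring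

end HorizontalForms

section Insertion

variable {V V' : Type*} [NormedAddCommGroup V] [NormedSpace ℝ V] [NormedAddCommGroup V']
  [NormedSpace ℝ V'] {k : ℕ}

/-- `insertion A α` as a linear function of `A`. -/
def insertionₗ (α : V [⋀^Fin k]→L[ℝ] ℝ) : (V →L[ℝ] V) →ₗ[ℝ] V [⋀^Fin k]→L[ℝ] ℝ where
  toFun A := insertion A α
  map_add' A B := by
    ext v
    change ∑ i : Fin k, α _ = ∑ i : Fin k, α _ + ∑ i : Fin k, α _
    rw [← Finset.sum_add_distrib]
    exact Finset.sum_congr rfl fun i _ => α.map_update_add _ _ _ _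
  map_smul' c A := by
    ext v
    change ∑ i : Fin k, α _ = c • ∑ i : Fin k, α _
    rw [Finset.smul_sum]
    exact Finset.sum_congr rfl fun i _ => α.map_update_smul _ _ _ _

theorem insertion_compContinuousLinearMap (α : V [⋀^Fin k]→L[ℝ] ℝ) {A : V →L[ℝ] V}
    {A' : V' →L[ℝ] V'} {N : V' →L[ℝ] V} (h : ∀ v, A (N v) = N (A' v)) :
    (insertion A α).compContinuousLinearMap N = insertion A' (α.compContinuousLinearMap N) := by
  ext v
  change ∑ i : Fin k, α _ = ∑ i : Fin k, α _
  refine Finset.sum_congr rfl fun i _ => ?_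
  congr 1
  funext j
  by_cases hj : j = i
  · subst hj
    simp [h]
  · simp [hj]

end Insertion

theorem HForms.ext {m : ℕ} {F : Type*} [NormedAddCommGroup F] [NormedSpace ℝ F] {P M : Type*}
    [TopologicalSpace M] [ChartedSpace (Base m) M]
    [TopologicalSpace P] [ChartedSpace (Base m × F) P] {p : P → M} {r k : ℕ} {e : P}
    {a b : HForms m F p r k e} (h : a.val = b.val) : a = b :=
  Subtype.ext h

theorem ModelForms.ext {m : ℕ} {F : Type*} [NormedAddCommGroup F] [NormedSpace ℝ F] {r k : ℕ}
    {a b : ModelForms m F r k} (h : a.val = b.val) : a = b :=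
  Subtype.ext h

section Critical

variable {m : ℕ} {F : Type*} [NormedAddCommGroup F] [NormedSpace ℝ F] [FiniteDimensional ℝ F]
  {P M : Type*} [TopologicalSpace M] [ChartedSpace (Base m) M]
  [TopologicalSpace P] [ChartedSpace (Base m × F) P] [IsManifold 𝓘(ℝ, Base m × F) ∞ P]
  {p : P → M} [hp : IsFibration m F p]

theorem HamiltonianSection.flat_eq_negD_iff_form (h : HamiltonianSection m F p)
    (z : MultimomentaJet m F p) :
    flat z = h.negD z.pt ↔ (flat z).form.val = -h.densityForm.d z.pt := by
  constructor
  · intro hz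
    have key : ∀ t t' : MultimomentaForms m F p, t = t' → ∀ hpt : t.pt = t'.pt,
        t.form.val = hpt ▸ t'.form.val := by
      rintro t _ rfl _
      rfl
    exact key _ _ hz rfl
  · intro hz
    have : (flat z).form = (h.negD z.pt).form := HForms.ext hz
    change FormBundle.mk z.pt (flat z).form = FormBundle.mk z.pt (h.negD z.pt).form
    rw [this]

/-- `♭_Ω(z) = -d𝓗` if and only if `i_X (Ω + d𝓗)` vanishes on the horizontal space of `z` for all
tangent vectors `X`. -/
theorem HamiltonianSection.flat_eq_negD_iff (h : HamiltonianSection m F p)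
    (z : MultimomentaJet m F p) :
    flat z = h.negD z.pt ↔
      ∀ (X : TangentSpace 𝓘(ℝ, Base m × MultimomentaFibre m F) z.pt)
        (w : Fin m → TangentSpace 𝓘(ℝ, Base m) (Multimomenta.proj z.pt)),
        (canonicalForm m F p 2 m + h.densityForm.d) z.pt (Fin.cons X fun i => z.jet (w i)) = 0 := by
  rw [h.flat_eq_negD_iff_form]
  have : Module.Finite ℝ (TangentSpace 𝓘(ℝ, Base m) (Multimomenta.proj z.pt)) :=
    inferInstanceAs (Module.Finite ℝ (Base m))
  have hfin : Module.finrank ℝ (TangentSpace 𝓘(ℝ, Base m) (Multimomenta.proj z.pt)) = m :=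
    (finrank_euclideanSpace_fin : Module.finrank ℝ (Base m) = m)
  have h1 : ∀ (X : TangentSpace 𝓘(ℝ, Base m × MultimomentaFibre m F) z.pt)
      (w : Fin m → TangentSpace 𝓘(ℝ, Base m) (Multimomenta.proj z.pt)),
      (flat z).form.val (Fin.cons X fun i => z.jet (w i)) =
        canonicalForm m F p 2 m z.pt (Fin.cons X fun i => z.jet (w i)) := fun X w =>
    insertion_sub_apply_cons hfin (canonicalForm m F p 2 m z.pt) z.jet
      (L := mfderiv 𝓘(ℝ, Base m × MultimomentaFibre m F) 𝓘(ℝ, Base m) Multimomenta.proj z.pt)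
      z.isSection X w
  constructor
  · intro hz X w
    have h2 := h1 X w
    rw [hz] at h2
    change canonicalForm m F p 2 m z.pt _ + h.densityForm.d z.pt _ = 0
    rw [← h2]
    exact neg_add_cancel _
  · intro hz
    refine sub_eq_zero.1 (horizontalForms.eq_zero_of_section (k := m)
      (Submodule.sub_mem _ (flat z).form.2 (h.negD z.pt).form.2) z.jet z.isSection
      fun X w => ?_)
    have h2 := hz X w
    have h3 : ∀ a b c : ℝ, a = b → b + c = 0 → a - -c = 0 := by
      rintro a _ c rfl hc
      rwa [sub_neg_eq_add]
    exact h3 _ _ _ (h1 X w) h2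

/-- The Hamilton-De Donder-Weyl equation. -/
theorem HamiltonianSection.isCriticalPoint_iff [T2Space P] (h : HamiltonianSection m F p)
    (τ : LocalSection m (ReducedMultimomentaFibre m F)
      (ReducedMultimomenta.proj : ReducedMultimomenta m F p → M)) :
    h.IsCriticalPoint τ ↔ ∀ (x : M) (hx : x ∈ τ.dom),
      flat ((h.comp τ).jet x hx) = h.negD ((h.comp τ).toFun x) := by
  constructor
  · intro hτ x hx
    refine (h.flat_eq_negD_iff ((h.comp τ).jet x hx)).2 fun X w => ?_
    obtain ⟨Y, hY, hYX⟩ := exists_vectorField_eq ((h.comp τ).toFun x) X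
    have h1 := hτ Y hY x hx
    have h2 := congrArg (fun α : Base m [⋀^Fin m]→L[ℝ] ℝ => α w) h1
    rw [← hYX]
    exact h2
  · intro hτ Y _ x hx
    have h1 := (h.flat_eq_negD_iff ((h.comp τ).jet x hx)).1 (hτ x hx) (Y _)
    exact ContinuousAlternatingMap.ext fun w => h1 w

end Critical

section Jets

variable {m : ℕ} {F : Type*} [NormedAddCommGroup F] [NormedSpace ℝ F]
  {P M : Type*} [TopologicalSpace M] [ChartedSpace (Base m) M]
  [TopologicalSpace P] [ChartedSpace (Base m × F) P]
  {p : P → M} [hp : IsFibration m F p]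

/-- The horizontal projector `(x, w) ↦ (x, g x)` on `ℝ^m × F`. -/
def modelProjector (g : Base m →L[ℝ] F) : Base m × F →L[ℝ] Base m × F :=
  ((ContinuousLinearMap.id ℝ (Base m)).prod g).comp (ContinuousLinearMap.fst ℝ (Base m) F)

theorem AdaptedChart.tangentCoord_projector (c : AdaptedChart m F p) (z : JetBundle m F p)
    (hz : z.pt ∈ c.total.source) (v : TangentSpace 𝓘(ℝ, Base m × F) z.pt) :
    c.tangentCoord z.pt (z.projector v) =
      modelProjector (c.jetCoord z) (c.tangentCoord z.pt v) := by
  have h1 : (c.tangentCoord z.pt v).1 =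
      c.baseCoord (p z.pt) (mfderiv 𝓘(ℝ, Base m × F) 𝓘(ℝ, Base m) p z.pt v) :=
    c.tangentCoord_fst hz v
  refine Prod.ext ?_ ?_
  · change (c.tangentCoord z.pt (z.jet _)).1 = (c.tangentCoord z.pt v).1
    rw [c.tangentCoord_fst hz, z.isSection, h1]
    rfl
  · change _ = (c.tangentCoord z.pt (z.jet (c.basePoint (p z.pt) (c.tangentCoord z.pt v).1))).2
    rw [h1, c.basePoint_coord (c.map_source _ hz)]
    rfl

theorem AdaptedChart.projector_tangentPoint (c : AdaptedChart m F p) (z : JetBundle m F p)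
    (hz : z.pt ∈ c.total.source) (w : Base m × F) :
    z.projector (c.tangentPoint z.pt w) =
      c.tangentPoint z.pt (modelProjector (c.jetCoord z) w) := by
  have h := c.tangentCoord_projector z hz (c.tangentPoint z.pt w)
  rw [c.tangentCoord_point hz] at h
  rw [← h, c.tangentPoint_coord hz]

end Jets

section FlatModel

variable {m : ℕ} {F : Type*} [NormedAddCommGroup F] [NormedSpace ℝ F] [FiniteDimensional ℝ F]

variable (m F) in
/-- The linear part of `♭_Ω` in coordinates. -/
def flatLinearForm : (Base m →L[ℝ] MultimomentaFibre m F) →ₗ[ℝ]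
    (Base m × MultimomentaFibre m F) [⋀^Fin (m + 1)]→L[ℝ] ℝ where
  toFun g := insertionₗ (modelCanonical m F 2 m)
    ((ContinuousLinearMap.inr ℝ (Base m) (MultimomentaFibre m F)).comp
      (g.comp (ContinuousLinearMap.fst ℝ (Base m) (MultimomentaFibre m F))))
  map_add' g g' := by
    rw [← map_add]
    congr 1
    ext v <;> simp
  map_smul' c g := by
    rw [RingHom.id_apply, ← map_smul]
    congr 1
    ext v <;> simp

/-- The morphism `♭_Ω` in coordinates. -/
def flatModel (g : Base m →L[ℝ] MultimomentaFibre m F) :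
    ModelForms m (MultimomentaFibre m F) 2 (m + 1) :=
  ModelForms.mk (insertion (modelProjector g) (modelCanonical m F 2 m) -
      ((m : ℝ) - 1) • modelCanonical m F 2 m)
    (insertion_sub_mem_horizontalForms modelCanonical_mem (fun _ => rfl) fun v hv => by
      change modelProjector g v = 0
      have hv' : v.1 = 0 := hv
      simp [modelProjector, hv'])

theorem flatModel_val_eq (g : Base m →L[ℝ] MultimomentaFibre m F) :
    (flatModel g).val = (flatModel (0 : Base m →L[ℝ] MultimomentaFibre m F)).val +
      flatLinearForm m F g := by
  have h : modelProjector g = modelProjector (0 : Base m →L[ℝ] MultimomentaFibre m F) +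
      (ContinuousLinearMap.inr ℝ (Base m) (MultimomentaFibre m F)).comp
        (g.comp (ContinuousLinearMap.fst ℝ (Base m) (MultimomentaFibre m F))) := by
    ext v <;> simp [modelProjector]
  change insertionₗ _ (modelProjector g) - _ = insertionₗ _ (modelProjector 0) - _ + insertionₗ _ _
  rw [h, map_add]
  abel

theorem flatLinearForm_mem (g : Base m →L[ℝ] MultimomentaFibre m F) :
    flatLinearForm m F g ∈
      horizontalForms (ContinuousLinearMap.fst ℝ (Base m) (MultimomentaFibre m F)) 2 (m + 1) := by
  rw [← sub_eq_of_eq_add' (flatModel_val_eq g)]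
  exact Submodule.sub_mem _ (flatModel g).2 (flatModel 0).2

variable (m F) in
/-- The linear part of `♭_Ω` in coordinates, with values in the `2`-horizontal forms. -/
def flatLinear : (Base m →L[ℝ] MultimomentaFibre m F) →L[ℝ]
    ModelForms m (MultimomentaFibre m F) 2 (m + 1) :=
  LinearMap.toContinuousLinearMap (ModelForms.lift (flatLinearForm m F) flatLinearForm_mem)

theorem flatModel_eq (g : Base m →L[ℝ] MultimomentaFibre m F) :
    flatModel g = flatModel 0 + flatLinear m F g :=
  ModelForms.ext (flatModel_val_eq g)

end FlatModel

section Flat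

variable {m : ℕ} {F : Type*} [NormedAddCommGroup F] [NormedSpace ℝ F] [FiniteDimensional ℝ F]
  {P M : Type*} [TopologicalSpace M] [ChartedSpace (Base m) M]
  [TopologicalSpace P] [ChartedSpace (Base m × F) P] [IsManifold 𝓘(ℝ, Base m × F) ∞ P]
  {p : P → M} [hp : IsFibration m F p]

/-- The morphism `♭_Ω` in a chart. -/
theorem AdaptedChart.pushForm_flat (c : AdaptedChart m F p) (z : MultimomentaJet m F p)
    (hz : z.pt.pt ∈ c.total.source) :
    (c.formLift 2 m).pushForm 2 (m + 1) z.pt (flat z).form =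
      flatModel ((c.formLift 2 m).jetCoord z) := by
  have hz' : z.pt ∈ (c.formLift 2 m).total.source := hz
  apply ModelForms.ext
  refine (AdaptedChart.coe_pushForm (c := c.formLift 2 m) hz' (flat z).form).trans ?_
  have h1 : (canonicalForm m F p 2 m z.pt).compContinuousLinearMap
      ((c.formLift 2 m).tangentPoint z.pt) = modelCanonical m F 2 m := by
    rw [c.canonicalForm_eq z.pt hz]
    ext v
    change modelCanonical m F 2 m _ = _
    congr 1
    funext i
    exact (c.formLift 2 m).tangentCoord_point hz' (v i)
  have h2 := insertion_compContinuousLinearMap (V := Base m × MultimomentaFibre m F)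
    (canonicalForm m F p 2 m z.pt)
    (A := z.projector) (N := (c.formLift 2 m).tangentPoint z.pt)
    ((c.formLift 2 m).projector_tangentPoint z hz')
  ext v
  have h3 := congrArg (fun α => α v) (h2.trans (congrArg (insertion _) h1))
  have h4 := congrArg (fun α => α v) h1
  change insertion z.projector (canonicalForm m F p 2 m z.pt) _ -
    ((m : ℝ) - 1) * canonicalForm m F p 2 m z.pt _ =
      insertion (modelProjector _) (modelCanonical m F 2 m) v -
        ((m : ℝ) - 1) * modelCanonical m F 2 m v
  exact congrArg₂ (· - ·) h3 (congrArg (((m : ℝ) - 1) * ·) h4)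

/-- The chart of `J¹(p ∘ ν)` induced by a fibred chart of `P`. -/
abbrev AdaptedChart.jetLift (c : AdaptedChart m F p) :
    AdaptedChart m (MultimomentaFibre m F × (Base m →L[ℝ] MultimomentaFibre m F))
      ((Multimomenta.proj : Multimomenta m F p → M) ∘
        (JetBundle.pt : MultimomentaJet m F p → Multimomenta m F p)) :=
  (jetCoordinates m (MultimomentaFibre m F)
    (Multimomenta.proj : Multimomenta m F p → M)).lift (c.formLift 2 m)

/-- The linear part of the map `♭_Ω` between the charts. -/
def flatChartLinear (m : ℕ) (F : Type*) [NormedAddCommGroup F] [NormedSpace ℝ F]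
    [FiniteDimensional ℝ F] :
    Base m × (MultimomentaFibre m F × (Base m →L[ℝ] MultimomentaFibre m F)) →L[ℝ]
      Base m × (MultimomentaFibre m F × ModelForms m (MultimomentaFibre m F) 2 (m + 1)) :=
  (ContinuousLinearMap.id ℝ (Base m)).prodMap
    ((ContinuousLinearMap.id ℝ (MultimomentaFibre m F)).prodMap (flatLinear m F))

theorem AdaptedChart.hasMFDerivAt_flat (c : AdaptedChart m F p) (z : MultimomentaJet m F p)
    (hz : z.pt.pt ∈ c.total.source) :
    HasMFDerivAt
      𝓘(ℝ, Base m × (MultimomentaFibre m F × (Base m →L[ℝ] MultimomentaFibre m F)))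
      𝓘(ℝ, Base m × (MultimomentaFibre m F × ModelForms m (MultimomentaFibre m F) 2 (m + 1)))
      (flat : MultimomentaJet m F p → MultimomentaForms m F p) z
      ((((c.formLift 2 m).formLift 2 (m + 1)).tangentPoint (flat z)).comp
        ((flatChartLinear m F).comp (c.jetLift.tangentCoord z))) := by
  let Ψ : Base m × (MultimomentaFibre m F × (Base m →L[ℝ] MultimomentaFibre m F)) →
      Base m × (MultimomentaFibre m F × ModelForms m (MultimomentaFibre m F) 2 (m + 1)) :=
    fun y => (y.1, (y.2.1, flatModel y.2.2))
  have hΨ : ∀ y, HasFDerivAt Ψ (flatChartLinear m F) y := by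
    intro y
    have h1 : Ψ = fun y => flatChartLinear m F y + (0, (0, flatModel 0)) := by
      funext y
      refine Prod.ext (by simp [Ψ, flatChartLinear]) (Prod.ext (by simp [Ψ, flatChartLinear]) ?_)
      change flatModel y.2.2 = flatLinear m F y.2.2 + flatModel 0
      exact (flatModel_eq _).trans (add_comm _ _)
    rw [h1]
    exact (flatChartLinear m F).hasFDerivAt.add_const _
  let cf := (c.formLift 2 m).formLift 2 (m + 1)
  have hchart : ∀ z : MultimomentaJet m F p, z.pt.pt ∈ c.total.source →
      cf.total (flat z) = Ψ (c.jetLift.total z) := by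
    intro z hz
    refine Prod.ext rfl (Prod.ext rfl ?_)
    exact c.pushForm_flat z hz
  have hzj : z ∈ c.jetLift.total.source := hz
  have hzf : flat z ∈ cf.total.source := hz
  have h1 := HasMFDerivAt.comp z (hΨ (c.jetLift.total z)).hasMFDerivAt
    (c.jetLift.mdifferentiable_total.mdifferentiableAt hzj).hasMFDerivAt
  have h2 : HasMFDerivAt
      𝓘(ℝ, Base m × (MultimomentaFibre m F × ModelForms m (MultimomentaFibre m F) 2 (m + 1)))
      𝓘(ℝ, Base m × (MultimomentaFibre m F × ModelForms m (MultimomentaFibre m F) 2 (m + 1)))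
      cf.total.symm (Ψ (c.jetLift.total z)) (cf.tangentPoint (flat z)) := by
    rw [← hchart z hz]
    exact (cf.mdifferentiable_total.mdifferentiableAt_symm
      (cf.total.map_source hzf)).hasMFDerivAt
  have h3 := HasMFDerivAt.comp z h2 h1
  refine h3.congr_of_eventuallyEq ?_
  filter_upwards [c.jetLift.total.open_source.mem_nhds hzj] with z' hz'
  change flat z' = cf.total.symm (Ψ (c.jetLift.total z'))
  rw [← hchart z' hz']
  exact (cf.total.left_inv (show flat z' ∈ cf.total.source from hz')).symm

/-- The form `Ω̃` in a chart. -/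
theorem AdaptedChart.jetForm_apply (c : AdaptedChart m F p) (z : MultimomentaJet m F p)
    (hz : z.pt.pt ∈ c.total.source)
    (v : Fin (m + 2) → TangentSpace
      𝓘(ℝ, Base m × (MultimomentaFibre m F × (Base m →L[ℝ] MultimomentaFibre m F))) z) :
    jetForm m F p z v = -∑ i : Fin (m + 2), (-1 : ℝ) ^ (i : ℕ) *
      flatLinearForm m F (c.jetLift.tangentCoord z (v i)).2.2
        (i.removeNth fun j => dropFibre m (MultimomentaFibre m F) _
          (c.jetLift.tangentCoord z (v j))) := by
  have hzf : flat z ∈ ((c.formLift 2 m).formLift 2 (m + 1)).total.source := hz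
  have h1 := (c.hasMFDerivAt_flat z hz).mfderiv
  change canonicalForm m (MultimomentaFibre m F) (Multimomenta.proj : Multimomenta m F p → M) 2
    (m + 1) (flat z) (fun i => mfderiv _ _ flat z (v i)) = _
  rw [(c.formLift 2 m).canonicalForm_eq (flat z) hz, h1]
  change modelCanonical m (MultimomentaFibre m F) 2 (m + 1) (fun i =>
    ((c.formLift 2 m).formLift 2 (m + 1)).tangentCoord (flat z)
      (((c.formLift 2 m).formLift 2 (m + 1)).tangentPoint (flat z)
        (flatChartLinear m F (c.jetLift.tangentCoord z (v i))))) = _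
  simp only [((c.formLift 2 m).formLift 2 (m + 1)).tangentCoord_point hzf]
  rw [modelCanonical_apply]
  rfl

end Flat

section Density

variable {m : ℕ} {F : Type*} [NormedAddCommGroup F] [NormedSpace ℝ F] [FiniteDimensional ℝ F]
  {P M : Type*} [TopologicalSpace M] [ChartedSpace (Base m) M]
  [TopologicalSpace P] [ChartedSpace (Base m × F) P] [IsManifold 𝓘(ℝ, Base m × F) ∞ P]
  {p : P → M} [hp : IsFibration m F p]

/-- The chart of `𝓜°p` induced by a fibred chart of `P`. -/
abbrev AdaptedChart.reducedLift (c : AdaptedChart m F p) :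
    AdaptedChart m (ReducedMultimomentaFibre m F)
      (p ∘ (ReducedFormBundle.pt : ReducedMultimomenta m F p → P)) :=
  (reducedCoordinates m F p m).lift c

namespace HamiltonianSection

variable (h : HamiltonianSection m F p) (c : AdaptedChart m F p)

/-- The Hamiltonian section in coordinates. -/
def inCoordinates (w : (Base m × F) × (ModelForms m F 2 m ⧸ ModelSemibasic m F m)) :
    ModelForms m F 2 m :=
  c.pushForm 2 m _ (h.form ((reducedCoordinates m F p m).point c w.1 w.2))

theorem contDiffOn_inCoordinates :
    ContDiffOn ℝ ∞ (h.inCoordinates c) (Prod.fst ⁻¹' c.total.target) := by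
  have h1 := contMDiffOn_of_mem_maximalAtlas (c.formLift 2 m).total_mem
  have h2 := contMDiffOn_symm_of_mem_maximalAtlas c.reducedLift.total_mem
  have h3 := h1.comp (h.smooth.comp_contMDiffOn h2) (by
    intro w hw
    exact c.total.map_target hw)
  rw [contMDiffOn_iff_contDiffOn] at h3
  have h4 : ContDiff ℝ ∞
      (fun w : (Base m × F) × (ModelForms m F 2 m ⧸ ModelSemibasic m F m) =>
        (w.1.1, (w.1.2, w.2))) := by fun_prop
  exact (h3.comp h4.contDiffOn fun w hw => hw).snd.snd

/-- The Hamiltonian density in coordinates. -/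
def densityModel (y : Base m × MultimomentaFibre m F) :
    (Base m × MultimomentaFibre m F) [⋀^Fin m]→L[ℝ] ℝ :=
  modelTautological m F 2 m (y.1, (y.2.1, y.2.2 -
    h.inCoordinates c ((y.1, y.2.1), Submodule.Quotient.mk y.2.2)))

theorem inLocalChart_densityForm {y : Base m × MultimomentaFibre m F}
    (hy : y ∈ (c.formLift 2 m).total.target) :
    h.densityForm.inLocalChart (c.formLift 2 m).total y = h.densityModel c y := by
  refine (c.inLocalChart_pullback h.density hy).trans ?_
  have hy' : (y.1, y.2.1) ∈ c.total.target := hy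
  rw [densityModel, modelTautological_apply]
  refine congrArg (fun a : ModelForms m F 2 m =>
      a.val.compContinuousLinearMap (dropFibre m F (ModelForms m F 2 m))) ?_
  refine (map_sub (c.pushForm 2 m (c.total.symm (y.1, y.2.1))) _ _).trans ?_
  refine congrArg₂ (· - ·) (AdaptedChart.push_pull (c.total.map_target hy') y.2.2) rfl

theorem contDiffOn_densityModel :
    ContDiffOn ℝ ∞ (h.densityModel c) (c.formLift 2 m).total.target := by
  refine (modelTautological m F 2 m).contDiff.comp_contDiffOn ?_
  have h1 : ContDiff ℝ ∞ (ModelSemibasic m F m).mkQ.toContinuousLinearMap :=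
    (ModelSemibasic m F m).mkQ.toContinuousLinearMap.contDiff
  have h2 : ContDiff ℝ ∞ (fun y : Base m × MultimomentaFibre m F =>
      ((y.1, y.2.1), (ModelSemibasic m F m).mkQ.toContinuousLinearMap y.2.2)) := by
    fun_prop
  have h3 := (h.contDiffOn_inCoordinates c).comp h2.contDiffOn
    (s := (c.formLift 2 m).total.target) fun y hy => hy
  have h4 : ContDiffOn ℝ ∞ (fun y : Base m × MultimomentaFibre m F => y.2.2)
      (c.formLift 2 m).total.target := contDiff_snd.snd.contDiffOn
  exact contDiff_fst.contDiffOn.prodMk (contDiff_snd.fst.contDiffOn.prodMk (h4.sub h3))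

theorem densityModel_mem {y : Base m × MultimomentaFibre m F}
    (hy : y ∈ (c.formLift 2 m).total.target) :
    h.densityModel c y ∈
      horizontalForms (ContinuousLinearMap.fst ℝ (Base m) (MultimomentaFibre m F)) 1 m := by
  rw [← h.inLocalChart_densityForm c hy]
  refine (congrArg (· ∈ horizontalForms (ContinuousLinearMap.fst ℝ (Base m)
    (MultimomentaFibre m F)) 1 m) (c.inLocalChart_pullback h.density hy)).mpr ?_
  refine horizontalForms.comp_mem (L := ContinuousLinearMap.fst ℝ (Base m) F) ?_ _
    fun v hv => hv
  exact c.semibasic_le_push m _ (h.density_mem _)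

theorem d_densityForm (z : Multimomenta m F p) (hz : z.pt ∈ c.total.source) :
    h.densityForm.d z = (extDeriv (h.densityModel c)
      ((c.formLift 2 m).total z)).compContinuousLinearMap ((c.formLift 2 m).tangentCoord z) := by
  have hz' : z ∈ (c.formLift 2 m).total.source := hz
  have hnhds := (c.formLift 2 m).total.open_target.mem_nhds
    ((c.formLift 2 m).total.map_source hz')
  have h1 : h.densityForm.inLocalChart (c.formLift 2 m).total
      =ᶠ[𝓝 ((c.formLift 2 m).total z)] h.densityModel c := by
    filter_upwards [hnhds] with y hy
    exact h.inLocalChart_densityForm c hy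
  have h2 := h.densityForm.d_eq (c.formLift 2 m).total_mem hz'
    ((((h.contDiffOn_densityModel c).contDiffAt hnhds).differentiableAt
      (by simp)).congr_of_eventuallyEq h1)
  rw [h2, h1.extDeriv_eq]
  rfl

theorem mem_equationSet (z : MultimomentaJet m F p) :
    z ∈ h.equationSet ↔ flat z = h.negD z.pt := by
  constructor
  · rintro ⟨w, hw⟩
    obtain rfl : w = z.pt := congrArg FormBundle.pt hw
    exact hw.symm
  · intro hz
    exact ⟨_, hz.symm⟩

theorem mem_equationSet_iff (z : MultimomentaJet m F p) (hz : z.pt.pt ∈ c.total.source) :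
    z ∈ h.equationSet ↔ (flatModel ((c.formLift 2 m).jetCoord z)).val +
      extDeriv (h.densityModel c) ((c.formLift 2 m).total z.pt) = 0 := by
  have hz' : z.pt ∈ (c.formLift 2 m).total.source := hz
  rw [h.mem_equationSet, h.flat_eq_negD_iff_form, ← c.pushForm_flat z hz]
  have h1 : ((c.formLift 2 m).pushForm 2 (m + 1) z.pt (flat z).form).val =
      (flat z).form.val.compContinuousLinearMap ((c.formLift 2 m).tangentPoint z.pt) :=
    AdaptedChart.coe_pushForm (c := c.formLift 2 m) hz' (flat z).form
  have h2 := h.d_densityForm c z.pt hz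
  have h3 : ((c.formLift 2 m).pushForm 2 (m + 1) z.pt (flat z).form).val +
      extDeriv (h.densityModel c) ((c.formLift 2 m).total z.pt) = 0 ↔
      ∀ v : Fin (m + 1) → Base m × MultimomentaFibre m F, (flat z).form.val (fun i => (c.formLift 2 m).tangentPoint z.pt (v i)) =
        -h.densityForm.d z.pt (fun i => (c.formLift 2 m).tangentPoint z.pt (v i)) := by
    rw [h1, h2]
    have h4 : ∀ v : Fin (m + 1) → Base m × MultimomentaFibre m F,
        (extDeriv (h.densityModel c) ((c.formLift 2 m).total z.pt)).compContinuousLinearMap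
          ((c.formLift 2 m).tangentCoord z.pt)
            (fun i => (c.formLift 2 m).tangentPoint z.pt (v i)) =
          extDeriv (h.densityModel c) ((c.formLift 2 m).total z.pt) v := by
      intro v
      change extDeriv (h.densityModel c) ((c.formLift 2 m).total z.pt) _ = _
      congr 1
      funext i
      exact (c.formLift 2 m).tangentCoord_point hz' (v i)
    constructor
    · intro h5 v
      rw [h4]
      exact eq_neg_of_add_eq_zero_left (congrArg (fun α => α v) h5)
    · intro h5
      ext v
      have h6 := h5 v
      rw [h4] at h6
      exact (congrArg (· + _) h6).trans (neg_add_cancel _)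
  rw [h3]
  constructor
  · intro h5 v
    exact congrArg (fun α => α (fun i => (c.formLift 2 m).tangentPoint z.pt (v i))) h5
  · intro h5
    refine ContinuousAlternatingMap.ext fun v => ?_
    have h6 := h5 fun i => (c.formLift 2 m).tangentCoord z.pt (v i)
    have h7 : (fun i => (c.formLift 2 m).tangentPoint z.pt
        ((c.formLift 2 m).tangentCoord z.pt (v i))) = v :=
      funext fun i => (c.formLift 2 m).tangentPoint_coord hz' (v i)
    rw [h7] at h6
    exact h6

end HamiltonianSection

end Density

section Algebra

/-- A `2`-horizontal form which vanishes whenever the first argument is vertical and the others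
lie in a horizontal complement is `1`-horizontal. -/
theorem horizontalForms.mem_one_of_section {V W : Type*} [AddCommGroup V] [Module ℝ V]
    [TopologicalSpace V] [AddCommGroup W] [Module ℝ W] [TopologicalSpace W] {L : V →L[ℝ] W}
    {k : ℕ} {β : V [⋀^Fin (k + 1)]→L[ℝ] ℝ}
    (hβ : β ∈ horizontalForms L 2 (k + 1)) (s : W →L[ℝ] V) (hs : ∀ w, L (s w) = w)
    (h : ∀ (X : V) (w : Fin k → W), L X = 0 → β (Fin.cons X fun i => s (w i)) = 0) :
    β ∈ horizontalForms L 1 (k + 1) := by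
  have hbasic : ∀ r, 1 ≤ r → β.compContinuousLinearMap (s.comp L) ∈ horizontalForms L r (k + 1) := by
    rintro r hr v ⟨t, ht, hv⟩
    obtain ⟨i, hi⟩ := Finset.card_pos.1 (by omega : 0 < t.card)
    exact β.map_coord_zero i (by simp [hv i hi])
  have h0 : β - β.compContinuousLinearMap (s.comp L) = 0 := by
    refine horizontalForms.eq_zero_of_section
      (Submodule.sub_mem _ hβ (hbasic 2 (by norm_num))) s hs fun X w => ?_
    have h1 := h (X - s (L X)) w (by rw [map_sub, hs, sub_self])
    have h2 := β.toMultilinearMap.cons_add (fun i => s (w i)) (X - s (L X)) (s (L X))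
    rw [sub_add_cancel] at h2
    have h3 : (fun i => (s.comp L) ((Fin.cons X fun i => s (w i) : Fin (k + 1) → V) i)) =
        Fin.cons (s (L X)) fun i => s (w i) := by
      funext i
      refine Fin.cases rfl (fun i => ?_) i
      simp [hs]
    change β _ - β (fun i => (s.comp L) ((Fin.cons X fun i => s (w i) : Fin (k + 1) → V) i)) = 0
    rw [h3]
    have h4 : β (Fin.cons X fun i => s (w i)) = β (Fin.cons (X - s (L X)) fun i => s (w i)) +
      β (Fin.cons (s (L X)) fun i => s (w i)) := h2
    rw [h4, h1, zero_add, sub_self]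
  rw [sub_eq_zero.1 h0]
  exact hbasic 1 le_rfl

theorem ContinuousAlternatingMap.map_succ_removeNth_cons {V : Type*} [AddCommGroup V] [Module ℝ V]
    [TopologicalSpace V] {m : ℕ} (γ : V [⋀^Fin m]→L[ℝ] ℝ) (k : Fin m) (X : V) (e : Fin m → V) :
    γ (k.succ.removeNth (Fin.cons X e : Fin (m + 1) → V)) =
      (-1 : ℝ) ^ (k : ℕ) * γ (Function.update e k X) := by
  obtain _ | m := m
  · exact k.elim0
  have h1 : k.succ.removeNth (Fin.cons X e : Fin (m + 2) → V) = Fin.cons X (k.removeNth e) := by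
    funext i
    refine Fin.cases ?_ (fun i => ?_) i
    · simp [Fin.removeNth]
    · simp [Fin.removeNth]
  have h2 : Function.update e k X = k.insertNth X (k.removeNth e) := by
    rw [Fin.insertNth_removeNth]
  have h3 := γ.toAlternatingMap.neg_one_pow_smul_map_insertNth k X (k.removeNth e)
  rw [h1, h2]
  have h4 : γ (Fin.cons X (k.removeNth e)) =
      ((-1 : ℤ) ^ (k : ℕ)) • γ (k.insertNth X (k.removeNth e)) := h3.symm
  rw [h4]
  simp

end Algebra

section Momenta

variable {m n : ℕ}

theorem replaceCoord_baseVector (i j : Fin m) (a : Fin n) :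
    replaceCoord i a (baseVector j) = if j = i then 0 else Pi.single j 1 := by
  funext l
  simp only [replaceCoord, ContinuousLinearMap.pi_apply]
  by_cases hl : l = i
  · subst hl
    by_cases hj : j = l
    · simp [hj, baseVector]
    · simp [hj, baseVector, Ne.symm hj]
  · by_cases hj : j = i
    · subst hj
      simp [hl, baseVector]
    · simp [hl, hj, baseVector, Pi.single_apply]

theorem replaceCoord_fibreVector (i : Fin m) (a b : Fin n) :
    replaceCoord i a (fibreVector b) = if a = b then Pi.single i 1 else 0 := by
  funext l
  simp only [replaceCoord, ContinuousLinearMap.pi_apply]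
  by_cases hl : l = i
  · subst hl
    by_cases hab : a = b <;> simp [hab, fibreVector]
  · by_cases hab : a = b <;> simp [hl, hab, fibreVector]

theorem momentumCoord_momentumForm (i j : Fin m) (a b : Fin n) :
    momentumCoord (momentumForm i a) j b = if i = j ∧ a = b then 1 else 0 := by
  change detForm m (fun l => replaceCoord i a (Function.update baseVector j (fibreVector b) l)) = _
  by_cases hij : i = j
  · subst hij
    by_cases hab : a = b
    · subst hab
      have : (fun l => replaceCoord i a (Function.update baseVector i (fibreVector a) l)) =
          (1 : Matrix (Fin m) (Fin m) ℝ) := by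
        funext l
        by_cases hl : l = i
        · subst hl
          rw [Function.update_self, replaceCoord_fibreVector, if_pos rfl]
          funext k
          simp [Matrix.one_apply, Pi.single_apply, eq_comm]
        · rw [Function.update_of_ne hl, replaceCoord_baseVector, if_neg hl]
          funext k
          simp [Matrix.one_apply, Pi.single_apply, eq_comm]
      rw [this]
      simp only [and_self, if_true]
      exact Matrix.det_one
    · rw [if_neg (fun h => hab h.2)]
      refine (detForm m).map_coord_zero i ?_
      rw [Function.update_self, replaceCoord_fibreVector, if_neg hab]
  · rw [if_neg (fun h => hij h.1)]
    refine (detForm m).map_coord_zero i ?_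
    rw [Function.update_of_ne hij, replaceCoord_baseVector, if_pos rfl]

theorem fibre_eq_sum (u : Fibre n) :
    ((0, u) : Base m × Fibre n) = ∑ a, u a • fibreVector a := by
  refine Prod.ext ?_ ?_
  · simp [fibreVector, Prod.fst_sum]
  · rw [Prod.snd_sum]
    have := (EuclideanSpace.basisFun (Fin n) ℝ).sum_repr u
    simp only [EuclideanSpace.basisFun_repr, EuclideanSpace.basisFun_apply] at this
    simpa [fibreVector] using this.symm

theorem update_baseVector (β : ModelForms m (Fibre n) 2 m) (k : Fin m) (u : Fibre n) :
    β.val (Function.update baseVector k (0, u)) = ∑ a, momentumCoord β k a * u a := by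
  rw [fibre_eq_sum]
  have h1 : β.val (Function.update baseVector k (∑ a, u a • fibreVector a)) =
      ∑ a, β.val (Function.update baseVector k (u a • fibreVector a)) :=
    β.val.toMultilinearMap.map_update_sum _ _ _ _
  rw [h1]
  refine Finset.sum_congr rfl fun a _ => ?_
  rw [β.val.map_update_smul, smul_eq_mul, mul_comm]
  rfl

theorem mem_modelSemibasic_of_momentumCoord {β : ModelForms m (Fibre n) 2 m}
    (hβ : momentumCoord β = 0) : β ∈ ModelSemibasic m (Fibre n) m := by
  obtain _ | m := m
  · rintro v ⟨s, hs, -⟩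
    have := s.card_le_univ
    simp [hs] at this
  refine horizontalForms.mem_one_of_section (k := m) β.2
    (ContinuousLinearMap.inl ℝ (Base (m + 1)) (Fibre n)) (fun _ => rfl) fun X w hX => ?_
  have h3 : (β.val.toAlternatingMap.curryLeft X).compLinearMap
      (ContinuousLinearMap.inl ℝ (Base (m + 1)) (Fibre n)).toLinearMap = 0 := by
    refine Module.Basis.ext_alternating
      (EuclideanSpace.basisFun (Fin (m + 1)) ℝ).toBasis fun f hf => ?_
    obtain ⟨k, hk⟩ : ∃ k, ∀ i, f i ≠ k := by
      by_contra! h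
      have := Fintype.card_le_of_surjective f h
      simp at this
    have hinj : Function.Injective (Fin.cons k f : Fin (m + 1) → Fin (m + 1)) :=
      Fin.cons_injective_iff.2 ⟨fun ⟨i, hi⟩ => hk i hi, hf⟩
    let σ := Equiv.ofBijective _ (Finite.injective_iff_bijective.1 hinj)
    have h4 := β.val.toAlternatingMap.map_perm (Function.update baseVector k X) σ
    have hX' : X = (0, X.2) := Prod.ext hX rfl
    have h5 : β.val.toAlternatingMap (Function.update baseVector k X) = 0 := by
      have := update_baseVector β k X.2
      rw [← hX', hβ] at this
      simpa using this
    rw [h5, smul_zero] at h4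
    refine Eq.trans ?_ h4
    change β.val _ = β.val _
    congr 1
    funext i
    refine Fin.cases ?_ (fun i => ?_) i
    · change X = Function.update baseVector k X k
      simp
    · change _ = Function.update baseVector k X (f i)
      rw [Function.update_of_ne (hk i)]
      simp [baseVector]
  exact congrArg (fun α => α w) h3

theorem mk_sum_momentumForm (β : ModelForms m (Fibre n) 2 m) :
    (Submodule.Quotient.mk (∑ i, ∑ a, momentumCoord β i a • momentumForm i a) :
      ModelForms m (Fibre n) 2 m ⧸ ModelSemibasic m (Fibre n) m) = Submodule.Quotient.mk β := by
  rw [Submodule.Quotient.eq]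
  refine mem_modelSemibasic_of_momentumCoord ?_
  rw [map_sub, sub_eq_zero]
  funext j b
  simp only [map_sum, map_smul, Finset.sum_apply, Pi.smul_apply, momentumCoord_momentumForm,
    smul_eq_mul]
  rw [Finset.sum_eq_single j, Finset.sum_eq_single b] <;> simp +contextual

end Momenta

section FlatCoordinates

variable {m n : ℕ}

/-- The coordinate vectors `∂/∂x^i` of `ℝ^m × (ℝ^n × Λ)`. -/
def horizontalVector (i : Fin m) : Base m × MultimomentaFibre m (Fibre n) :=
  ContinuousLinearMap.inl ℝ (Base m) (MultimomentaFibre m (Fibre n))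
    ((EuclideanSpace.basisFun (Fin m) ℝ).toBasis i)

theorem modelCanonical_horizontal (u : Fibre n) (β : ModelForms m (Fibre n) 2 m) :
    modelCanonical m (Fibre n) 2 m (Fin.cons (0, (u, β)) horizontalVector) =
      -energyCoord β := by
  rw [modelCanonical_apply, Fin.sum_univ_succ, Finset.sum_eq_zero]
  · simp only [Fin.val_zero, pow_zero, one_mul, add_zero, Fin.cons_zero]
    congr 2
    funext i
    simp [Fin.removeNth, horizontalVector, baseVector]
  · intro i _
    have : (horizontalVector (n := n) i).2.2 = 0 := rfl
    rw [Fin.cons_succ, this, map_zero]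
    exact mul_zero _

theorem modelCanonical_update (u u' : Fibre n) (β β' : ModelForms m (Fibre n) 2 m) (k : Fin m) :
    modelCanonical m (Fibre n) 2 m
        (Fin.cons (0, (u, β)) (Function.update horizontalVector k (0, (u', β')))) =
      ∑ a, momentumCoord β' k a * u a - ∑ a, momentumCoord β k a * u' a := by
  rw [modelCanonical_apply, Fin.sum_univ_succ, Finset.sum_eq_single k]
  · have h1 : (fun j : Fin (m + 1) =>
        (((Fin.cons (0, (u, β)) (Function.update horizontalVector k (0, (u', β'))) :
          Fin (m + 1) → Base m × MultimomentaFibre m (Fibre n)) j).1,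
        ((Fin.cons (0, (u, β)) (Function.update horizontalVector k (0, (u', β'))) :
          Fin (m + 1) → Base m × MultimomentaFibre m (Fibre n)) j).2.1)) =
        Fin.cons (0, u) (Function.update baseVector k (0, u')) := by
      funext j
      refine Fin.cases rfl (fun j => ?_) j
      simp only [Fin.cons_succ]
      by_cases hj : j = k
      · subst hj
        simp
      · simp [hj, horizontalVector, baseVector]
    rw [h1, ContinuousAlternatingMap.map_succ_removeNth_cons, Function.update_idem]
    simp only [Fin.cons_succ, Function.update_self, Fin.cons_zero, Fin.val_zero, pow_zero, one_mul,
      Fin.val_succ]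
    have h2 : (0 : Fin (m + 1)).removeNth
        (Fin.cons (0, u) (Function.update baseVector k (0, u')) : Fin (m + 1) → Base m × Fibre n) =
        Function.update baseVector k (0, u') := by
      funext j
      simp [Fin.removeNth]
    rw [h2, update_baseVector, update_baseVector, ← mul_assoc, ← pow_add,
      show (k : ℕ) + 1 + k = 2 * k + 1 by ring, pow_succ, pow_mul]
    simp
    ring
  · intro i _ hi
    have : ((Fin.cons (0, (u, β)) (Function.update horizontalVector k (0, (u', β'))) :
        Fin (m + 1) → Base m × MultimomentaFibre m (Fibre n)) i.succ).2.2 = 0 := by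
      rw [Fin.cons_succ, Function.update_of_ne hi]
      rfl
    rw [this, map_zero]
    exact mul_zero _
  · simp

theorem flatLinearForm_horizontal (g : Base m →L[ℝ] MultimomentaFibre m (Fibre n)) (u : Fibre n)
    (β : ModelForms m (Fibre n) 2 m) :
    flatLinearForm m (Fibre n) g (Fin.cons (0, (u, β)) horizontalVector) =
      ∑ k, (∑ a, momentumCoord (g (EuclideanSpace.single k 1)).2 k a * u a -
        ∑ a, momentumCoord β k a * (g (EuclideanSpace.single k 1)).1 a) := by
  change insertion _ _ _ = _
  rw [insertion_apply, Fin.sum_univ_succ]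
  have h0 : modelCanonical m (Fibre n) 2 m (Function.update
      (Fin.cons (0, (u, β)) horizontalVector : Fin (m + 1) → _) 0
      (((ContinuousLinearMap.inr ℝ (Base m) (MultimomentaFibre m (Fibre n))).comp
        (g.comp (ContinuousLinearMap.fst ℝ (Base m) (MultimomentaFibre m (Fibre n)))))
        ((Fin.cons (0, (u, β)) horizontalVector : Fin (m + 1) → _) 0))) = 0 :=
    ContinuousAlternatingMap.map_coord_zero _ 0 (by simp)
  rw [h0, zero_add]
  refine Finset.sum_congr rfl fun k _ => ?_
  rw [← modelCanonical_update, Fin.cons_succ, ← Fin.cons_update]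
  congr 3
  simp [horizontalVector]

theorem flatModel_zero_horizontal (u : Fibre n) (β : ModelForms m (Fibre n) 2 m) :
    (flatModel (0 : Base m →L[ℝ] MultimomentaFibre m (Fibre n))).val
      (Fin.cons (0, (u, β)) horizontalVector) = -energyCoord β := by
  rw [← modelCanonical_horizontal u β]
  have h1 : modelProjector (0 : Base m →L[ℝ] MultimomentaFibre m (Fibre n)) =
      (ContinuousLinearMap.inl ℝ (Base m) (MultimomentaFibre m (Fibre n))).comp
        (ContinuousLinearMap.fst ℝ (Base m) (MultimomentaFibre m (Fibre n))) := by
    ext v <;> simp [modelProjector]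
  change (insertion _ _ - _) _ = _
  rw [h1]
  exact insertion_sub_apply_cons finrank_euclideanSpace_fin _ _ (fun _ => rfl) _ _

theorem flatModel_horizontal (g : Base m →L[ℝ] MultimomentaFibre m (Fibre n)) (u : Fibre n)
    (β : ModelForms m (Fibre n) 2 m) :
    (flatModel g).val (Fin.cons (0, (u, β)) horizontalVector) = -energyCoord β +
      ∑ k, (∑ a, momentumCoord (g (EuclideanSpace.single k 1)).2 k a * u a -
        ∑ a, momentumCoord β k a * (g (EuclideanSpace.single k 1)).1 a) := by
  rw [← flatLinearForm_horizontal, ← flatModel_zero_horizontal u β, flatModel_val_eq]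
  rfl

end FlatCoordinates

theorem extDeriv_cons_of_vertical {V W : Type*} [NormedAddCommGroup V] [NormedSpace ℝ V]
    [NormedAddCommGroup W] [NormedSpace ℝ W] {L : V →L[ℝ] W} {k : ℕ} {α : V → V [⋀^Fin k]→L[ℝ] ℝ}
    {x : V} (hα : DifferentiableAt ℝ α x) (h : ∀ᶠ y in 𝓝 x, α y ∈ horizontalForms L 1 k)
    {X : V} (hX : L X = 0) (w : Fin k → V) :
    extDeriv α x (Fin.cons X w) = fderiv ℝ (fun y => α y w) x X := by
  rw [extDeriv_apply hα, Fin.sum_univ_succ, Finset.sum_eq_zero]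
  · simp only [Fin.val_zero, pow_zero, one_smul, add_zero, Fin.cons_zero]
    rfl
  · intro i _
    obtain _ | k := k
    · exact i.elim0
    have h1 : (fun y => α y (i.succ.removeNth (Fin.cons X w : Fin (k + 2) → V))) =ᶠ[𝓝 x] fun _ => 0 := by
      filter_upwards [h] with y hy
      exact hy _ ⟨{0}, by simp, by simp [Fin.removeNth, hX]⟩
    rw [h1.fderiv_eq]
    simp

theorem fderiv_mem_horizontalForms {V W X : Type*} [NormedAddCommGroup V] [NormedSpace ℝ V]
    [NormedAddCommGroup W] [NormedSpace ℝ W] [NormedAddCommGroup X] [NormedSpace ℝ X]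
    {L : V →L[ℝ] W} {r k : ℕ} {α : X → V [⋀^Fin k]→L[ℝ] ℝ} {x : X} {α' : X →L[ℝ] V [⋀^Fin k]→L[ℝ] ℝ}
    (hα : HasFDerivAt α α' x) (h : ∀ᶠ y in 𝓝 x, α y ∈ horizontalForms L r k) (w : X) :
    α' w ∈ horizontalForms L r k := by
  intro v hv
  have h1 : HasFDerivAt (fun y => α y v) _ x :=
    (ContinuousAlternatingMap.apply ℝ V ℝ v).hasFDerivAt.comp x hα
  have h2 : HasFDerivAt (fun y => α y v) (0 : X →L[ℝ] ℝ) x :=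
    (hasFDerivAt_const (0 : ℝ) x).congr_of_eventuallyEq (h.mono fun y hy => hy v hv)
  exact congrArg (fun A : X →L[ℝ] ℝ => A w) (h1.unique h2)

section Pairing

variable {m n : ℕ}

/-- The value `∑ b_a u^a - ∑ a^k_a p^k_a(β)` of a pair `(a, b)` on `(u, β)`. -/
def equationPairing (q : (Fin m → Fin n → ℝ) × (Fin n → ℝ)) (u : Fibre n)
    (β : ModelForms m (Fibre n) 2 m) : ℝ :=
  ∑ a, q.2 a * u a - ∑ k, ∑ a, momentumCoord β k a * q.1 k a

theorem eq_zero_of_equationPairing {q : (Fin m → Fin n → ℝ) × (Fin n → ℝ)}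
    (hq : ∀ u β, equationPairing q u β = 0) : q = 0 := by
  refine Prod.ext ?_ ?_
  · funext k a
    have h := hq 0 (momentumForm k a)
    simp only [equationPairing, momentumCoord_momentumForm] at h
    rw [Finset.sum_eq_single k (by intro b _ hb; simp [Ne.symm hb]) (by simp),
      Finset.sum_eq_single a (by intro b _ hb; simp) (by simp)] at h
    simpa using h
  · funext a
    have h := hq (EuclideanSpace.single a 1) 0
    simpa [equationPairing] using h

theorem eq_zero_of_horizontalVector
    {Φ : (Base m × MultimomentaFibre m (Fibre n)) [⋀^Fin (m + 1)]→L[ℝ] ℝ}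
    (hΦ : Φ ∈ horizontalForms
      (ContinuousLinearMap.fst ℝ (Base m) (MultimomentaFibre m (Fibre n))) 2 (m + 1))
    (h : ∀ u β, Φ (Fin.cons (0, (u, β)) horizontalVector) = 0) : Φ = 0 := by
  refine horizontalForms.eq_zero_of_basis hΦ
    (ContinuousLinearMap.inl ℝ (Base m) (MultimomentaFibre m (Fibre n))) (fun _ => rfl)
    (EuclideanSpace.basisFun (Fin m) ℝ).toBasis fun X hX => ?_
  have hX' : X = (0, (X.2.1, X.2.2)) := Prod.ext hX rfl
  rw [hX']
  exact h _ _

end Pairing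

section Coordinates

variable {m n : ℕ} {E M : Type*} [TopologicalSpace M] [ChartedSpace (Base m) M]
  [TopologicalSpace E] [ChartedSpace (Base m × Fibre n) E]
  [IsManifold 𝓘(ℝ, Base m × Fibre n) ∞ E]
  {π : E → M} [IsFibration m (Fibre n) π]

variable (m n) in
/-- The map `(x, (u, β)) ↦ ((x, u), p^i_a(β))`. -/
def modelPosition : Base m × MultimomentaFibre m (Fibre n) →L[ℝ]
    (Base m × Fibre n) × (Fin m → Fin n → ℝ) :=
  (dropFibre m (Fibre n) (ModelForms m (Fibre n) 2 m)).prod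
    (momentumCoord.toContinuousLinearMap.comp
      ((ContinuousLinearMap.snd ℝ (Fibre n) (ModelForms m (Fibre n) 2 m)).comp
        (ContinuousLinearMap.snd ℝ (Base m) (MultimomentaFibre m (Fibre n)))))

namespace HamiltonianSection

variable (h : HamiltonianSection m (Fibre n) π) (c : AdaptedChart m (Fibre n) π)

theorem hamiltonian_modelPosition (y : Base m × MultimomentaFibre m (Fibre n)) :
    h.hamiltonian c (modelPosition m n y) =
      -energyCoord (h.inCoordinates c ((y.1, y.2.1), Submodule.Quotient.mk y.2.2)) := by
  rw [← mk_sum_momentumForm y.2.2]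
  rfl

theorem densityModel_horizontal (y : Base m × MultimomentaFibre m (Fibre n)) :
    h.densityModel c y horizontalVector =
      energyCoord y.2.2 + h.hamiltonian c (modelPosition m n y) := by
  rw [h.hamiltonian_modelPosition, densityModel, modelTautological_apply, ← sub_eq_add_neg]
  change (y.2.2 - h.inCoordinates c _).val _ = _
  rw [map_sub]
  have h1 : (fun i : Fin m => dropFibre m (Fibre n) (ModelForms m (Fibre n) 2 m)
      (horizontalVector i)) = baseVector := by
    funext i
    simp [horizontalVector, baseVector, dropFibre]
  change y.2.2.val (fun i => dropFibre m (Fibre n) (ModelForms m (Fibre n) 2 m)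
    (horizontalVector i)) - (h.inCoordinates c _).val
      (fun i => dropFibre m (Fibre n) (ModelForms m (Fibre n) 2 m) (horizontalVector i)) = _
  rw [h1]
  rfl

theorem contDiffOn_hamiltonian :
    ContDiffOn ℝ ∞ (h.hamiltonian c) (Prod.fst ⁻¹' c.total.target) := by
  let ε : ModelForms m (Fibre n) 2 m →ₗ[ℝ] ℝ :=
    { toFun := energyCoord
      map_add' := fun _ _ => rfl
      map_smul' := fun _ _ => rfl }
  have h0 : ContDiff ℝ ∞ (fun y : (Base m × Fibre n) × (Fin m → Fin n → ℝ) =>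
      ∑ i, ∑ a, y.2 i a • (momentumForm i a : ModelForms m (Fibre n) 2 m)) := by
    refine ContDiff.sum fun i _ => ContDiff.sum fun a _ => ?_
    have : ContDiff ℝ ∞ (fun y : (Base m × Fibre n) × (Fin m → Fin n → ℝ) => y.2 i a) := by
      fun_prop
    exact this.smul contDiff_const
  have h1 := contDiff_fst.prodMk
    ((ModelSemibasic m (Fibre n) m).mkQ.toContinuousLinearMap.contDiff.comp h0)
  have h2 := (h.contDiffOn_inCoordinates c).comp h1.contDiffOn
    (s := Prod.fst ⁻¹' c.total.target) fun y hy => hy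
  exact (ε.toContinuousLinearMap.contDiff.comp_contDiffOn h2).neg

theorem differentiableAt_hamiltonian {y : (Base m × Fibre n) × (Fin m → Fin n → ℝ)}
    (hy : y.1 ∈ c.total.target) : DifferentiableAt ℝ (h.hamiltonian c) y :=
  ((h.contDiffOn_hamiltonian c).contDiffAt
    ((c.total.open_target.preimage continuous_fst).mem_nhds hy)).differentiableAt (by simp)

theorem fderiv_hamiltonian (y : (Base m × Fibre n) × (Fin m → Fin n → ℝ)) (u : Fibre n)
    (q : Fin m → Fin n → ℝ) :
    fderiv ℝ (h.hamiltonian c) y ((0, u), q) =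
      ∑ a, h.fibrePartial c a y * u a + ∑ k, ∑ a, q k a * h.momentumPartial c k a y := by
  have hq : q = ∑ k, ∑ a, q k a • (Pi.single k (Pi.single a 1) : Fin m → Fin n → ℝ) := by
    funext j b
    simp only [Finset.sum_apply, Pi.smul_apply, smul_eq_mul]
    rw [Finset.sum_eq_single j, Finset.sum_eq_single b] <;> simp +contextual [Pi.single_apply]
  have h1 : (((0 : Base m), u), q) = ∑ a, u a • ((fibreVector a : Base m × Fibre n),
        (0 : Fin m → Fin n → ℝ)) +
      ∑ k, ∑ a, q k a • ((0 : Base m × Fibre n),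
        (Pi.single k (Pi.single a 1) : Fin m → Fin n → ℝ)) := by
    refine Prod.ext ?_ ?_
    · rw [fibre_eq_sum]
      simp [Prod.fst_sum]
    · conv_lhs => rw [hq]
      simp [Prod.snd_sum]
  rw [h1, map_add, map_sum, map_sum]
  congr 1
  · refine Finset.sum_congr rfl fun a _ => ?_
    rw [map_smul, smul_eq_mul, mul_comm]
    rfl
  · refine Finset.sum_congr rfl fun k _ => ?_
    rw [map_sum]
    refine Finset.sum_congr rfl fun a _ => ?_
    rw [map_smul, smul_eq_mul]
    rfl

theorem extDeriv_densityModel_horizontal {y : Base m × MultimomentaFibre m (Fibre n)}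
    (hy : y ∈ (c.formLift 2 m).total.target) (u : Fibre n) (β : ModelForms m (Fibre n) 2 m) :
    extDeriv (h.densityModel c) y (Fin.cons (0, (u, β)) horizontalVector) =
      energyCoord β + (∑ a, h.fibrePartial c a (modelPosition m n y) * u a +
        ∑ k, ∑ a, momentumCoord β k a * h.momentumPartial c k a (modelPosition m n y)) := by
  have hnhds := (c.formLift 2 m).total.open_target.mem_nhds hy
  have hd : DifferentiableAt ℝ (h.densityModel c) y :=
    ((h.contDiffOn_densityModel c).contDiffAt hnhds).differentiableAt (by simp)
  rw [extDeriv_cons_of_vertical (L := ContinuousLinearMap.fst ℝ (Base m)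
    (MultimomentaFibre m (Fibre n))) hd
    (by filter_upwards [hnhds] with y' hy' using h.densityModel_mem c hy') rfl]
  let ε : ModelForms m (Fibre n) 2 m →ₗ[ℝ] ℝ :=
    { toFun := energyCoord
      map_add' := fun _ _ => rfl
      map_smul' := fun _ _ => rfl }
  have h1 : (fun y => h.densityModel c y horizontalVector) = fun y =>
      (ε.toContinuousLinearMap.comp ((ContinuousLinearMap.snd ℝ (Fibre n)
        (ModelForms m (Fibre n) 2 m)).comp (ContinuousLinearMap.snd ℝ (Base m)
          (MultimomentaFibre m (Fibre n))))) y + h.hamiltonian c (modelPosition m n y) :=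
    funext (h.densityModel_horizontal c)
  have h2 := ((ε.toContinuousLinearMap.comp ((ContinuousLinearMap.snd ℝ (Fibre n)
      (ModelForms m (Fibre n) 2 m)).comp (ContinuousLinearMap.snd ℝ (Base m)
        (MultimomentaFibre m (Fibre n))))).hasFDerivAt (x := y)).add
    ((h.differentiableAt_hamiltonian c (y := modelPosition m n y) hy).hasFDerivAt.comp y
      (modelPosition m n).hasFDerivAt)
  rw [h1]
  refine (congrArg (fun A : Base m × MultimomentaFibre m (Fibre n) →L[ℝ] ℝ =>
    A (0, (u, β))) h2.fderiv).trans ?_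
  exact congrArg (energyCoord β + ·) (h.fderiv_hamiltonian c _ u (momentumCoord β))

/-- Hamilton's equations on `J¹(π ∘ ν)` in the induced chart. -/
def equationModel
    (y : Base m × (MultimomentaFibre m (Fibre n) × (Base m →L[ℝ] MultimomentaFibre m (Fibre n)))) :
    (Fin m → Fin n → ℝ) × (Fin n → ℝ) :=
  (fun j a => (y.2.2 (EuclideanSpace.single j 1)).1 a -
      h.momentumPartial c j a (modelPosition m n (y.1, y.2.1)),
    fun a => (∑ j, momentumCoord (y.2.2 (EuclideanSpace.single j 1)).2 j a) -
      (-h.fibrePartial c a (modelPosition m n (y.1, y.2.1))))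

theorem hamiltonMap_eq (z : MultimomentaJet m (Fibre n) π) :
    hamiltonMap h c z = h.equationModel c (c.jetLift.total z) := rfl

/-- The difference of `♭_Ω` and `-d𝓗` in coordinates. -/
def equationForm
    (y : Base m × (MultimomentaFibre m (Fibre n) × (Base m →L[ℝ] MultimomentaFibre m (Fibre n)))) :
    (Base m × MultimomentaFibre m (Fibre n)) [⋀^Fin (m + 1)]→L[ℝ] ℝ :=
  (flatModel y.2.2).val + extDeriv (h.densityModel c) (y.1, y.2.1)

theorem equationForm_horizontal
    {y : Base m × (MultimomentaFibre m (Fibre n) × (Base m →L[ℝ] MultimomentaFibre m (Fibre n)))}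
    (hy : (y.1, y.2.1) ∈ (c.formLift 2 m).total.target) (u : Fibre n)
    (β : ModelForms m (Fibre n) 2 m) :
    h.equationForm c y (Fin.cons (0, (u, β)) horizontalVector) =
      equationPairing (h.equationModel c y) u β := by
  have h1 : h.equationForm c y (Fin.cons (0, (u, β)) horizontalVector) =
      (flatModel y.2.2).val (Fin.cons (0, (u, β)) horizontalVector) +
      extDeriv (h.densityModel c) (y.1, y.2.1) (Fin.cons (0, (u, β)) horizontalVector) := rfl
  rw [h1, flatModel_horizontal, h.extDeriv_densityModel_horizontal c hy, equationPairing]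
  simp only [equationModel, sub_neg_eq_add, add_mul, mul_sub, Finset.sum_add_distrib,
    Finset.sum_sub_distrib, Finset.sum_mul]
  rw [Finset.sum_comm (f := fun a j =>
    momentumCoord (y.2.2 (EuclideanSpace.single j 1)).2 j a * u a)]
  ring

theorem equationForm_mem
    {y : Base m × (MultimomentaFibre m (Fibre n) × (Base m →L[ℝ] MultimomentaFibre m (Fibre n)))}
    (hy : (y.1, y.2.1) ∈ (c.formLift 2 m).total.target) :
    h.equationForm c y ∈ horizontalForms
      (ContinuousLinearMap.fst ℝ (Base m) (MultimomentaFibre m (Fibre n))) 2 (m + 1) := by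
  refine Submodule.add_mem _ (flatModel y.2.2).2 (extDeriv_mem_horizontalForms _ 1 m _ _ ?_)
  filter_upwards [(c.formLift 2 m).total.open_target.mem_nhds hy] with y' hy'
  exact h.densityModel_mem c hy'

theorem equationForm_eq_zero_iff
    {y : Base m × (MultimomentaFibre m (Fibre n) × (Base m →L[ℝ] MultimomentaFibre m (Fibre n)))}
    (hy : (y.1, y.2.1) ∈ (c.formLift 2 m).total.target) :
    h.equationForm c y = 0 ↔ h.equationModel c y = 0 := by
  constructor
  · intro h0
    refine eq_zero_of_equationPairing fun u β => ?_
    rw [← h.equationForm_horizontal c hy, h0]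
    rfl
  · intro h0
    refine eq_zero_of_horizontalVector (h.equationForm_mem c hy) fun u β => ?_
    rw [h.equationForm_horizontal c hy, h0]
    simp [equationPairing]

theorem mem_equationSet_iff_hamiltonMap (z : MultimomentaJet m (Fibre n) π)
    (hz : z.pt.pt ∈ c.total.source) : z ∈ h.equationSet ↔ hamiltonMap h c z = 0 := by
  rw [h.mem_equationSet_iff c z hz, hamiltonMap_eq, ← h.equationForm_eq_zero_iff c]
  · rfl
  · exact c.total.map_source hz

end HamiltonianSection

end Coordinates

section Coordinates

variable {m n : ℕ} {E M : Type*} [TopologicalSpace M] [ChartedSpace (Base m) M]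
  [TopologicalSpace E] [ChartedSpace (Base m × Fibre n) E]
  [IsManifold 𝓘(ℝ, Base m × Fibre n) ∞ E]
  {π : E → M} [IsFibration m (Fibre n) π]

/-- The principal part `(u^a_j, ∑ p^j_{aj})` of Hamilton's equations. -/
def equationSymbol (m n : ℕ) : (Base m →L[ℝ] MultimomentaFibre m (Fibre n)) →ₗ[ℝ]
    (Fin m → Fin n → ℝ) × (Fin n → ℝ) where
  toFun g := (fun j a => (g (EuclideanSpace.single j 1)).1 a,
    fun a => ∑ j, momentumCoord (g (EuclideanSpace.single j 1)).2 j a)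
  map_add' g g' := by
    refine Prod.ext rfl (funext fun a => ?_)
    simp [Finset.sum_add_distrib]
  map_smul' r g := by
    refine Prod.ext rfl (funext fun a => ?_)
    simp [Finset.mul_sum]

theorem equationSymbol_surjective (hm : 0 < m) :
    Function.Surjective (equationSymbol m n) := by
  intro q
  let j₀ : Fin m := ⟨0, hm⟩
  let g : Base m →L[ℝ] MultimomentaFibre m (Fibre n) :=
    ((EuclideanSpace.basisFun (Fin m) ℝ).toBasis.constr ℝ fun j =>
      ((WithLp.toLp 2 (q.1 j) : Fibre n),
        if j = j₀ then ∑ a, q.2 a • momentumForm j₀ a else 0)).toContinuousLinearMap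
  have hg : ∀ j, g (EuclideanSpace.single j 1) = ((WithLp.toLp 2 (q.1 j) : Fibre n),
      if j = j₀ then ∑ a, q.2 a • momentumForm j₀ a else 0) := by
    intro j
    have := (EuclideanSpace.basisFun (Fin m) ℝ).toBasis.constr_basis ℝ (fun j =>
      ((WithLp.toLp 2 (q.1 j) : Fibre n),
        (if j = j₀ then ∑ a, q.2 a • momentumForm j₀ a else 0 :
          ModelForms m (Fibre n) 2 m))) j
    rw [OrthonormalBasis.coe_toBasis, EuclideanSpace.basisFun_apply] at this
    exact this
  refine ⟨g, Prod.ext (funext fun j => funext fun a => ?_) (funext fun a => ?_)⟩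
  · change (g (EuclideanSpace.single j 1)).1 a = _
    rw [hg]
  · change ∑ j, momentumCoord (g (EuclideanSpace.single j 1)).2 j a = _
    rw [Finset.sum_eq_single j₀]
    · rw [hg]
      simp only [if_true, map_sum, map_smul, Finset.sum_apply, Pi.smul_apply, smul_eq_mul,
        momentumCoord_momentumForm]
      simp
    · intro j _ hj
      rw [hg]
      simp [hj]
    · simp

namespace HamiltonianSection

variable (h : HamiltonianSection m (Fibre n) π) (c : AdaptedChart m (Fibre n) π)

theorem contDiffOn_fderiv_hamiltonian (v : (Base m × Fibre n) × (Fin m → Fin n → ℝ)) :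
    ContDiffOn ℝ ∞ (fun y : Base m × (MultimomentaFibre m (Fibre n) ×
        (Base m →L[ℝ] MultimomentaFibre m (Fibre n))) =>
      fderiv ℝ (h.hamiltonian c) (modelPosition m n (y.1, y.2.1)) v) c.jetLift.total.target := by
  have h1 := ((h.contDiffOn_hamiltonian c).fderiv_of_isOpen (m := ∞)
    (c.total.open_target.preimage continuous_fst) (by simp)).clm_apply
      (contDiffOn_const (c := v))
  have h2 : ContDiff ℝ ∞ (fun y : Base m × (MultimomentaFibre m (Fibre n) ×
        (Base m →L[ℝ] MultimomentaFibre m (Fibre n))) =>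
      modelPosition m n (y.1, y.2.1)) :=
    (modelPosition m n).contDiff.comp (contDiff_fst.prodMk contDiff_snd.fst)
  exact h1.comp h2.contDiffOn fun y hy => hy

theorem contDiffOn_equationModel :
    ContDiffOn ℝ ∞ (h.equationModel c) c.jetLift.total.target := by
  have h1 : ContDiffOn ℝ ∞ (fun y : Base m × (MultimomentaFibre m (Fibre n) ×
        (Base m →L[ℝ] MultimomentaFibre m (Fibre n))) =>
      (equationSymbol m n).toContinuousLinearMap y.2.2) c.jetLift.total.target :=
    ((equationSymbol m n).toContinuousLinearMap.contDiff.comp contDiff_snd.snd).contDiffOn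
  refine ContDiffOn.prodMk ?_ ?_
  · refine contDiffOn_pi.2 fun j => contDiffOn_pi.2 fun a => ?_
    exact ((contDiffOn_pi.1 (contDiffOn_pi.1 h1.fst j)) a).sub
      (h.contDiffOn_fderiv_hamiltonian c _)
  · refine contDiffOn_pi.2 fun a => ?_
    exact ((contDiffOn_pi.1 h1.snd) a).sub (h.contDiffOn_fderiv_hamiltonian c _).neg

theorem hasFDerivAt_equationModel
    {y : Base m × (MultimomentaFibre m (Fibre n) × (Base m →L[ℝ] MultimomentaFibre m (Fibre n)))}
    (hy : y ∈ c.jetLift.total.target) :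
    HasFDerivAt (h.equationModel c) (fderiv ℝ (h.equationModel c) y) y :=
  (((h.contDiffOn_equationModel c).contDiffAt
    (c.jetLift.total.open_target.mem_nhds hy)).differentiableAt (by simp)).hasFDerivAt

theorem fderiv_equationModel_vertical
    {y : Base m × (MultimomentaFibre m (Fibre n) × (Base m →L[ℝ] MultimomentaFibre m (Fibre n)))}
    (hy : y ∈ c.jetLift.total.target) (g : Base m →L[ℝ] MultimomentaFibre m (Fibre n)) :
    fderiv ℝ (h.equationModel c) y (0, (0, g)) = equationSymbol m n g := by
  have h1 : HasFDerivAt (fun g : Base m →L[ℝ] MultimomentaFibre m (Fibre n) =>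
      (y.1, (y.2.1, g)))
      ((0 : _ →L[ℝ] Base m).prod ((0 : _ →L[ℝ] MultimomentaFibre m (Fibre n)).prod
        (ContinuousLinearMap.id ℝ _))) y.2.2 :=
    (hasFDerivAt_const _ _).prodMk ((hasFDerivAt_const _ _).prodMk (hasFDerivAt_id _))
  have h2 := HasFDerivAt.comp (g := h.equationModel c) y.2.2
    (h.hasFDerivAt_equationModel c hy) h1
  have h3 : (h.equationModel c ∘ fun g => (y.1, (y.2.1, g))) = fun g =>
      (equationSymbol m n).toContinuousLinearMap g + h.equationModel c (y.1, (y.2.1, 0)) := by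
    funext g
    refine Prod.ext (funext fun j => funext fun a => ?_) (funext fun a => ?_)
    · change _ - _ = _ + ((0 : ℝ) - _)
      rw [zero_sub, ← sub_eq_add_neg]
      rfl
    · change _ - _ = _ + ((∑ j : Fin m, momentumCoord (0 : ModelForms m (Fibre n) 2 m) j a) - _)
      simp only [map_zero, Pi.zero_apply, Finset.sum_const_zero]
      rw [zero_sub, ← sub_eq_add_neg]
      rfl
  rw [h3] at h2
  exact congrArg (fun A : (Base m →L[ℝ] MultimomentaFibre m (Fibre n)) →L[ℝ] _ => A g)
    (h2.unique ((equationSymbol m n).toContinuousLinearMap.hasFDerivAt.add_const _))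

theorem hasMFDerivAt_hamiltonMap (z : MultimomentaJet m (Fibre n) π)
    (hz : z.pt.pt ∈ c.total.source) :
    HasMFDerivAt 𝓘(ℝ, Base m × (MultimomentaFibre m (Fibre n) ×
        (Base m →L[ℝ] MultimomentaFibre m (Fibre n))))
      𝓘(ℝ, (Fin m → Fin n → ℝ) × (Fin n → ℝ)) (hamiltonMap h c) z
      ((fderiv ℝ (h.equationModel c) (c.jetLift.total z)).comp (c.jetLift.tangentCoord z)) := by
  have hz' : z ∈ c.jetLift.total.source := hz
  exact HasMFDerivAt.comp z
    (h.hasFDerivAt_equationModel c (c.jetLift.total.map_source hz')).hasMFDerivAt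
    (c.jetLift.mdifferentiable_total.mdifferentiableAt hz').hasMFDerivAt

/-- Hamilton's equations define `S_𝓗` in the induced chart. -/
theorem isLocalDefiningMap_hamiltonMap (hm : 0 < m) :
    IsLocalDefiningMap
      (V := Base m × (MultimomentaFibre m (Fibre n) ×
        (Base m →L[ℝ] MultimomentaFibre m (Fibre n))))
      h.equationSet {z | z.pt.pt ∈ c.total.source} (hamiltonMap h c) where
  isOpen := c.jetLift.total.open_source
  smooth := by
    have h1 := contMDiffOn_of_mem_maximalAtlas c.jetLift.total_mem
    exact (h.contDiffOn_equationModel c).contMDiffOn.comp h1 c.jetLift.total.mapsTo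
  inter_eq := by
    ext z
    constructor
    · rintro ⟨hz, hzU⟩
      exact ⟨hzU, (h.mem_equationSet_iff_hamiltonMap c z hzU).1 hz⟩
    · rintro ⟨hzU, hz⟩
      exact ⟨(h.mem_equationSet_iff_hamiltonMap c z hzU).2 hz, hzU⟩
  surjective := by
    rintro z ⟨-, hz⟩ q
    have hz' : z ∈ c.jetLift.total.source := hz
    obtain ⟨g, hg⟩ := equationSymbol_surjective (n := n) hm q
    refine ⟨c.jetLift.tangentPoint z (0, (0, g)), ?_⟩
    rw [(h.hasMFDerivAt_hamiltonMap c z hz).mfderiv]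
    change fderiv ℝ (h.equationModel c) (c.jetLift.total z)
      (c.jetLift.tangentCoord z (c.jetLift.tangentPoint z (0, (0, g)))) = q
    rw [c.jetLift.tangentCoord_point hz',
      h.fderiv_equationModel_vertical c (c.jetLift.total.map_source hz'), hg]

theorem contDiffAt_densityModel {y : Base m × MultimomentaFibre m (Fibre n)}
    (hy : y ∈ (c.formLift 2 m).total.target) : ContDiffAt ℝ ∞ (h.densityModel c) y :=
  (h.contDiffOn_densityModel c).contDiffAt ((c.formLift 2 m).total.open_target.mem_nhds hy)

theorem differentiableAt_extDeriv_densityModel {y : Base m × MultimomentaFibre m (Fibre n)}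
    (hy : y ∈ (c.formLift 2 m).total.target) :
    DifferentiableAt ℝ (extDeriv (h.densityModel c)) y := by
  have h1 : ContDiffAt ℝ ∞ (fderiv ℝ (h.densityModel c)) y :=
    (h.contDiffAt_densityModel c hy).fderiv_right (by simp)
  exact (ContinuousAlternatingMap.alternatizeUncurryFinCLM ℝ
    (Base m × MultimomentaFibre m (Fibre n)) ℝ).differentiableAt.comp _
      (h1.differentiableAt (by simp))

/-- The derivative of `h.equationForm c`. -/
def equationFormDeriv
    (y : Base m × (MultimomentaFibre m (Fibre n) × (Base m →L[ℝ] MultimomentaFibre m (Fibre n)))) :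
    Base m × (MultimomentaFibre m (Fibre n) × (Base m →L[ℝ] MultimomentaFibre m (Fibre n))) →L[ℝ]
      (Base m × MultimomentaFibre m (Fibre n)) [⋀^Fin (m + 1)]→L[ℝ] ℝ :=
  (flatLinearForm m (Fibre n)).toContinuousLinearMap.comp
      ((ContinuousLinearMap.snd ℝ (MultimomentaFibre m (Fibre n))
          (Base m →L[ℝ] MultimomentaFibre m (Fibre n))).comp
        (ContinuousLinearMap.snd ℝ (Base m) (MultimomentaFibre m (Fibre n) ×
          (Base m →L[ℝ] MultimomentaFibre m (Fibre n))))) +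
    (fderiv ℝ (extDeriv (h.densityModel c)) (y.1, y.2.1)).comp (dropFibre m _ _)

theorem hasFDerivAt_equationForm
    {y : Base m × (MultimomentaFibre m (Fibre n) × (Base m →L[ℝ] MultimomentaFibre m (Fibre n)))}
    (hy : (y.1, y.2.1) ∈ (c.formLift 2 m).total.target) :
    HasFDerivAt (h.equationForm c) (h.equationFormDeriv c y) y := by
  have h1 : h.equationForm c = fun y => (flatModel 0).val +
      ((flatLinearForm m (Fibre n)).toContinuousLinearMap
        ((ContinuousLinearMap.snd ℝ (MultimomentaFibre m (Fibre n))
          (Base m →L[ℝ] MultimomentaFibre m (Fibre n))).comp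
        (ContinuousLinearMap.snd ℝ (Base m) (MultimomentaFibre m (Fibre n) ×
          (Base m →L[ℝ] MultimomentaFibre m (Fibre n)))) y) +
        extDeriv (h.densityModel c) (dropFibre m _ _ y)) := by
    funext y
    rw [← add_assoc]
    change (flatModel y.2.2).val + _ = _ + flatLinearForm m (Fibre n) y.2.2 + _
    rw [← flatModel_val_eq]
    rfl
  have h2 : HasFDerivAt (fun y' => extDeriv (h.densityModel c)
      (dropFibre m (MultimomentaFibre m (Fibre n))
        (Base m →L[ℝ] MultimomentaFibre m (Fibre n)) y')) _ y :=
    HasFDerivAt.comp y (g := extDeriv (h.densityModel c))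
      (f := dropFibre m (MultimomentaFibre m (Fibre n))
        (Base m →L[ℝ] MultimomentaFibre m (Fibre n)))
      (h.differentiableAt_extDeriv_densityModel c hy).hasFDerivAt
      ((dropFibre m (MultimomentaFibre m (Fibre n))
        (Base m →L[ℝ] MultimomentaFibre m (Fibre n))).hasFDerivAt (x := y))
  have h3 := ((flatLinearForm m (Fibre n)).toContinuousLinearMap.comp
      ((ContinuousLinearMap.snd ℝ (MultimomentaFibre m (Fibre n))
          (Base m →L[ℝ] MultimomentaFibre m (Fibre n))).comp
        (ContinuousLinearMap.snd ℝ (Base m) (MultimomentaFibre m (Fibre n) ×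
          (Base m →L[ℝ] MultimomentaFibre m (Fibre n)))))).hasFDerivAt (x := y)
  rw [h1]
  exact (h3.add h2).const_add _

theorem equationFormDeriv_horizontal
    {y : Base m × (MultimomentaFibre m (Fibre n) × (Base m →L[ℝ] MultimomentaFibre m (Fibre n)))}
    (hy : y ∈ c.jetLift.total.target)
    (w : Base m × (MultimomentaFibre m (Fibre n) × (Base m →L[ℝ] MultimomentaFibre m (Fibre n))))
    (u : Fibre n) (β : ModelForms m (Fibre n) 2 m) :
    h.equationFormDeriv c y w (Fin.cons (0, (u, β)) horizontalVector) =
      equationPairing (fderiv ℝ (h.equationModel c) y w) u β := by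
  have h1 : HasFDerivAt (fun y' => h.equationForm c y'
      (Fin.cons (0, (u, β)) horizontalVector)) _ y :=
    (ContinuousAlternatingMap.apply ℝ (Base m × MultimomentaFibre m (Fibre n)) ℝ
      (Fin.cons (0, (u, β)) horizontalVector)).hasFDerivAt.comp y
        (h.hasFDerivAt_equationForm c hy)
  let L : (Fin m → Fin n → ℝ) × (Fin n → ℝ) →ₗ[ℝ] ℝ :=
    { toFun := fun q => equationPairing q u β
      map_add' := fun q q' => by
        simp only [equationPairing, Prod.fst_add, Prod.snd_add, Pi.add_apply, add_mul, mul_add,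
          Finset.sum_add_distrib]
        ring
      map_smul' := fun r q => by
        simp only [equationPairing, Prod.smul_fst, Prod.smul_snd, Pi.smul_apply, smul_eq_mul,
          RingHom.id_apply, mul_sub, Finset.mul_sum]
        congr 1
        · exact Finset.sum_congr rfl fun a _ => by ring
        · exact Finset.sum_congr rfl fun k _ => Finset.sum_congr rfl fun a _ => by ring }
  have h2 := L.toContinuousLinearMap.hasFDerivAt.comp y (h.hasFDerivAt_equationModel c hy)
  have h3 : (fun y' => h.equationForm c y' (Fin.cons (0, (u, β)) horizontalVector)) =ᶠ[𝓝 y]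
      L.toContinuousLinearMap ∘ h.equationModel c := by
    filter_upwards [c.jetLift.total.open_target.mem_nhds hy] with y' hy'
    exact h.equationForm_horizontal c hy' u β
  exact congrArg (fun A' : _ →L[ℝ] ℝ => A' w) (h1.unique (h2.congr_of_eventuallyEq h3))

theorem fderiv_equationModel_eq_zero_iff
    {y : Base m × (MultimomentaFibre m (Fibre n) × (Base m →L[ℝ] MultimomentaFibre m (Fibre n)))}
    (hy : y ∈ c.jetLift.total.target)
    (w : Base m × (MultimomentaFibre m (Fibre n) ×
      (Base m →L[ℝ] MultimomentaFibre m (Fibre n)))) :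
    fderiv ℝ (h.equationModel c) y w = 0 ↔ flatLinearForm m (Fibre n) w.2.2 =
      (-fderiv ℝ (extDeriv (h.densityModel c)) (y.1, y.2.1)) (w.1, w.2.1) := by
  have hmem : h.equationFormDeriv c y w ∈ horizontalForms
      (ContinuousLinearMap.fst ℝ (Base m) (MultimomentaFibre m (Fibre n))) 2 (m + 1) :=
    fderiv_mem_horizontalForms (h.hasFDerivAt_equationForm c hy) (by
      filter_upwards [c.jetLift.total.open_target.mem_nhds hy] with y' hy'
      exact h.equationForm_mem c hy') w
  have h1 : h.equationFormDeriv c y w = 0 ↔ flatLinearForm m (Fibre n) w.2.2 =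
      (-fderiv ℝ (extDeriv (h.densityModel c)) (y.1, y.2.1)) (w.1, w.2.1) :=
    add_eq_zero_iff_eq_neg
  rw [← h1]
  constructor
  · intro hw
    refine eq_zero_of_horizontalVector hmem fun u β => ?_
    rw [h.equationFormDeriv_horizontal c hy, hw]
    simp [equationPairing]
  · intro hw
    refine eq_zero_of_equationPairing fun u β => ?_
    rw [← h.equationFormDeriv_horizontal c hy, hw]
    rfl

theorem alternating_fderiv_extDeriv_densityModel {y : Base m × MultimomentaFibre m (Fibre n)}
    (hy : y ∈ (c.formLift 2 m).total.target)
    (v : Fin (m + 2) → Base m × MultimomentaFibre m (Fibre n)) :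
    ∑ i : Fin (m + 2), (-1 : ℝ) ^ (i : ℕ) *
      (-fderiv ℝ (extDeriv (h.densityModel c)) y) (v i) (i.removeNth v) = 0 := by
  have h1 := extDeriv_extDeriv_apply (r := ∞) (h.contDiffAt_densityModel c hy)
    (by rw [minSmoothness_of_isRCLikeNormedField]; exact WithTop.coe_le_coe.2 le_top)
  have h2 : extDeriv (extDeriv (h.densityModel c)) y v = 0 := by rw [h1]; rfl
  rw [extDeriv, ContinuousAlternatingMap.alternatizeUncurryFin_apply] at h2
  rw [← neg_eq_zero, ← Finset.sum_neg_distrib, ← h2]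
  refine Finset.sum_congr rfl fun i _ => ?_
  simp only [zsmul_eq_mul, Int.cast_pow, Int.cast_neg, Int.cast_one]
  rw [← mul_neg]
  congr 1
  exact neg_neg _

/-- The tangent spaces of `S_𝓗` are Lagrangian. -/
theorem isLagrangianSubspace_of_mem_iff (hm : 0 < m) (z : MultimomentaJet m (Fibre n) π)
    (hz : z.pt.pt ∈ c.total.source)
    (W : Submodule ℝ (TangentSpace 𝓘(ℝ, Base m × (MultimomentaFibre m (Fibre n) ×
        (Base m →L[ℝ] MultimomentaFibre m (Fibre n)))) z))
    (hW : ∀ v, v ∈ W ↔ fderiv ℝ (h.equationModel c) (c.jetLift.total z)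
      (c.jetLift.tangentCoord z v) = 0) :
    IsLagrangianSubspace (jetForm m (Fibre n) π z).toAlternatingMap (m + 1) W := by
  have hz' : z ∈ c.jetLift.total.source := hz
  have hyt : c.jetLift.total z ∈ c.jetLift.total.target := c.jetLift.total.map_source hz'
  let T : TangentSpace 𝓘(ℝ, Base m × (MultimomentaFibre m (Fibre n) ×
        (Base m →L[ℝ] MultimomentaFibre m (Fibre n)))) z →ₗ[ℝ]
      Base m × (MultimomentaFibre m (Fibre n) × (Base m →L[ℝ] MultimomentaFibre m (Fibre n))) :=
    (c.jetLift.tangentCoord z).toLinearMap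
  have hT : ∀ w, T (c.jetLift.tangentPoint z w) = w := c.jetLift.tangentCoord_point hz'
  refine IsLagrangianSubspace.of_graph
    ((dropFibre m (MultimomentaFibre m (Fibre n))
      (Base m →L[ℝ] MultimomentaFibre m (Fibre n))).toLinearMap ∘ₗ T)
    (LinearMap.snd ℝ _ _ ∘ₗ LinearMap.snd ℝ _ _ ∘ₗ T)
    (fun y' g => ⟨c.jetLift.tangentPoint z (y'.1, (y'.2, g)), ?_, ?_⟩)
    (flatLinearForm m (Fibre n))
    (-fderiv ℝ (extDeriv (h.densityModel c))
      ((c.jetLift.total z).1, (c.jetLift.total z).2.1)).toLinearMap _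
    (c.jetForm_apply z hz) (h.alternating_fderiv_extDeriv_densityModel c hyt) ?_ W ?_
  · change dropFibre m _ _ (T _) = y'
    rw [hT]
    rfl
  · change (T _).2.2 = g
    rw [hT]
  · intro y'
    obtain ⟨g, hg⟩ := equationSymbol_surjective (n := n) hm
      (-fderiv ℝ (h.equationModel c) (c.jetLift.total z) (y'.1, (y'.2, 0)))
    refine ⟨g, (h.fderiv_equationModel_eq_zero_iff c hyt (y'.1, (y'.2, g))).1 ?_⟩
    have h1 : (y'.1, (y'.2, g)) = (y'.1, (y'.2, (0 : Base m →L[ℝ] _))) + (0, (0, g)) := by simp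
    rw [h1, map_add, h.fderiv_equationModel_vertical c hyt, hg, add_neg_cancel]
  · intro v
    rw [hW, h.fderiv_equationModel_eq_zero_iff c hyt]
    rfl

theorem isLagrangianSubmanifold_equationSet (hm : 0 < m) :
    IsLagrangianSubmanifold h.equationSet (jetForm m (Fibre n) π) (m + 1) := by
  intro z hzS
  obtain ⟨c, hc⟩ := AdaptedChart.exists_mem_source (m := m) (F := Fibre n) (p := π) z.pt.pt
  have hH := h.isLocalDefiningMap_hamiltonMap c hm
  let ι : ((Fin m → Fin n → ℝ) × (Fin n → ℝ)) ≃L[ℝ] (Fin _ → ℝ) :=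
    (Module.finBasis ℝ ((Fin m → Fin n → ℝ) × (Fin n → ℝ))).equivFun.toContinuousLinearEquiv
  have hd : ∀ z : MultimomentaJet m (Fibre n) π, z.pt.pt ∈ c.total.source →
      HasMFDerivAt 𝓘(ℝ, Base m × (MultimomentaFibre m (Fibre n) ×
          (Base m →L[ℝ] MultimomentaFibre m (Fibre n)))) 𝓘(ℝ, Fin _ → ℝ)
        (ι ∘ hamiltonMap h c) z _ := fun z hz =>
    HasMFDerivAt.comp z (ι.toContinuousLinearMap.hasMFDerivAt) (h.hasMFDerivAt_hamiltonMap c z hz)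
  refine ⟨{z | z.pt.pt ∈ c.total.source}, _, ι ∘ hamiltonMap h c, hc, ⟨hH.isOpen, ?_, ?_, ?_⟩,
    h.isLagrangianSubspace_of_mem_iff c hm z hc _ fun v => ?_⟩
  · exact ι.toContinuousLinearMap.contMDiff.comp_contMDiffOn hH.smooth
  · rw [hH.inter_eq]
    ext z
    simp
  · rintro z hz q
    obtain ⟨v, hv⟩ := hH.surjective z hz (ι.symm q)
    refine ⟨v, ?_⟩
    rw [(hd z hz.2).mfderiv]
    rw [(h.hasMFDerivAt_hamiltonMap c z hz.2).mfderiv] at hv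
    change ι (((fderiv ℝ (h.equationModel c) (c.jetLift.total z)).comp
      (c.jetLift.tangentCoord z)) v) = q
    exact (congrArg ι hv).trans (ι.apply_symm_apply q)
  · rw [(hd z hc).mfderiv]
    exact ι.map_eq_zero_iff

end HamiltonianSection

end Coordinates

section Sections

variable {m : ℕ} {F : Type*} [NormedAddCommGroup F] [NormedSpace ℝ F] {P M : Type*}
  [TopologicalSpace M] [ChartedSpace (Base m) M]
  [TopologicalSpace P] [ChartedSpace (Base m × F) P] {p : P → M} [IsFibration m F p]

/-- The derivative of the coordinate expression of a local section is given by the jet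
coordinates. -/
theorem LocalSection.hasFDerivAt_coord (σ : LocalSection m F p) (c : AdaptedChart m F p) {x : M}
    (hx : x ∈ σ.dom) (hsrc : σ.toFun x ∈ c.total.source) :
    HasFDerivAt (fun s => (c.total (σ.toFun (c.base.symm s))).2) (c.jetCoord (σ.jet x hx))
      (c.base x) := by
  have hproj : p (σ.toFun x) = x := σ.proj x hx
  have hxs : x ∈ c.base.source := hproj ▸ c.map_source _ hsrc
  have hinv : c.base.symm (c.base x) = x := c.base.left_inv hxs
  have h1 := (c.mdifferentiable_base.mdifferentiableAt_symm
    (c.base.map_source hxs)).hasMFDerivAt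
  have h2 : HasMFDerivAt 𝓘(ℝ, Base m) 𝓘(ℝ, Base m × F) σ.toFun (c.base.symm (c.base x))
      (mfderiv 𝓘(ℝ, Base m) 𝓘(ℝ, Base m × F) σ.toFun x) := by
    rw [hinv]
    exact ((σ.smooth.contMDiffAt (σ.isOpen_dom.mem_nhds hx)).mdifferentiableAt
      (by simp)).hasMFDerivAt
  have h3 : HasMFDerivAt 𝓘(ℝ, Base m × F) 𝓘(ℝ, Base m × F) c.total
      (σ.toFun (c.base.symm (c.base x))) (c.tangentCoord (σ.toFun x)) := by
    rw [hinv]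
    exact (c.mdifferentiable_total.mdifferentiableAt hsrc).hasMFDerivAt
  have h4 := HasMFDerivAt.comp (c.base x) h3 (HasMFDerivAt.comp (c.base x) h2 h1)
  have h5 := ((ContinuousLinearMap.snd ℝ (Base m) F).hasFDerivAt).comp (c.base x)
    (HasMFDerivAt.hasFDerivAt h4)
  refine h5.congr_fderiv ?_
  refine ContinuousLinearMap.ext fun w => ?_
  have h6 : ∀ y, y = x →
      (mfderiv 𝓘(ℝ, Base m) 𝓘(ℝ, Base m) c.base.symm (c.base y) w : Base m) =
        mfderiv 𝓘(ℝ, Base m) 𝓘(ℝ, Base m) c.base.symm (c.base x) w := by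
    rintro _ rfl
    rfl
  change _ = (c.tangentCoord (σ.toFun x) (mfderiv 𝓘(ℝ, Base m) 𝓘(ℝ, Base m × F) σ.toFun x
    (mfderiv 𝓘(ℝ, Base m) 𝓘(ℝ, Base m) c.base.symm (c.base (p (σ.toFun x))) w : Base m))).2
  rw [h6 _ hproj]
  rfl

end Sections

section Coordinates

variable {m n : ℕ} {E M : Type*} [TopologicalSpace M] [ChartedSpace (Base m) M]
  [TopologicalSpace E] [ChartedSpace (Base m × Fibre n) E]
  [IsManifold 𝓘(ℝ, Base m × Fibre n) ∞ E]
  {π : E → M} [IsFibration m (Fibre n) π]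

namespace HamiltonianSection

variable (h : HamiltonianSection m (Fibre n) π) (c : AdaptedChart m (Fibre n) π)

/-- The equations for jets are Hamilton's equations for the reduced section. -/
theorem hamiltonMap_jet_eq_zero_iff
    (σ : LocalSection m (MultimomentaFibre m (Fibre n))
      (Multimomenta.proj : Multimomenta m (Fibre n) π → M)) {x : M} (hx : x ∈ σ.dom)
    (hsrc : (σ.toFun x).pt ∈ c.total.source) :
    hamiltonMap h c (σ.jet x hx) = 0 ↔
      HamiltonEquationsAt h c (fun y => (σ.toFun y).reduce) x := by
  have hD := σ.hasFDerivAt_coord (c.formLift 2 m) hx hsrc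
  have h1 (a : Fin n) : HasFDerivAt
      (fun s : Base m => (reducedPosition c (σ.toFun (c.base.symm s)).reduce).1.2 a)
      ((EuclideanSpace.proj a).comp ((ContinuousLinearMap.fst ℝ (Fibre n)
        (ModelForms m (Fibre n) 2 m)).comp (jetDerivative c (σ.jet x hx)))) (c.base x) :=
    ((EuclideanSpace.proj a).comp (ContinuousLinearMap.fst ℝ (Fibre n)
      (ModelForms m (Fibre n) 2 m))).hasFDerivAt.comp (c.base x) hD
  let L (i : Fin m) (a : Fin n) : ModelForms m (Fibre n) 2 m →L[ℝ] ℝ :=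
    LinearMap.toContinuousLinearMap (𝕜 := ℝ) (E := ModelForms m (Fibre n) 2 m) (F' := ℝ)
      { toFun := fun β => momentumCoord β i a
        map_add' := fun _ _ => rfl
        map_smul' := fun _ _ => rfl }
  have h2 (i : Fin m) (a : Fin n) : HasFDerivAt
      (fun s : Base m => (reducedPosition c (σ.toFun (c.base.symm s)).reduce).2 i a)
      ((L i a).comp ((ContinuousLinearMap.snd ℝ (Fibre n)
        (ModelForms m (Fibre n) 2 m)).comp (jetDerivative c (σ.jet x hx)))) (c.base x) :=
    ((L i a).comp (ContinuousLinearMap.snd ℝ (Fibre n)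
      (ModelForms m (Fibre n) 2 m))).hasFDerivAt.comp (c.base x) hD
  refine Prod.ext_iff.trans (and_congr (funext_iff.trans (forall_congr' fun i =>
    funext_iff.trans (forall_congr' fun a => ?_))) (funext_iff.trans (forall_congr' fun a => ?_)))
  · rw [(h1 a).fderiv]
    exact sub_eq_zero
  · simp only [(h2 _ a).fderiv]
    exact sub_eq_zero

end HamiltonianSection

end Coordinates

end

theorem mainTheorem2 {m n : ℕ} (hm : 0 < m) {M E : Type*}
    [TopologicalSpace M] [T2Space M] [ChartedSpace (Base m) M] [IsManifold 𝓘(ℝ, Base m) ∞ M]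
    [TopologicalSpace E] [T2Space E] [ChartedSpace (Base m × Fibre n) E]
    [IsManifold 𝓘(ℝ, Base m × Fibre n) ∞ E]
    (π : E → M) [IsFibration m (Fibre n) π] (h : HamiltonianSection m (Fibre n) π) :
    (∀ τ : LocalSection m (ReducedMultimomentaFibre m (Fibre n))
        (ReducedMultimomenta.proj : ReducedMultimomenta m (Fibre n) π → M),
      h.IsCriticalPoint τ ↔
        ∀ (x : M) (hx : x ∈ τ.dom),
          flat ((h.comp τ).jet x hx) = h.negD ((h.comp τ).toFun x)) ∧
    (IsLagrangianSubmanifold h.equationSet (jetForm m (Fibre n) π) (m + 1) ∧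
      ∀ c : AdaptedChart m (Fibre n) π,
        IsLocalDefiningMap
          (V := Base m × (MultimomentaFibre m (Fibre n) ×
            (Base m →L[ℝ] MultimomentaFibre m (Fibre n))))
          h.equationSet {z | z.pt.pt ∈ c.total.source} (hamiltonMap h c) ∧
        ∀ (σ : LocalSection m (MultimomentaFibre m (Fibre n))
            (Multimomenta.proj : Multimomenta m (Fibre n) π → M)) (x : M) (hx : x ∈ σ.dom),
          (σ.toFun x).pt ∈ c.total.source →
            (hamiltonMap h c (σ.jet x hx) = 0 ↔
              HamiltonEquationsAt h c (fun y => (σ.toFun y).reduce) x)) :=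
  ⟨fun τ => h.isCriticalPoint_iff τ, h.isLagrangianSubmanifold_equationSet hm, fun c =>
    ⟨h.isLocalDefiningMap_hamiltonMap c hm, fun σ _ hx hsrc =>
      h.hamiltonMap_jet_eq_zero_iff c σ hx hsrc⟩⟩
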